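/- Let $S$ be a compact connected Riemann surface (without boundary), let $Z \subset S$ be a finite non-empty set of marked points, and let $q$ be a meromorphic quadratic differential on $S$ that has at most simple poles and all of whose zeroes and poles lie in $Z$ (points of $Z$ may also be regular points of $q$). Then the half-translation surface $(S,q)$ admits a straight triangulation, that is, a triangulation $\tau$ of $(S,Z)$ all of whose edges are saddle connections. Here a *triangulation* of $(S,Z)$ is a decomposition of $S$ as the disjoint union of the set of vertices, which is exactly $Z$, finitely many open edges and finitely many open triangles. Each open edge is the injective image of $(0,1)$ under a continuous map $[0,1] \to S$ sending $0$ and $1$ into $Z$. Each open triangle is the injective image of the interior of a closed triangle $\Delta$ under a continuous map $\Delta \to S$ which, on each side of $\Delta$, is the composition of a homeomorphism onto $[0,1]$ with the map of some edge. (The vertices, or the edges, of a single triangle are allowed to coincide in $S$.) A *saddle connection* is a path $\gamma \colon [0,1] \to S$ with $\gamma(0), \gamma(1) \in Z$ whose restriction to $(0,1)$ is injective, avoids $Z$, and is locally a straight line $t \mapsto a + tb$, $b \neq 0$, in the holomorphic charts in which $q = dz^2$; an edge *is* a saddle connection if it has the same image as such a path. -/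

import Mathlib

open scoped Manifold ContDiff Topology

namespace HalfTranslation

/-- A meromorphic quadratic differential `q` on a Riemann surface `S`: in every holomorphic chart `e`
it is written `q = coeff e (z) dz ^ 2` with `coeff e` meromorphic on the target of `e`, and the
coefficients in two charts are related by the usual transformation law.
The coefficients are in normal form (the removable singularities are removed, and the value
at a pole is `0` by convention), which makes the transformation law meaningful at every point. -/
structure QuadDiff (S : Type*) [TopologicalSpace S] [ChartedSpace ℂ S]
    [IsManifold 𝓘(ℂ) ω S] where
  /-- the coefficient of `q` in a holomorphic chart -/
  coeff : OpenPartialHomeomorph S ℂ → ℂ → ℂ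
  meromorphic : ∀ e ∈ IsManifold.maximalAtlas 𝓘(ℂ) ω S, MeromorphicNFOn (coeff e) e.target
  transform : ∀ e ∈ IsManifold.maximalAtlas 𝓘(ℂ) ω S,
    ∀ e' ∈ IsManifold.maximalAtlas 𝓘(ℂ) ω S, ∀ p ∈ e.source ∩ e'.source,
      coeff e (e p) = coeff e' (e' p) * deriv (fun z => e' (e.symm z)) (e p) ^ 2

section Surface

variable {S : Type*} [TopologicalSpace S] [ChartedSpace ℂ S] [IsManifold 𝓘(ℂ) ω S]

/-- The order of `q` at `p`: positive at a zero, negative at a pole, `0` at a regular point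
(and `⊤` if `q` vanishes identically near `p`). -/
noncomputable def QuadDiff.orderAt (q : QuadDiff S) (p : S) : WithTop ℤ :=
  meromorphicOrderAt (q.coeff (chartAt ℂ p)) (chartAt ℂ p p)

/-- The differential `q` has at most simple poles, and all of its zeroes and poles are
in the set `Z` of marked points. A marked point may be a regular point. -/
structure QuadDiff.IsMarkedBy (q : QuadDiff S) (Z : Set S) : Prop where
  neg_one_le_orderAt : ∀ p ∈ Z, -1 ≤ q.orderAt p
  orderAt_eq_zero : ∀ p ∉ Z, q.orderAt p = 0

/-- A chart of the half-translation structure of `q`: a holomorphic chart in which `q = dz ^ 2`.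
Any two of these differ by maps of the form `z ↦ ± z + c`. -/
def QuadDiff.IsFlatChart (q : QuadDiff S) (e : OpenPartialHomeomorph S ℂ) : Prop :=
  e ∈ IsManifold.maximalAtlas 𝓘(ℂ) ω S ∧ ∀ z ∈ e.target, q.coeff e z = 1

/-- The path `γ` is a straight line segment (parametrized with constant nonzero speed) over
the open interval `(0, 1)`: locally, it is a straight line in the charts of
the half-translation structure. -/
def QuadDiff.IsStraight (q : QuadDiff S) (γ : C(unitInterval, S)) : Prop :=
  ∀ t ∈ Set.Ioo (0 : unitInterval) 1, ∃ e : OpenPartialHomeomorph S ℂ,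
    q.IsFlatChart e ∧ γ t ∈ e.source ∧
      ∃ a b : ℂ, b ≠ 0 ∧ ∀ᶠ s : unitInterval in 𝓝 t, e (γ s) = a + ((s : ℝ) : ℂ) * b

/-- A saddle connection: a straight line segment with endpoints in `Z`, whose interior is embedded
in the complement of `Z`. -/
structure QuadDiff.IsSaddleConnection (q : QuadDiff S) (Z : Set S) (γ : C(unitInterval, S)) :
    Prop where
  source_mem : γ 0 ∈ Z
  target_mem : γ 1 ∈ Z
  interior_notMem : ∀ t ∈ Set.Ioo (0 : unitInterval) 1, γ t ∉ Z
  injOn_interior : Set.InjOn γ (Set.Ioo 0 1)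
  isStraight : q.IsStraight γ

end Surface

/-- The closed triangle, in barycentric coordinates. -/
abbrev Triangle : Type := stdSimplex ℝ (Fin 3)

/-- The parametrization of the side of the closed triangle opposite to the vertex `i`. -/
def side (i : Fin 3) (t : unitInterval) : Triangle :=
  ⟨fun j => if j = i then 0 else if j = i + 1 then 1 - (t : ℝ) else t, by
    constructor
    · intro j
      have h0 := t.2.1
      have h1 := t.2.2
      dsimp only
      split_ifs <;> linarith
    · fin_cases i <;> simp [Fin.sum_univ_three]⟩

/-- The open triangle. -/
def openTriangle : Set Triangle := {x | ∀ j, 0 < x.1 j}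

/-- A (topological) triangulation of `(S, Z)`: a decomposition of `S` into finitely many vertices,
open edges and open triangles, where the vertices are exactly the points of `Z`. Every
edge is the image of a closed interval, with its endpoints in `Z`, and every triangle is the image of
a closed triangle, each side of which is attached by a homeomorphism to an edge.
The three vertices of a triangle need not be distinct, and neither need its three edges. -/
structure Triangulation (S : Type*) [TopologicalSpace S] (Z : Set S) where
  /-- the collection of edges -/
  E : Type
  /-- the collection of triangles -/
  F : Type
  finite_E : Finite E
  finite_F : Finite F
  /-- the characteristic map of an edge -/
  edge : E → C(unitInterval, S)
  /-- the characteristic map of a triangle -/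
  face : F → C(Triangle, S)
  edge_source : ∀ e, edge e 0 ∈ Z
  edge_target : ∀ e, edge e 1 ∈ Z
  face_side : ∀ (f : F) (i : Fin 3), ∃ (e : E) (h : unitInterval ≃ₜ unitInterval),
    ∀ t, face f (side i t) = edge e (h t)
  /-- Every point of `S` is in exactly one of: the set of vertices, the open edges, the open
  triangles; and the characteristic maps are injective on open edges and open triangles. -/
  bijective_cells : Function.Bijective
    (Sum.elim (fun z : Z => (z : S))
      (Sum.elim (fun x : E × Set.Ioo (0 : unitInterval) 1 => edge x.1 x.2)
        (fun x : F × openTriangle => face x.1 x.2)))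

/-- A triangulation is straight if its edges are saddle connections. -/
def Triangulation.IsStraight {S : Type*} [TopologicalSpace S] [ChartedSpace ℂ S]
    [IsManifold 𝓘(ℂ) ω S] {Z : Set S} (τ : Triangulation S Z) (q : QuadDiff S) : Prop :=
  ∀ e : τ.E, ∃ γ : C(unitInterval, S),
    q.IsSaddleConnection Z γ ∧ Set.range γ = Set.range (τ.edge e)

end HalfTranslation

namespace HalfTranslation

open Set Filter Metric

/-! ### Holomorphic charts and local biholomorphisms -/

section Charts

variable {S : Type*} [TopologicalSpace S] [ChartedSpace ℂ S]

/-! The triangulation is a Delaunay triangulation of the flat metric. Away from `Z` there are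
coordinates with `q = dz ^ 2`, unique up to `z ↦ ± z + c`, so the germ of a flat map from `ℂ` to `S`
continues uniquely over convex sets until marked points obstruct it. Around every unmarked point
there is a largest disc with a flat map to `S` that sends its centre to that point; the disc is
immersed and may overlap itself in `S`. Radii are bounded (`exists_radius_bound`), so its boundary
circle carries singular points, where the map does not extend flatly. There it tends to marked
points (`FlatOn.boundary`), and the normal form of `q` at marked points (`exists_isConeModel`) keeps
singular points a definite distance apart, hence finite in number. The convex hull of these points
is cut into triangles without new vertices (`exists_isPlanarTriangulation`). The cells are the
images in `S` of the open edges and triangles of these polygons, for one chosen disc per unmarked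
centre.

Two cells that meet are equal (`MaxDisc.align_cells`). Draw both discs in one plane. The difference
of the powers of a point with respect to the two circles is affine, and neither disc contains a
singular point of the other, so this affine function has opposite weak signs on the two vertex sets.
A common point of the two relative interiors forces it to vanish at all vertices, which thus lie on
both circles. Different circles share at most two points, so both cells are the same chord; equal
circles belong to the same chosen polygon.

The cells cover the complement of `Z` (`IsDiscSystem.exists_mem_cell`): among the developed discs of
centre `k` and radius `r` containing a point `a`, take one that maximizes `r ^ 2 - ‖a - k‖ ^ 2`. If
`a` were outside the hull of the singular points, pushing the centre away from them would increase
this quantity (`mem_convexHull_of_max`).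

There are finitely many cells (`finite_cells`): the barycentre of a cell is the centre of a ball of
definite radius inside its disc, so it stays away from `Z`, and the cells with barycentre near a
given point can all be drawn in one developed picture with vertices in a finite set. Compactness
concludes. -/

theorem mem_contDiffGroupoid_of_contDiffOn (G : OpenPartialHomeomorph ℂ ℂ)
    (h₁ : ContDiffOn ℂ ω G G.source) (h₂ : ContDiffOn ℂ ω G.symm G.target) :
    G ∈ contDiffGroupoid ω 𝓘(ℂ) := by
  rw [contDiffGroupoid, mem_groupoid_of_pregroupoid]
  constructor
  · simpa [contDiffPregroupoid] using h₁
  · simpa [contDiffPregroupoid] using h₂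

theorem contDiffOn_of_mem_contDiffGroupoid {G : OpenPartialHomeomorph ℂ ℂ}
    (h : G ∈ contDiffGroupoid ω 𝓘(ℂ)) : ContDiffOn ℂ ω G G.source := by
  rw [contDiffGroupoid, mem_groupoid_of_pregroupoid] at h
  simpa [contDiffPregroupoid] using h.1

theorem trans_mem_maximalAtlas {e : OpenPartialHomeomorph S ℂ}
    (he : e ∈ IsManifold.maximalAtlas 𝓘(ℂ) ω S) {G : OpenPartialHomeomorph ℂ ℂ}
    (hG : G ∈ contDiffGroupoid ω 𝓘(ℂ)) : e.trans G ∈ IsManifold.maximalAtlas 𝓘(ℂ) ω S := by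
  intro e' he'
  obtain ⟨h₁, h₂⟩ := he e' he'
  constructor
  · rw [OpenPartialHomeomorph.trans_symm_eq_symm_trans_symm, OpenPartialHomeomorph.trans_assoc]
    exact (contDiffGroupoid ω 𝓘(ℂ)).trans ((contDiffGroupoid ω 𝓘(ℂ)).symm hG) h₁
  · rw [← OpenPartialHomeomorph.trans_assoc]
    exact (contDiffGroupoid ω 𝓘(ℂ)).trans h₂ hG

/-- An analytic function with nonvanishing derivative is locally a biholomorphism; its source may be
taken inside any given neighbourhood. -/
theorem exists_biholomorphism_of_deriv_ne_zero {M : ℂ → ℂ} {ζ : ℂ} (hM : AnalyticAt ℂ M ζ)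
    (hd : deriv M ζ ≠ 0) {U : Set ℂ} (hU : U ∈ 𝓝 ζ) :
    ∃ G : OpenPartialHomeomorph ℂ ℂ, G ∈ contDiffGroupoid ω 𝓘(ℂ) ∧ ⇑G = M ∧ ζ ∈ G.source ∧
      G.source ⊆ U := by
  have hs := hM.hasStrictDerivAt.hasStrictFDerivAt_equiv hd
  set G₀ := hs.toOpenPartialHomeomorph M with hG₀
  have hG₀c : ⇑G₀ = M := hs.toOpenPartialHomeomorph_coe
  have hev : ∀ᶠ z in 𝓝 ζ, z ∈ U ∧ AnalyticAt ℂ M z ∧ deriv M z ≠ 0 :=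
    (eventually_mem_set.2 hU).and
      (hM.eventually_analyticAt.and (hM.deriv.continuousAt.eventually_ne hd))
  obtain ⟨V, hV, hVo, hζV⟩ := _root_.eventually_nhds_iff.1 hev
  refine ⟨G₀.restrOpen V hVo, mem_contDiffGroupoid_of_contDiffOn _ ?_ ?_, ?_, ?_, ?_⟩
  · intro z hz
    have hz' : z ∈ V := hz.2
    have : AnalyticAt ℂ M z := (hV z hz').2.1
    show ContDiffWithinAt ℂ ω G₀ _ z
    rw [hG₀c]
    exact this.contDiffAt.contDiffWithinAt
  · intro w hw
    have hz := (G₀.restrOpen V hVo).map_target hw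
    have hz' : G₀.symm w ∈ V := hz.2
    have hz'' : G₀.symm w ∈ G₀.source := hz.1
    have hw' : w ∈ G₀.target := hw.1
    have hA := (hV _ hz').2.1
    have : ContDiffAt ℂ ω G₀.symm w := by
      refine G₀.contDiffAt_symm_deriv (hV _ hz').2.2 hw' ?_ ?_
      · rw [hG₀c]; exact hA.differentiableAt.hasDerivAt
      · rw [hG₀c]; exact hA.contDiffAt
    exact this.contDiffWithinAt
  · exact hG₀c
  · exact ⟨hs.mem_toOpenPartialHomeomorph_source, hζV⟩
  · exact fun z hz => (hV z hz.2).1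

end Charts

/-! ### Flat maps: alignment and unique continuation -/

section Flat

variable {S : Type*} [TopologicalSpace S] [ChartedSpace ℂ S] [IsManifold 𝓘(ℂ) ω S]
  {q : QuadDiff S} {Z : Set S} {f g : ℂ → S} {a b z : ℂ}

/-- The map `f` is, near `z`, the inverse of a flat chart, and `f z` is not a marked point. -/
def FlatAt (q : QuadDiff S) (Z : Set S) (f : ℂ → S) (z : ℂ) : Prop :=
  ∃ e : OpenPartialHomeomorph S ℂ, q.IsFlatChart e ∧ z ∈ e.target ∧ f =ᶠ[𝓝 z] e.symm ∧ f z ∉ Z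

theorem FlatAt.congr (h : FlatAt q Z f z) (hfg : g =ᶠ[𝓝 z] f) : FlatAt q Z g z := by
  obtain ⟨e, he, hz, hf, hfz⟩ := h
  exact ⟨e, he, hz, hfg.trans hf, by rwa [hfg.eq_of_nhds]⟩

theorem FlatAt.notMem (h : FlatAt q Z f z) : f z ∉ Z := h.choose_spec.2.2.2

theorem FlatAt.continuousAt (h : FlatAt q Z f z) : ContinuousAt f z := by
  obtain ⟨e, he, hz, hf, hfz⟩ := h
  exact (e.continuousAt_symm hz).congr hf.symm

theorem FlatAt.eventually (hZ : IsClosed Z) (h : FlatAt q Z f z) :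
    ∀ᶠ w in 𝓝 z, FlatAt q Z f w := by
  have hc := h.continuousAt.eventually_mem (hZ.isOpen_compl.mem_nhds h.notMem)
  obtain ⟨e, he, hz, hf, hfz⟩ := h
  filter_upwards [hc, eventually_eventually_nhds.2 hf, e.open_target.mem_nhds hz] with w h₁ h₂ h₃
  exact ⟨e, he, h₃, h₂, h₁⟩

theorem FlatAt.exists_injOn (h : FlatAt q Z f z) : ∃ U ∈ 𝓝 z, InjOn f U := by
  obtain ⟨e, he, hz, hf, hfz⟩ := h
  refine ⟨{w | f w = e.symm w} ∩ e.target, inter_mem hf (e.open_target.mem_nhds hz), ?_⟩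
  intro x hx y hy hxy
  rw [hx.1, hy.1] at hxy
  exact e.symm.injOn hx.2 hy.2 hxy

theorem FlatAt.image_mem_nhds (h : FlatAt q Z f z) {U : Set ℂ} (hU : U ∈ 𝓝 z) :
    f '' U ∈ 𝓝 (f z) := by
  obtain ⟨e, he, hz, hf, hfz⟩ := h
  rw [hf.eq_of_nhds]
  have := e.symm.image_mem_nhds hz (inter_mem hU hf)
  refine mem_of_superset this ?_
  rintro _ ⟨w, ⟨hw, hw'⟩, rfl⟩
  exact ⟨w, hw, hw'⟩

theorem sq_eq_one_imp {x : ℂ} (h : x ^ 2 = 1) : x = 1 ∨ x = -1 := by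
  rw [← one_pow 2] at h
  exact sq_eq_sq_iff_eq_or_eq_neg.1 h

/-- Solutions of the differential equation of flat coordinates are flat. -/
theorem flatAt_of_deriv {e : OpenPartialHomeomorph S ℂ}
    (he : e ∈ IsManifold.maximalAtlas 𝓘(ℂ) ω S) {M : ℂ → ℂ} {ζ : ℂ} (hM : AnalyticAt ℂ M ζ)
    (hMe : M ζ ∈ e.target) (hode : ∀ᶠ w in 𝓝 ζ, q.coeff e (M w) * deriv M w ^ 2 = 1)
    (hζ : e.symm (M ζ) ∉ Z) : FlatAt q Z (fun w => e.symm (M w)) ζ := by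
  have hd : deriv M ζ ≠ 0 := by
    intro h
    simpa [h] using hode.self_of_nhds
  obtain ⟨G, hG, hGM, hζG, hGU⟩ := exists_biholomorphism_of_deriv_ne_zero hM hd
    (inter_mem hode (hM.continuousAt.preimage_mem_nhds (e.open_target.mem_nhds hMe)))
  -- The flat chart is `e` followed by the local inverse of `M`; by the transformation law its
  -- coefficient is the left side of the differential equation.
  have hme : e.trans G.symm ∈ IsManifold.maximalAtlas 𝓘(ℂ) ω S :=
    trans_mem_maximalAtlas he ((contDiffGroupoid ω 𝓘(ℂ)).symm hG)
  have hsymm : ∀ w, (e.trans G.symm).symm w = e.symm (M w) := by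
    intro w; rw [← hGM]; rfl
  refine ⟨e.trans G.symm, ⟨hme, ?_⟩, ?_, ?_, hζ⟩
  · intro w hw
    have hw₁ : w ∈ G.source := by
      have := hw.1; simpa using this
    have hp : (e.trans G.symm).symm w ∈ (e.trans G.symm).source ∩ e.source :=
      ⟨(e.trans G.symm).map_target hw, ((e.trans G.symm).map_target hw).1⟩
    have := q.transform _ hme _ he _ hp
    rw [(e.trans G.symm).right_inv hw] at this
    rw [this]
    have h₁ : ∀ᶠ v in 𝓝 w, e ((e.trans G.symm).symm v) = M v := by
      filter_upwards [G.open_source.mem_nhds hw₁] with v hv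
      rw [hsymm]
      exact e.right_inv (hGU hv).2
    rw [h₁.self_of_nhds, EventuallyEq.deriv_eq h₁]
    exact (hGU hw₁).1
  · constructor
    · simpa using hζG
    · have : M ζ ∈ e.target := hMe
      rw [← hGM] at this
      simpa using this
  · exact Eventually.of_forall fun w => (hsymm w).symm

theorem FlatAt.comp_affine {ε c : ℂ} (hε : ε ^ 2 = 1)
    (h : FlatAt q Z f (ε * z + c)) : FlatAt q Z (fun w => f (ε * w + c)) z := by
  obtain ⟨e, he, hz, hf, hfz⟩ := h
  have hM : AnalyticAt ℂ (fun w : ℂ => ε * w + c) z := by fun_prop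
  have hder : ∀ w, deriv (fun w : ℂ => ε * w + c) w = ε := by
    intro w
    rw [deriv_add_const, deriv_const_mul_id']
  have := flatAt_of_deriv (q := q) (Z := Z) he.1 hM hz ?_ (by rw [← hf.eq_of_nhds]; exact hfz)
  · exact this.congr (hM.continuousAt.tendsto.eventually hf)
  · filter_upwards [hM.continuousAt.preimage_mem_nhds (e.open_target.mem_nhds hz)] with w hw
    rw [hder, he.2 _ hw, hε, one_mul]

/-- Two flat maps with a common value differ by `z ↦ ± z + c` near the corresponding points. -/
theorem FlatAt.align (hf : FlatAt q Z f a) (hg : FlatAt q Z g b) (hab : f a = g b) :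
    ∃ ε : ℂ, (ε = 1 ∨ ε = -1) ∧ ∀ᶠ z in 𝓝 b, g z = f (ε * (z - b) + a) := by
  obtain ⟨e₁, he₁, ha, hf, hfa⟩ := hf
  obtain ⟨e₂, he₂, hb, hg, hgb⟩ := hg
  have hp : e₂.symm b = e₁.symm a := by rw [← hf.eq_of_nhds, ← hg.eq_of_nhds, hab]
  set T : ℂ → ℂ := fun z => e₁ (e₂.symm z) with hT
  have hTb : T b = a := by simp only [hT]; rw [hp, e₁.right_inv ha]
  have hsrc : (e₂.symm.trans e₁).source ∈ 𝓝 b := by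
    refine (e₂.symm.trans e₁).open_source.mem_nhds ?_
    refine ⟨hb, ?_⟩
    show e₂.symm b ∈ e₁.source
    rw [hp]; exact e₁.map_target ha
  have hTd : ContDiffOn ℂ ω T (e₂.symm.trans e₁).source :=
    contDiffOn_of_mem_contDiffGroupoid
      (IsManifold.compatible_of_mem_maximalAtlas he₂.1 he₁.1)
  have hTan : AnalyticAt ℂ T b := (hTd.contDiffAt hsrc).analyticAt
  have hsq : ∀ z ∈ (e₂.symm.trans e₁).source, deriv T z ^ 2 = 1 := by
    intro z hz
    have hz₂ : z ∈ e₂.target := hz.1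
    have hz₁ : e₂.symm z ∈ e₁.source := hz.2
    have := q.transform _ he₂.1 _ he₁.1 (e₂.symm z) ⟨e₂.map_target hz₂, hz₁⟩
    rw [e₂.right_inv hz₂, he₂.2 _ hz₂, he₁.2 _ (e₁.map_source hz₁), one_mul] at this
    exact this.symm
  have hε : deriv T b = 1 ∨ deriv T b = -1 := sq_eq_one_imp (hsq b (mem_of_mem_nhds hsrc))
  refine ⟨deriv T b, hε, ?_⟩
  -- The derivative of the transition map is continuous with values `± 1`, hence locally constant.
  have hball : ∀ᶠ z in 𝓝 b, DifferentiableAt ℂ T z ∧ deriv T z = deriv T b := by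
    have h1 : ∀ᶠ z in 𝓝 b, dist (deriv T z) (deriv T b) < 1 :=
      hTan.deriv.continuousAt.eventually (Metric.ball_mem_nhds _ one_pos)
    filter_upwards [h1, hsrc, hTan.eventually_analyticAt] with z h1 h2 h3
    refine ⟨h3.differentiableAt, ?_⟩
    have h4 : deriv T z = 1 ∨ deriv T z = -1 := sq_eq_one_imp (hsq z h2)
    rw [dist_eq_norm] at h1
    rcases hε with h | h <;> rcases h4 with h' | h' <;> rw [h, h'] at h1 ⊢ <;> norm_num at h1
  obtain ⟨r, hr, hball⟩ := Metric.eventually_nhds_iff_ball.1 hball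
  have hlin : ∀ z ∈ ball b r, T z = deriv T b * (z - b) + a := by
    intro z hz
    have := (convex_ball b r).is_const_of_fderivWithin_eq_zero (𝕜 := ℂ)
      (f := fun z => T z - deriv T b * (z - b)) ?_ ?_ hz (mem_ball_self hr)
    · simp only [sub_self, mul_zero, sub_zero, hTb] at this
      rw [← this]; ring
    · intro w hw
      exact ((hball w hw).1.sub (by fun_prop)).differentiableWithinAt
    · intro w hw
      have hd : HasDerivAt (fun z => T z - deriv T b * (z - b)) 0 w := by
        have h1 := (hball w hw).1.hasDerivAt
        rw [(hball w hw).2] at h1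
        have h2 : HasDerivAt (fun z => deriv T b * (z - b)) (deriv T b) w := by
          simpa using ((hasDerivAt_id w).sub_const b).const_mul (deriv T b)
        exact (h1.sub h2).congr_deriv (sub_self _)
      rw [fderivWithin_of_isOpen isOpen_ball hw]
      have := hd.hasFDerivAt.fderiv
      rw [this]; simp
  have hcont : ContinuousAt T b := hTan.continuousAt
  have hfT : ∀ᶠ z in 𝓝 b, f (T z) = e₁.symm (T z) := by
    have := hcont.tendsto
    rw [hTb] at this
    exact this.eventually hf
  filter_upwards [hfT, hg, hsrc, Metric.ball_mem_nhds b hr] with z h1 h2 h3 h4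
  rw [← hlin z h4, h1, h2]
  exact (e₁.left_inv h3.2).symm

/-- Unique continuation for flat maps. -/
theorem FlatAt.eventuallyEq_of_isPreconnected [T2Space S] {T : Set ℂ} (hT : IsPreconnected T)
    (hf : ∀ z ∈ T, FlatAt q Z f z) (hg : ∀ z ∈ T, FlatAt q Z g z) (ha : a ∈ T)
    (hfg : f =ᶠ[𝓝 a] g) (hz : z ∈ T) : f =ᶠ[𝓝 z] g := by
  have hU : IsOpen {z | f =ᶠ[𝓝 z] g} := isOpen_setOfPred_eventually_nhds
  refine hT.subset_of_closure_inter_subset hU ⟨a, ha, hfg⟩ ?_ hz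
  rintro w ⟨hwc, hwT⟩
  have hfr : ∃ᶠ x in 𝓝 w, f =ᶠ[𝓝 x] g := mem_closure_iff_frequently.1 hwc
  -- At a limit of agreement points the values agree because `S` is Hausdorff, so the two maps can
  -- be aligned there. The sign `-1` would contradict local injectivity at nearby points where the
  -- germs agree.
  have heq : f w = g w := by
    by_contra hne
    have := (hf w hwT).continuousAt.prodMk (hg w hwT).continuousAt
    have hopen : {p : S × S | p.1 ≠ p.2} ∈ 𝓝 (f w, g w) :=
      (isClosed_diagonal.isOpen_compl).mem_nhds (by simpa using hne)
    have hev := this.eventually_mem hopen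
    obtain ⟨x, hx, hx'⟩ := (hfr.and_eventually hev).exists
    exact hx' hx.eq_of_nhds
  obtain ⟨ε, hε, hal⟩ := (hf w hwT).align (hg w hwT) heq
  rcases hε with rfl | rfl
  · show f =ᶠ[𝓝 w] g
    filter_upwards [hal] with x hx
    rw [hx]; congr 1; ring
  · exfalso
    obtain ⟨V, hV, hinj⟩ := (hf w hwT).exists_injOn
    have hrefl : ∀ᶠ x in 𝓝 w, -1 * (x - w) + w ∈ V := by
      have hc : ContinuousAt (fun x : ℂ => -1 * (x - w) + w) w := by fun_prop
      refine hc.eventually_mem ?_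
      simpa using hV
    obtain ⟨x, hx, hA⟩ := (hfr.and_eventually (eventually_eventually_nhds.2
      (hal.and (hrefl.and (eventually_mem_set.2 hV))))).exists
    have key : ∀ᶠ y in 𝓝 x, y = w := by
      filter_upwards [hx, hA] with y h0 ⟨h1, h2, h3⟩
      have := hinj h3 h2 (h0.trans h1)
      linear_combination this / 2
    obtain ⟨y, hy, hyx⟩ := ((key.filter_mono (nhdsWithin_le_nhds (s := {x}ᶜ))).and
      self_mem_nhdsWithin).exists
    exact hyx (hy.trans key.self_of_nhds.symm)

end Flat

/-! ### Roots, primitives and inverses of analytic functions -/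

section Analytic

/-- Dividing by `g z₀` brings the values near `1`, where the principal logarithm is analytic. -/
theorem exists_analyticAt_pow_eq {g : ℂ → ℂ} {z₀ : ℂ} (hg : AnalyticAt ℂ g z₀) (h0 : g z₀ ≠ 0)
    {n : ℕ} (hn : 0 < n) : ∃ h : ℂ → ℂ, AnalyticAt ℂ h z₀ ∧ ∀ᶠ z in 𝓝 z₀, h z ^ n = g z := by
  obtain ⟨s, hs⟩ := IsAlgClosed.exists_pow_nat_eq (g z₀) hn
  have hmem : g z₀ / g z₀ ∈ Complex.slitPlane := by simp [div_self h0]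
  have hdiv : AnalyticAt ℂ (fun z => g z / g z₀) z₀ := hg.div_const
  refine ⟨fun z => s * Complex.exp (Complex.log (g z / g z₀) / n), ?_, ?_⟩
  · have := hdiv.clog hmem
    fun_prop
  · filter_upwards [hg.continuousAt.eventually_ne h0] with z hz
    rw [mul_pow, hs, ← Complex.exp_nat_mul, mul_div_cancel₀ _ (by exact_mod_cast hn.ne'),
      Complex.exp_log (div_ne_zero hz h0), mul_div_cancel₀ _ h0]

theorem exists_primitive {h : ℂ → ℂ} {z₀ : ℂ} (hh : AnalyticAt ℂ h z₀) :
    ∃ F : ℂ → ℂ, AnalyticAt ℂ F z₀ ∧ F z₀ = 0 ∧ ∀ᶠ z in 𝓝 z₀, HasDerivAt F (h z) z := by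
  obtain ⟨r, hr, hball⟩ := Metric.eventually_nhds_iff_ball.1 hh.eventually_analyticAt
  have hd : DifferentiableOn ℂ h (ball z₀ r) :=
    fun z hz => (hball z hz).differentiableAt.differentiableWithinAt
  obtain ⟨F, hF0, hF⟩ := hd.isExactOn_ball.with_val_at z₀ 0
  refine ⟨F, ?_, hF0, ?_⟩
  · have : DifferentiableOn ℂ F (ball z₀ r) :=
      fun z hz => (hF z hz).differentiableAt.differentiableWithinAt
    exact this.analyticAt (ball_mem_nhds _ hr)
  · filter_upwards [ball_mem_nhds z₀ hr] with z hz using hF z hz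

theorem exists_analytic_inverse {F : ℂ → ℂ} {z₀ : ℂ} (hF : AnalyticAt ℂ F z₀)
    (hd : deriv F z₀ ≠ 0) : ∃ I : ℂ → ℂ, AnalyticAt ℂ I (F z₀) ∧ I (F z₀) = z₀ ∧
      (∀ᶠ ζ in 𝓝 (F z₀), F (I ζ) = ζ) ∧ ∀ᶠ z in 𝓝 z₀, I (F z) = z :=
  ⟨_, hF.analyticAt_localInverse hd, HasStrictFDerivAt.localInverse_apply_image ..,
    HasStrictDerivAt.eventually_right_inverse .., HasStrictDerivAt.eventually_left_inverse ..⟩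

end Analytic

/-! ### Local models at unmarked and at marked points -/

section Existence

variable {S : Type*} [TopologicalSpace S] [ChartedSpace ℂ S] [IsManifold 𝓘(ℂ) ω S]
  {q : QuadDiff S} {Z : Set S}

theorem QuadDiff.coeff_ne_zero_of_orderAt_eq_zero {p : S} (hp : q.orderAt p = 0) :
    q.coeff (chartAt ℂ p) (chartAt ℂ p p) ≠ 0 := by
  have h := q.meromorphic _ (IsManifold.chart_mem_maximalAtlas (I := 𝓘(ℂ)) (n := ω) p)
    (mem_chart_target ℂ p)
  exact h.meromorphicOrderAt_eq_zero_iff.1 hp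

/-- The flat coordinate is the primitive of a square root of the coefficient, and the flat map is
its inverse. -/
theorem exists_flatAt (hq : q.IsMarkedBy Z) {p : S} (hp : p ∉ Z) :
    ∃ f : ℂ → S, FlatAt q Z f 0 ∧ f 0 = p := by
  have hmem := IsManifold.chart_mem_maximalAtlas (I := 𝓘(ℂ)) (n := ω) p
  set e := chartAt ℂ p
  have hsrc : p ∈ e.source := mem_chart_source ℂ p
  have hord := hq.orderAt_eq_zero p hp
  have hne := QuadDiff.coeff_ne_zero_of_orderAt_eq_zero hord
  have han : AnalyticAt ℂ (q.coeff e) (e p) := by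
    have h := q.meromorphic _ hmem (mem_chart_target ℂ p)
    exact h.meromorphicOrderAt_nonneg_iff_analyticAt.1 (le_of_eq hord.symm)
  obtain ⟨h, hh, hsq⟩ := exists_analyticAt_pow_eq han hne two_pos
  obtain ⟨F, hF, hF0, hFd⟩ := exists_primitive hh
  have hh0 : h (e p) ≠ 0 := by
    intro h0
    have := hsq.self_of_nhds
    rw [h0] at this
    exact hne (by rw [← this]; norm_num)
  have hd : deriv F (e p) ≠ 0 := by rwa [hFd.self_of_nhds.deriv]
  obtain ⟨I, hI, hI0, hFI, hIF⟩ := exists_analytic_inverse hF hd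
  rw [hF0] at hI hI0 hFI
  have hIt : Tendsto I (𝓝 0) (𝓝 (e p)) := by
    have := hI.continuousAt.tendsto
    rwa [hI0] at this
  have hval : e.symm (I 0) = p := by rw [hI0]; exact e.left_inv hsrc
  refine ⟨fun w => e.symm (I w), flatAt_of_deriv hmem hI ?_ ?_ (by rwa [hval]), hval⟩
  · rw [hI0]; exact e.map_source hsrc
  · filter_upwards [hI.eventually_analyticAt, eventually_eventually_nhds.2 hFI,
      hIt.eventually hFd, hIt.eventually hsq] with w h1 h2 h3 h4
    have h5 := h3.comp w h1.differentiableAt.hasDerivAt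
    have h6 : HasDerivAt (F ∘ I) 1 w := (hasDerivAt_id w).congr_of_eventuallyEq h2
    have h7 := h5.unique h6
    rw [← h4, ← mul_pow, h7, one_pow]

/-- The map `ψ` describes a neighbourhood of `p` as a quotient of a ball such that the
local inverses of `u ↦ u ^ n` composed with `ψ` are flat. -/
structure IsConeModel (q : QuadDiff S) (Z : Set S) (p : S) (n : ℕ) (ρ : ℝ) (ψ : ℂ → S) : Prop where
  n_pos : 0 < n
  ρ_pos : 0 < ρ
  apply_zero : ψ 0 = p
  continuousAt_zero : ContinuousAt ψ 0
  image_mem_nhds : ∀ N ∈ 𝓝 (0 : ℂ), ψ '' N ∈ 𝓝 p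
  flatAt : ∀ u : ℂ, u ≠ 0 → ∀ ζ : ℂ, ζ / u ^ n ∈ Complex.slitPlane → ‖ζ‖ < ρ ^ n →
    FlatAt q Z (fun w => ψ (u * (w / u ^ n) ^ (1 / n : ℂ))) ζ

theorem root_pow {u ζ : ℂ} (hu : u ≠ 0) {n : ℕ} (hn : 0 < n) :
    (u * (ζ / u ^ n) ^ (1 / n : ℂ)) ^ n = ζ := by
  rw [mul_pow, one_div, Complex.cpow_nat_inv_pow _ hn.ne', mul_div_cancel₀ _ (pow_ne_zero _ hu)]

/-- If `q` vanished identically near `p`, it would vanish at nearby points outside the finite set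
`Z`, where its order is `0`. -/
theorem QuadDiff.orderAt_ne_top [T2Space S] (hq : q.IsMarkedBy Z) (hZ : Z.Finite) (p : S) :
    q.orderAt p ≠ ⊤ := by
  intro htop
  have hmem := IsManifold.chart_mem_maximalAtlas (I := 𝓘(ℂ)) (n := ω) p
  have hsrc : p ∈ (chartAt ℂ p).source := mem_chart_source ℂ p
  have h0 := meromorphicOrderAt_eq_top_iff.1 htop
  have hZ' : IsClosed (Z \ {p}) := (hZ.subset sdiff_subset).isClosed
  have h1 : ∀ᶠ z in 𝓝 (chartAt ℂ p p), (chartAt ℂ p).symm z ∈ (Z \ {p})ᶜ :=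
    ((chartAt ℂ p).continuousAt_symm (mem_chart_target ℂ p)).eventually_mem
      (hZ'.isOpen_compl.mem_nhds (by
        rw [(chartAt ℂ p).left_inv hsrc]; simp))
  have h2 : ∀ᶠ z in 𝓝 (chartAt ℂ p p), z ∈ (chartAt ℂ p).target :=
    (chartAt ℂ p).open_target.mem_nhds (mem_chart_target ℂ p)
  obtain ⟨z, ⟨h0, h1, h2⟩, hz⟩ := ((h0.and ((h1.and h2).filter_mono nhdsWithin_le_nhds)).and
    self_mem_nhdsWithin).exists
  set p' := (chartAt ℂ p).symm z with hp'
  have hp's : p' ∈ (chartAt ℂ p).source := (chartAt ℂ p).map_target h2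
  have hzp : chartAt ℂ p p' = z := (chartAt ℂ p).right_inv h2
  have hne : p' ≠ p := by
    rintro h
    rw [h] at hzp
    exact hz hzp.symm
  have hnot : p' ∉ Z := fun h => h1 ⟨h, hne⟩
  have hc := QuadDiff.coeff_ne_zero_of_orderAt_eq_zero (hq.orderAt_eq_zero p' hnot)
  have ht := q.transform _ (IsManifold.chart_mem_maximalAtlas (I := 𝓘(ℂ)) (n := ω) p') _ hmem p'
    ⟨mem_chart_source ℂ p', hp's⟩
  rw [hzp, h0, zero_mul] at ht
  exact hc ht

/-- The substitution `z = z₀ + u ^ 2` makes the square root of `q` single valued and treats simple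
poles like all other points: with `q` of order `m - 1` it becomes `2 * u ^ m * h (z₀ + u ^ 2) du`.
Its primitive vanishes to order `m + 1`, so it is the power `x ^ (m + 1)` of a new coordinate `x`,
and `n = m + 1`. The model is therefore a double cover in the coordinate `z`. -/
theorem exists_isConeModel [T2Space S] (hq : q.IsMarkedBy Z) (hZ : Z.Finite) {p : S} (hp : p ∈ Z) :
    ∃ n ρ ψ, IsConeModel q Z p n ρ ψ := by
  have hmem := IsManifold.chart_mem_maximalAtlas (I := 𝓘(ℂ)) (n := ω) p
  obtain ⟨k, hk⟩ := WithTop.ne_top_iff_exists.1 (QuadDiff.orderAt_ne_top hq hZ p)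
  have hk1 := hq.neg_one_le_orderAt p hp
  rw [← hk] at hk1
  have hk2 : -1 ≤ k := WithTop.coe_le_coe.1 (hk1 : ((-1 : ℤ) : WithTop ℤ) ≤ k)
  obtain ⟨m, rfl⟩ : ∃ m : ℕ, k = m - 1 := ⟨(k + 1).toNat, by omega⟩
  have hord : meromorphicOrderAt (q.coeff (chartAt ℂ p)) (chartAt ℂ p p) = ((m : ℤ) - 1 : ℤ) :=
    hk.symm
  have hmer := (q.meromorphic _ hmem (mem_chart_target ℂ p)).meromorphicAt
  obtain ⟨g, hg, hg0, hcg⟩ := (meromorphicOrderAt_eq_int_iff hmer).1 hord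
  have hsrc : p ∈ (chartAt ℂ p).source := mem_chart_source ℂ p
  have htgt := mem_chart_target ℂ p
  set e := chartAt ℂ p
  set z₀ := e p with hz₀
  obtain ⟨h, hh, hsq⟩ := exists_analyticAt_pow_eq hg hg0 two_pos
  have hh0 : h z₀ ≠ 0 := by
    intro h0
    have := hsq.self_of_nhds
    rw [h0] at this
    exact hg0 (by rw [← this]; norm_num)
  have hs0 : z₀ + (0 : ℂ) ^ 2 = z₀ := by simp
  have hhs : AnalyticAt ℂ (fun u : ℂ => h (z₀ + u ^ 2)) 0 := by
    have : AnalyticAt ℂ h (z₀ + (0 : ℂ) ^ 2) := by rwa [hs0]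
    exact this.fun_comp (f := fun u : ℂ => z₀ + u ^ 2) (by fun_prop)
  obtain ⟨F, hF, hF0, hFd⟩ := exists_primitive
    (h := fun u : ℂ => 2 * u ^ m * h (z₀ + u ^ 2)) (z₀ := 0) (AnalyticAt.mul (by fun_prop) hhs)
  have hFord : analyticOrderAt F 0 = ((m + 1 : ℕ) : ℕ∞) := by
    have h1 := hF.analyticOrderAt_deriv_add_one
    have h2 : analyticOrderAt (deriv F) 0 = (m : ℕ∞) := by
      rw [hF.deriv.analyticOrderAt_eq_natCast]
      refine ⟨fun u => 2 * h (z₀ + u ^ 2), analyticAt_const.mul hhs, by simpa using hh0, ?_⟩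
      filter_upwards [hFd] with u hu
      rw [hu.deriv, smul_eq_mul]; ring
    rw [h2, show (fun x => F x - F 0) = F by simp [hF0]] at h1
    rw [← h1]; push_cast; rfl
  obtain ⟨K, hK, hK0, hFK⟩ := (hF.analyticOrderAt_eq_natCast).1 hFord
  obtain ⟨G, hG, hGK⟩ := exists_analyticAt_pow_eq hK hK0 m.succ_pos
  have hG0 : G 0 ≠ 0 := by
    intro h0
    have := hGK.self_of_nhds
    rw [h0] at this
    exact hK0 (by rw [← this]; simp)
  have hU : AnalyticAt ℂ (fun u => u * G u) 0 := by fun_prop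
  have hUd : deriv (fun u => u * G u) 0 ≠ 0 := by
    have := (hasDerivAt_id (0 : ℂ)).mul hG.differentiableAt.hasDerivAt
    have h2 := this.deriv
    simp only [id, one_mul, zero_mul, add_zero] at h2
    have h3 : deriv (fun u => u * G u) 0 = G 0 := h2
    rw [h3]; exact hG0
  obtain ⟨I, hI, hI0, hUI, hIU⟩ := exists_analytic_inverse hU hUd
  simp only [zero_mul] at hI hI0 hUI
  have hIt : Tendsto I (𝓝 0) (𝓝 0) := by
    have := hI.continuousAt.tendsto
    rwa [hI0] at this
  have hFI : ∀ᶠ x in 𝓝 (0 : ℂ), F (I x) = x ^ (m + 1) := by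
    filter_upwards [hIt.eventually hFK, hIt.eventually hGK, hUI] with x h1 h2 h3
    rw [h1, ← h2, sub_zero, smul_eq_mul, ← mul_pow, h3]
  have hzt : Tendsto (fun x => z₀ + I x ^ 2) (𝓝 0) (𝓝 z₀) := by
    have : Tendsto (fun x => z₀ + I x ^ 2) (𝓝 0) (𝓝 (z₀ + 0 ^ 2)) :=
      tendsto_const_nhds.add (hIt.pow 2)
    rwa [hs0] at this
  have hcg' : ∀ᶠ z in 𝓝 z₀, z ≠ z₀ → q.coeff e z = (z - z₀) ^ ((m : ℤ) - 1) * g z :=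
    eventually_nhdsWithin_iff.1 hcg
  have hZ' : IsClosed (Z \ {p}) := (hZ.subset sdiff_subset).isClosed
  have hnZ : ∀ᶠ z in 𝓝 z₀, z ≠ z₀ → e.symm z ∉ Z := by
    have h1 : ∀ᶠ z in 𝓝 z₀, e.symm z ∈ (Z \ {p})ᶜ :=
      (e.continuousAt_symm htgt).eventually_mem (hZ'.isOpen_compl.mem_nhds (by
        rw [e.left_inv hsrc]; simp))
    filter_upwards [h1, e.open_target.mem_nhds htgt] with z h1 h2 h3 h4
    refine h1 ⟨h4, ?_⟩
    rintro (h5 : e.symm z = p)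
    apply h3
    rw [hz₀, ← h5, e.right_inv h2]
  obtain ⟨ρ, hρ, hball⟩ := Metric.eventually_nhds_iff_ball.1
    (hI.eventually_analyticAt.and ((hIt.eventually hFd).and
    ((eventually_eventually_nhds.2 hFI).and ((hzt.eventually hcg').and
    ((hzt.eventually hsq).and ((hzt.eventually hnZ).and
    ((hzt.eventually (e.open_target.mem_nhds htgt)).and hUI)))))))
  refine ⟨m + 1, ρ, fun x => e.symm (z₀ + I x ^ 2), m.succ_pos, hρ, ?_, ?_, ?_, ?_⟩
  · simp only [hI0, hs0]; exact e.left_inv hsrc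
  · have : ContinuousAt e.symm (z₀ + I 0 ^ 2) := by
      rw [hI0, hs0]; exact e.continuousAt_symm htgt
    exact ContinuousAt.comp (f := fun x => z₀ + I x ^ 2) this
      (continuousAt_const.add (hI.continuousAt.pow 2))
  · intro N hN
    have h1 : ∀ᶠ u in 𝓝 (0 : ℂ), I (u * G u) = u ∧ u * G u ∈ N := by
      refine hIU.and (hU.continuousAt.eventually_mem ?_)
      simpa using hN
    obtain ⟨δ, hδ, hb⟩ := Metric.eventually_nhds_iff_ball.1 h1
    have h2 : ball z₀ (δ ^ 2) ∩ e.target ∈ 𝓝 z₀ :=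
      inter_mem (ball_mem_nhds _ (by positivity)) (e.open_target.mem_nhds htgt)
    have h3 := e.symm.image_mem_nhds (x := z₀) htgt h2
    rw [e.left_inv hsrc] at h3
    refine mem_of_superset h3 ?_
    rintro _ ⟨z, ⟨hz1, hz2⟩, rfl⟩
    -- Every `z` near `z₀` has a small square root of `z - z₀`, so the double cover is onto a
    -- neighbourhood.
    obtain ⟨u, hu⟩ := IsAlgClosed.exists_pow_nat_eq (z - z₀) two_pos
    have hub : u ∈ ball (0 : ℂ) δ := by
      rw [mem_ball_zero_iff]
      rw [mem_ball, dist_eq_norm, ← hu, norm_pow] at hz1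
      exact lt_of_pow_lt_pow_left₀ 2 hδ.le hz1
    refine ⟨u * G u, (hb u hub).2, ?_⟩
    show e.symm (z₀ + I (u * G u) ^ 2) = e.symm z
    rw [(hb u hub).1, hu]; congr 1; ring
  · intro u₀ hu₀ ζ hζ hζρ
    -- The branch of the root on a slit plane that takes `u₀ ^ (m + 1)` to `u₀`.
    set J : ℂ → ℂ := fun w => u₀ * (w / u₀ ^ (m + 1)) ^ (1 / (m + 1 : ℕ) : ℂ) with hJ
    have hJpow : ∀ w, J w ^ (m + 1) = w := fun w => root_pow hu₀ m.succ_pos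
    have hJball : ∀ w : ℂ, ‖w‖ < ρ ^ (m + 1) → J w ∈ ball (0 : ℂ) ρ := by
      intro w hw
      rw [mem_ball_zero_iff]
      rw [← hJpow w, norm_pow] at hw
      exact lt_of_pow_lt_pow_left₀ _ hρ.le hw
    have hJan : ∀ w : ℂ, w / u₀ ^ (m + 1) ∈ Complex.slitPlane → AnalyticAt ℂ J w := by
      intro w hw
      have : AnalyticAt ℂ (fun w : ℂ => (w / u₀ ^ (m + 1)) ^ (1 / (m + 1 : ℕ) : ℂ)) w :=
        AnalyticAt.cpow (analyticAt_id.div_const) analyticAt_const hw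
      exact analyticAt_const.mul this
    have hNan : ∀ w : ℂ, w / u₀ ^ (m + 1) ∈ Complex.slitPlane → ‖w‖ < ρ ^ (m + 1) →
        AnalyticAt ℂ (fun w => I (J w)) w := fun w h1 h2 =>
      (hball _ (hJball w h2)).1.fun_comp (hJan w h1)
    have hN0 : ∀ w : ℂ, w / u₀ ^ (m + 1) ∈ Complex.slitPlane → ‖w‖ < ρ ^ (m + 1) →
        I (J w) ≠ 0 := by
      intro w h1 h2 h3
      have h4 := (hball _ (hJball w h2)).2.2.2.2.2.2.2
      rw [h3, zero_mul] at h4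
      have h5 := hJpow w
      rw [← h4, zero_pow (by omega)] at h5
      rw [← h5] at h1
      simp at h1
    have hMne : ∀ w : ℂ, w / u₀ ^ (m + 1) ∈ Complex.slitPlane → ‖w‖ < ρ ^ (m + 1) →
        z₀ + I (J w) ^ 2 ≠ z₀ := by
      intro w h1 h2 h3
      have := hN0 w h1 h2
      simp at h3
      exact this h3
    have hO : ∀ᶠ w in 𝓝 ζ, w / u₀ ^ (m + 1) ∈ Complex.slitPlane ∧ ‖w‖ < ρ ^ (m + 1) := by
      have c1 : ContinuousAt (fun w : ℂ => w / u₀ ^ (m + 1)) ζ := by fun_prop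
      exact (c1.eventually_mem (Complex.isOpen_slitPlane.mem_nhds hζ)).and
        (continuous_norm.continuousAt.eventually_lt continuousAt_const hζρ)
    refine flatAt_of_deriv (M := fun w => z₀ + I (J w) ^ 2) hmem ?_ ?_ ?_ ?_
    · exact analyticAt_const.add ((hNan ζ hζ hζρ).pow 2)
    · exact (hball _ (hJball ζ hζρ)).2.2.2.2.2.2.1
    · filter_upwards [hO] with w ⟨h1, h2⟩
      obtain ⟨b1, b2, b3, b4, b5, b6, b7, b8⟩ := hball _ (hJball w h2)
      have hNd := (hNan w h1 h2).differentiableAt.hasDerivAt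
      set N' := deriv (fun w => I (J w)) w
      have h3 := HasDerivAt.comp w (h := fun w => I (J w)) b2 hNd
      have h4 : HasDerivAt (F ∘ fun w => I (J w)) 1 w := by
        refine (hasDerivAt_id w).congr_of_eventuallyEq ?_
        filter_upwards [(hJan w h1).continuousAt.eventually b3] with v hv
        show F (I (J v)) = v
        rw [hv, hJpow]
      have h5 := h3.unique h4
      have h6 : deriv (fun w => z₀ + I (J w) ^ 2) w = 2 * I (J w) * N' := by
        have := (hNd.pow 2).const_add z₀
        exact this.deriv.trans (by simp)
      rw [h6, b4 (hMne w h1 h2), ← b5, add_sub_cancel_left]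
      -- One factor `I (J w) ^ 2` from the derivative of the square absorbs the exponent `m - 1`,
      -- which is `-1` at a pole.
      have h7 : (I (J w) ^ 2) ^ ((m : ℤ) - 1) * I (J w) ^ 2 = (I (J w) ^ m) ^ 2 := by
        have hne : I (J w) ^ 2 ≠ 0 := pow_ne_zero _ (hN0 w h1 h2)
        rw [← zpow_add_one₀ hne, sub_add_cancel, zpow_natCast, ← pow_mul, ← pow_mul, mul_comm]
      calc _ = ((I (J w) ^ 2) ^ ((m : ℤ) - 1) * I (J w) ^ 2) * (2 * h (z₀ + I (J w) ^ 2) * N') ^ 2 := by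
            ring
        _ = (2 * I (J w) ^ m * h (z₀ + I (J w) ^ 2) * N') ^ 2 := by rw [h7]; ring
        _ = 1 := by rw [h5, one_pow]
    · exact (hball _ (hJball ζ hζρ)).2.2.2.2.2.1 (hMne ζ hζ hζρ)

end Existence

/-! ### Segments, balls and slit planes -/

section Plane

theorem add_smul_mem_ball {k z v : ℂ} {r s : ℝ} (hz : z ∈ ball k r) (hv : v ∈ closedBall k r)
    (hs : 0 ≤ s) (hs1 : s < 1) : z + s * (v - z) ∈ ball k r := by
  rw [mem_ball, dist_eq_norm] at hz ⊢
  rw [mem_closedBall, dist_eq_norm] at hv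
  have h : z + s * (v - z) - k = ((1 - s : ℝ) : ℂ) * (z - k) + (s : ℂ) * (v - k) := by
    push_cast; ring
  rw [h]
  calc _ ≤ ‖((1 - s : ℝ) : ℂ) * (z - k)‖ + ‖(s : ℂ) * (v - k)‖ := norm_add_le _ _
    _ = (1 - s) * ‖z - k‖ + s * ‖v - k‖ := by
        rw [norm_mul, norm_mul, Complex.norm_of_nonneg (by linarith), Complex.norm_of_nonneg hs]
    _ < r := by nlinarith [norm_nonneg (z - k)]

/-- If `z` is not in the plane slit along the ray from `c` away from `y`, then `c` lies between `y`
and `z`. -/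
theorem exists_of_notMem_slitPlane {z c y : ℂ} (hy : y ≠ c)
    (h : (z - c) / (y - c) ∉ Complex.slitPlane) :
    ∃ s : ℝ, 0 < s ∧ s ≤ 1 ∧ c = y + s * (z - y) ∧ (z ≠ c → s < 1) := by
  rw [Complex.mem_slitPlane_iff] at h
  push Not at h
  obtain ⟨h1, h2⟩ := h
  set τ := ((z - c) / (y - c)).re with hτ
  have hyc : y - c ≠ 0 := sub_ne_zero.2 hy
  have h3 : z - c = τ * (y - c) := by
    rw [← div_eq_iff hyc]
    exact Complex.ext (by simp [hτ]) (by simp [h2])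
  have h4 : 0 < 1 - τ := by linarith
  have h4' : (1 : ℂ) - τ ≠ 0 := by
    have : ((1 - τ : ℝ) : ℂ) ≠ 0 := by exact_mod_cast h4.ne'
    simpa using this
  refine ⟨1 / (1 - τ), by positivity, ?_, ?_, ?_⟩
  · rw [div_le_one h4]; linarith
  · have h5 : z - y = (τ - 1) * (y - c) := by linear_combination h3
    rw [h5]
    push_cast
    field_simp
    ring
  · intro hz
    rw [div_lt_one h4]
    have : τ ≠ 0 := by
      rintro h0
      rw [h0] at h3
      simp [sub_eq_zero] at h3
      exact hz h3
    have : τ < 0 := lt_of_le_of_ne h1 this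
    linarith

/-- Otherwise `c` would lie on the segment from `y` to `z`. Thus a convex set avoiding `c` fits in
the domain of one branch of the cone model. -/
theorem Convex.mem_slitPlane {D : Set ℂ} (hD : Convex ℝ D) {z c y : ℂ} (hy : y ∈ D) (hz : z ∈ D)
    (hc : c ∉ D) : (z - c) / (y - c) ∈ Complex.slitPlane := by
  by_contra h
  obtain ⟨s, hs0, hs1, hs, -⟩ := exists_of_notMem_slitPlane (by rintro rfl; exact hc hy) h
  apply hc
  rw [hs]
  exact hD.add_smul_sub_mem hy hz ⟨hs0.le, hs1⟩

theorem isOpen_slit_ball (c y : ℂ) (r : ℝ) :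
    IsOpen {z : ℂ | (z - c) / (y - c) ∈ Complex.slitPlane ∧ ‖z - c‖ < r} :=
  (Complex.isOpen_slitPlane.preimage (f := fun z : ℂ => (z - c) / (y - c)) (by fun_prop)).inter
    (isOpen_lt (f := fun z : ℂ => ‖z - c‖) (by fun_prop) continuous_const)

end Plane

/-! ### Flat discs and their singular boundary points -/

section Discs

variable {S : Type*} [TopologicalSpace S] [ChartedSpace ℂ S] [IsManifold 𝓘(ℂ) ω S]
  {q : QuadDiff S} {Z : Set S} {f g φ : ℂ → S} {a b z : ℂ} {D D' : Set ℂ}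

def FlatOn (q : QuadDiff S) (Z : Set S) (f : ℂ → S) (D : Set ℂ) : Prop := ∀ z ∈ D, FlatAt q Z f z

theorem FlatOn.mono (h : FlatOn q Z f D) (hD : D' ⊆ D) : FlatOn q Z f D' := fun z hz => h z (hD hz)

theorem norm_sign {ε : ℂ} (hε : ε = 1 ∨ ε = -1) : ‖ε‖ = 1 := by rcases hε with rfl | rfl <;> simp

theorem sign_sq {ε : ℂ} (hε : ε = 1 ∨ ε = -1) : ε ^ 2 = 1 := by rcases hε with rfl | rfl <;> simp

theorem FlatAt.comp_sign {ε : ℂ} (hε : ε = 1 ∨ ε = -1) (h : FlatAt q Z f (ε * (z - b) + a)) :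
    FlatAt q Z (fun w => f (ε * (w - b) + a)) z := by
  have := FlatAt.comp_affine (q := q) (Z := Z) (f := f) (z := z) (c := a - ε * b) (sign_sq hε)
    (by convert h using 1; ring)
  refine this.congr (Eventually.of_forall fun w => ?_)
  show f _ = f _
  congr 1; ring

theorem FlatAt.exists_ball (hZ : IsClosed Z) (h : FlatAt q Z f z) :
    ∃ δ > 0, FlatOn q Z f (ball z δ) := by
  obtain ⟨δ, hδ, h⟩ := Metric.eventually_nhds_iff_ball.1 (h.eventually hZ)
  exact ⟨δ, hδ, h⟩

/-- Two flat maps on convex sets with a common value differ by a map `z ↦ ± z + c`. -/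
theorem FlatOn.align [T2Space S] (hφ : FlatOn q Z φ D) (hf : FlatOn q Z f D') (hD : Convex ℝ D)
    (hD' : Convex ℝ D') (ha : a ∈ D') (hb : b ∈ D) (hab : f a = φ b) :
    ∃ ε : ℂ, (ε = 1 ∨ ε = -1) ∧ ∀ z ∈ D, ε * (z - b) + a ∈ D' →
      φ =ᶠ[𝓝 z] fun z => f (ε * (z - b) + a) := by
  obtain ⟨ε, hε, hal⟩ := (hf a ha).align (hφ b hb) hab
  refine ⟨ε, hε, fun z hz hz' => ?_⟩
  -- The overlap is convex, hence connected, so the local alignment propagates.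
  have hconv : Convex ℝ (D ∩ {z | ε * (z - b) + a ∈ D'}) := by
    refine hD.inter ?_
    intro x hx y hy s t hs ht hst
    have := hD' hx hy hs ht hst
    show ε * (s • x + t • y - b) + a ∈ D'
    convert this using 1
    have hst' : (s : ℂ) + t = 1 := by exact_mod_cast hst
    simp only [Complex.real_smul]
    linear_combination (ε * b - a) * hst'
  refine FlatAt.eventuallyEq_of_isPreconnected hconv.isPreconnected (fun w hw => hφ w hw.1)
    (fun w hw => (hf _ hw.2).comp_sign hε) (a := b) ⟨hb, by simpa using ha⟩ hal ⟨hz, hz'⟩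

/-- Continuation of a flat map around a nearby marked point. -/
theorem IsConeModel.continuation [T2Space S] {p : S} {n : ℕ} {ρ : ℝ} {ψ : ℂ → S}
    (hψ : IsConeModel q Z p n ρ ψ) (hp : p ∈ Z) (hD : Convex ℝ D) (hφ : FlatOn q Z φ D)
    {z₀ u : ℂ} (hz₀ : z₀ ∈ D) (hu : ‖u‖ < ρ) (hφu : φ z₀ = ψ u) :
    ∃ c g, ‖z₀ - c‖ = ‖u‖ ^ n ∧ c ∉ D ∧
      FlatOn q Z g {z | (z - c) / (z₀ - c) ∈ Complex.slitPlane ∧ ‖z - c‖ < ρ ^ n} ∧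
      (∀ z ∈ D, ‖z - c‖ < ρ ^ n → φ =ᶠ[𝓝 z] g) ∧ Tendsto g (𝓝 c) (𝓝 p) := by
  have hn := hψ.n_pos
  have hu0 : u ≠ 0 := by
    rintro rfl
    apply (hφ z₀ hz₀).notMem
    rw [hφu, hψ.apply_zero]
    exact hp
  have hun : u ^ n ≠ 0 := pow_ne_zero _ hu0
  set J : ℂ → ℂ := fun w => u * (w / u ^ n) ^ (1 / n : ℂ) with hJ
  have hJpow : ∀ w, J w ^ n = w := fun w => root_pow hu0 hn
  have hflat : ∀ ζ : ℂ, ζ / u ^ n ∈ Complex.slitPlane → ‖ζ‖ < ρ ^ n →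
      FlatAt q Z (fun w => ψ (J w)) ζ := hψ.flatAt u hu0
  have hun' : ‖u‖ ^ n < ρ ^ n := pow_lt_pow_left₀ hu (norm_nonneg _) hn.ne'
  have h0 : FlatAt q Z (fun w => ψ (J w)) (u ^ n) :=
    hflat _ (by simp [div_self hun]) (by rwa [norm_pow])
  have hJ0 : J (u ^ n) = u := by simp [hJ, div_self hun]
  obtain ⟨ε, hε, hal⟩ := h0.align (hφ z₀ hz₀) (by simp only [hJ0, hφu])
  have hε2 := sign_sq hε
  have hε0 : ε ≠ 0 := by rintro rfl; simp at hε2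
  set c := z₀ - ε * u ^ n with hc
  have hzc : z₀ - c = ε * u ^ n := by rw [hc]; ring
  have hdiv : ∀ z, (z - c) / (z₀ - c) = ε * (z - c) / u ^ n := by
    intro z
    rw [hzc, div_eq_div_iff (mul_ne_zero hε0 hun) hun]
    linear_combination -((z - c) * u ^ n) * hε2
  have hnorm : ‖z₀ - c‖ = ‖u‖ ^ n := by
    rw [hzc, norm_mul, norm_sign hε, one_mul, norm_pow]
  set g : ℂ → S := fun z => ψ (J (ε * (z - c) + 0)) with hg
  have hgflat : FlatOn q Z g {z | (z - c) / (z₀ - c) ∈ Complex.slitPlane ∧ ‖z - c‖ < ρ ^ n} := by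
    rintro z ⟨hz1, hz2⟩
    refine FlatAt.comp_sign (f := fun w => ψ (J w)) hε (hflat _ ?_ ?_)
    · rwa [add_zero, ← hdiv]
    · rwa [add_zero, norm_mul, norm_sign hε, one_mul]
  have hφg : φ =ᶠ[𝓝 z₀] g := by
    filter_upwards [hal] with z hz
    rw [hz, hg]
    congr 2
    rw [hc]
    linear_combination u ^ n * -hε2
  have hgt : Tendsto g (𝓝 c) (𝓝 p) := by
    have h1 : Tendsto (fun z => J (ε * (z - c) + 0)) (𝓝 c) (𝓝 0) := by
      rw [Metric.tendsto_nhds_nhds]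
      intro δ hδ
      refine ⟨δ ^ n, by positivity, fun z hz => ?_⟩
      rw [dist_zero_right]
      refine lt_of_pow_lt_pow_left₀ n hδ.le ?_
      rw [← norm_pow, hJpow, add_zero, norm_mul, norm_sign hε, one_mul, ← dist_eq_norm]
      exact hz
    have h2 := hψ.continuousAt_zero.tendsto
    rw [hψ.apply_zero] at h2
    exact h2.comp h1
  -- Were `c` in `D`, then `φ` and `g` would agree along the segment from `z₀` towards `c`, and the
  -- limit would give the marked value `φ c = p`.
  have hcD : c ∉ D := by
    intro hcD
    set T : Set ℂ := (fun t : ℝ => c + t * (z₀ - c)) '' Ioc 0 1 with hT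
    have hTpre : IsPreconnected T :=
      isPreconnected_Ioc.image _ (Continuous.continuousOn (by fun_prop))
    have hTD : T ⊆ D := by
      rintro _ ⟨t, ht, rfl⟩
      exact hD.add_smul_sub_mem hcD hz₀ ⟨ht.1.le, ht.2⟩
    have hz0c : z₀ - c ≠ 0 := by rw [hzc]; exact mul_ne_zero hε0 hun
    have hTg : T ⊆ {z | (z - c) / (z₀ - c) ∈ Complex.slitPlane ∧ ‖z - c‖ < ρ ^ n} := by
      rintro _ ⟨t, ht, rfl⟩
      simp only [mem_ofPred_eq, add_sub_cancel_left]
      constructor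
      · rw [mul_div_cancel_right₀ _ hz0c]
        exact Complex.ofReal_mem_slitPlane.2 ht.1
      · rw [norm_mul, Complex.norm_of_nonneg ht.1.le, hnorm]
        refine lt_of_le_of_lt ?_ hun'
        exact mul_le_of_le_one_left (by positivity) ht.2
    have hz₀T : z₀ ∈ T := ⟨1, by simp, by simp⟩
    have heq : ∀ z ∈ T, φ z = g z := fun z hz =>
      (FlatAt.eventuallyEq_of_isPreconnected hTpre (hφ.mono hTD) (hgflat.mono hTg) hz₀T hφg
        hz).eq_of_nhds
    have hline : Tendsto (fun t : ℝ => c + t * (z₀ - c)) (𝓝[>] 0) (𝓝 c) := by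
      have : Continuous (fun t : ℝ => c + t * (z₀ - c)) := by fun_prop
      have h := this.tendsto 0
      simp only [Complex.ofReal_zero, zero_mul, add_zero] at h
      exact h.mono_left nhdsWithin_le_nhds
    have h1 := (hφ c hcD).continuousAt.tendsto.comp hline
    have h2 := hgt.comp hline
    have h3 : φ c = p := by
      refine tendsto_nhds_unique_of_eventuallyEq h1 h2 ?_
      filter_upwards [Ioc_mem_nhdsGT one_pos] with t ht
      exact heq _ ⟨t, ht, rfl⟩
    exact (hφ c hcD).notMem (h3 ▸ hp)
  refine ⟨c, g, hnorm, hcD, hgflat, fun z hz hzρ => ?_, hgt⟩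
  have hconv : Convex ℝ (D ∩ ball c (ρ ^ n)) := hD.inter (convex_ball _ _)
  refine FlatAt.eventuallyEq_of_isPreconnected hconv.isPreconnected (fun w hw => hφ w hw.1)
    (fun w hw => hgflat w ⟨Convex.mem_slitPlane hD hz₀ hw.1 hcD, ?_⟩) (a := z₀) ⟨hz₀, ?_⟩ hφg ⟨hz, ?_⟩
  · exact mem_ball_iff_norm.1 hw.2
  · rw [mem_ball_iff_norm, hnorm]; exact hun'
  · exact mem_ball_iff_norm.2 hzρ

/-- If `φ c = ψ u` then the place of `p` in the plane is at distance `‖u‖ ^ n` from `c` and cannot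
be in the disc. This bounds the radius near `p`. -/
theorem IsConeModel.exists_nhds_radius_lt [T2Space S] {p : S} {n : ℕ} {ρ : ℝ} {ψ : ℂ → S}
    (hψ : IsConeModel q Z p n ρ ψ) (hp : p ∈ Z) {s : ℝ} (hs : 0 < s) :
    ∃ N ∈ 𝓝 p, ∀ (φ : ℂ → S) (c : ℂ) (r : ℝ), FlatOn q Z φ (ball c r) → φ c ∈ N → r < s := by
  have h1 : Tendsto (fun u : ℂ => ‖u‖ ^ n) (𝓝 0) (𝓝 0) := by
    have : Continuous (fun u : ℂ => ‖u‖ ^ n) := by fun_prop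
    have h := this.tendsto 0
    simpa [hψ.n_pos.ne'] using h
  refine ⟨_, hψ.image_mem_nhds _ (inter_mem (ball_mem_nhds 0 hψ.ρ_pos)
    (h1.eventually_lt_const hs)), ?_⟩
  rintro φ c r hφ ⟨u, ⟨hu1, hu2⟩, hu⟩
  by_contra! hr
  obtain ⟨c', g, h1, h2, -⟩ := hψ.continuation hp (convex_ball c r) hφ
    (mem_ball_self (hs.trans_le hr)) (mem_ball_zero_iff.1 hu1) hu.symm
  apply h2
  rw [mem_ball', dist_eq_norm, h1]
  exact lt_of_lt_of_le hu2 hr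

/-- The radii of the flat discs on a half-translation surface are bounded. -/
theorem exists_radius_bound [T2Space S] [CompactSpace S] [ConnectedSpace S] (hq : q.IsMarkedBy Z)
    (hZ : Z.Finite) (hne : Z.Nonempty) :
    ∃ R > 0, ∀ (φ : ℂ → S) (c : ℂ) (r : ℝ), FlatOn q Z φ (ball c r) → r ≤ R := by
  -- Points with a neighbourhood of bounded radii form a clopen set containing `Z`, hence all of `S`
  -- by connectedness; compactness then makes the bound uniform.
  set P : Set S → Prop := fun N => ∃ M : ℝ, ∀ (φ : ℂ → S) (c : ℂ) (r : ℝ), 0 < r →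
    FlatOn q Z φ (ball c r) → φ c ∈ N → r ≤ M with hP
  set B : Set S := {x | ∃ N ∈ 𝓝 x, P N} with hB
  have hZB : Z ⊆ B := by
    intro p hp
    obtain ⟨n, ρ, ψ, hψ⟩ := exists_isConeModel hq hZ hp
    obtain ⟨N, hN, h⟩ := hψ.exists_nhds_radius_lt hp one_pos
    exact ⟨N, hN, 1, fun φ c r _ h1 h2 => (h φ c r h1 h2).le⟩
  have hBo : IsOpen B := by
    rw [isOpen_iff_mem_nhds]
    rintro x ⟨N, hN, hPN⟩
    filter_upwards [eventually_mem_nhds_iff.2 hN] with y hy using ⟨N, hy, hPN⟩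
  have hBc : IsClosed B := by
    refine isClosed_of_closure_subset fun x hx => ?_
    by_cases hxZ : x ∈ Z
    · exact hZB hxZ
    obtain ⟨f, hf, rfl⟩ := exists_flatAt hq hxZ
    obtain ⟨δ, hδ, hfδ⟩ := hf.exists_ball hZ.isClosed
    have hN := hf.image_mem_nhds (ball_mem_nhds 0 (half_pos hδ))
    obtain ⟨_, ⟨a', ha', rfl⟩, N', hN', M, hM⟩ := mem_closure_iff_nhds.1 hx _ hN
    refine ⟨_, hN, max δ (M + δ), ?_⟩
    rintro φ c r hr hφ ⟨a, ha, hac⟩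
    rcases le_or_gt r δ with h | h
    · exact le_max_of_le_left h
    refine le_max_of_le_right ?_
    rw [mem_ball_zero_iff] at ha ha'
    obtain ⟨ε, hε, hal⟩ := hφ.align hfδ (convex_ball _ _) (convex_ball _ _)
      (mem_ball_zero_iff.2 (by linarith)) (mem_ball_self hr) hac
    -- Moving the centre from `f a` to `f a'` inside one flat chart costs at most `δ` of the radius.
    have hA : ε * (c + ε * (a' - a) - c) + a = a' := by
      linear_combination (a' - a) * sign_sq hε
    have hd : ‖ε * (a' - a)‖ < δ := by
      rw [norm_mul, norm_sign hε, one_mul]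
      calc _ ≤ ‖a'‖ + ‖a‖ := norm_sub_le _ _
        _ < δ := by linarith
    have hc' : c + ε * (a' - a) ∈ ball c r := by
      rw [mem_ball_iff_norm, add_sub_cancel_left]; linarith
    have hval := (hal _ hc' (by rw [hA, mem_ball_zero_iff]; linarith)).eq_of_nhds
    rw [hA] at hval
    have := hM φ (c + ε * (a' - a)) (r - δ) (by linarith) (hφ.mono (ball_subset_ball' ?_)) ?_
    · linarith
    · rw [dist_eq_norm, add_sub_cancel_left]; linarith
    · rw [hval]; exact mem_of_mem_nhds hN'
  have huniv : B = univ := IsClopen.eq_univ ⟨hBc, hBo⟩ (hne.mono hZB)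
  have hPu : P univ := by
    refine isCompact_univ.induction_on (p := P) ⟨0, by simp⟩ ?_ ?_ ?_
    · rintro s t hst ⟨M, hM⟩
      exact ⟨M, fun φ c r hr h1 h2 => hM φ c r hr h1 (hst h2)⟩
    · rintro s t ⟨M, hM⟩ ⟨M', hM'⟩
      refine ⟨max M M', fun φ c r hr h1 h2 => ?_⟩
      rcases h2 with h2 | h2
      · exact le_max_of_le_left (hM φ c r hr h1 h2)
      · exact le_max_of_le_right (hM' φ c r hr h1 h2)
    · intro x _
      have : x ∈ B := huniv ▸ mem_univ x
      obtain ⟨N, hN, h⟩ := this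
      exact ⟨N, mem_nhdsWithin_of_mem_nhds hN, h⟩
  obtain ⟨M, hM⟩ := hPu
  refine ⟨max M 1, by positivity, fun φ c r h => ?_⟩
  rcases le_or_gt r 0 with hr | hr
  · exact hr.trans (by positivity)
  · exact le_max_of_le_left (hM φ c r hr h (mem_univ _))

/-- The flat map `φ` on `D` extends to a flat map near `v`. -/
def RegularAt (q : QuadDiff S) (Z : Set S) (φ : ℂ → S) (D : Set ℂ) (v : ℂ) : Prop :=
  ∃ δ > 0, ∃ g, FlatOn q Z g (ball v δ) ∧ ∀ z ∈ D, z ∈ ball v δ → φ z = g z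

/-- The number `η` is a lower bound for the sizes of standard neighbourhoods of the marked
points. -/
def IsConeScale (q : QuadDiff S) (Z : Set S) (η : ℝ) : Prop :=
  0 < η ∧ ∀ p ∈ Z, ∃ n ρ ψ, IsConeModel q Z p n ρ ψ ∧ η ≤ ρ ^ n

theorem exists_isConeScale [T2Space S] (hq : q.IsMarkedBy Z) (hZ : Z.Finite) :
    ∃ η, IsConeScale q Z η := by
  have h : ∀ p : Z, ∃ η : ℝ, 0 < η ∧ ∃ n ρ ψ, IsConeModel q Z (p : S) n ρ ψ ∧ η ≤ ρ ^ n := by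
    intro p
    obtain ⟨n, ρ, ψ, hψ⟩ := exists_isConeModel hq hZ p.2
    exact ⟨ρ ^ n, pow_pos hψ.ρ_pos n, n, ρ, ψ, hψ, le_rfl⟩
  choose η hη h using h
  have := hZ.to_subtype
  obtain ⟨η₀, hη₀⟩ : ∃ η₀ : ℝ, 0 < η₀ ∧ ∀ p, η₀ ≤ η p := by
    have := Set.finite_range η
    rcases (range η).eq_empty_or_nonempty with h0 | h0
    · exact ⟨1, one_pos, fun p => absurd (mem_range_self p) (h0 ▸ notMem_empty _)⟩
    · obtain ⟨m, ⟨p, rfl⟩, hm⟩ := this.exists_minimal h0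
      refine ⟨η p, hη p, fun p' => ?_⟩
      by_contra! h1
      exact absurd (hm (mem_range_self p') h1.le) (not_le.2 h1)
  refine ⟨η₀, hη₀.1, fun p hp => ?_⟩
  obtain ⟨n, ρ, ψ, hψ, hle⟩ := h ⟨p, hp⟩
  exact ⟨n, ρ, ψ, hψ, (hη₀.2 _).trans hle⟩

/-- At a boundary point to which it does not extend, a flat map on a disc tends to a marked
point, and it extends to a slit disc of definite size. -/
theorem FlatOn.boundary [T2Space S] [CompactSpace S] (hq : q.IsMarkedBy Z) (hZ : Z.Finite) {η : ℝ}
    (hη : IsConeScale q Z η) {k : ℂ} {r : ℝ} (hφ : FlatOn q Z φ (ball k r)) {y v : ℂ}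
    (hy : y ∈ ball k r) (hv : v ∈ sphere k r) (hreg : ¬ RegularAt q Z φ (ball k r) v) :
    ∃ p ∈ Z, Tendsto φ (𝓝[ball k r] v) (𝓝 p) ∧
      ∃ g, FlatOn q Z g {z | (z - v) / (y - v) ∈ Complex.slitPlane ∧ ‖z - v‖ < η} ∧
        ∀ z ∈ ball k r, ‖z - v‖ < η → φ =ᶠ[𝓝 z] g := by
  have hvc : v ∈ closedBall k r := sphere_subset_closedBall hv
  have hvD : v ∉ ball k r := fun h => by
    rw [mem_sphere] at hv; rw [mem_ball] at h; linarith
  have hyv : y ≠ v := by rintro rfl; exact hvD hy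
  set L : ℝ → ℂ := fun t => y + t * (v - y) with hL
  have hLt : Tendsto L (𝓝[<] 1) (𝓝 v) := by
    have : Continuous L := by fun_prop
    have h := this.tendsto 1
    simp only [hL, Complex.ofReal_one, one_mul, add_sub_cancel] at h
    exact h.mono_left nhdsWithin_le_nhds
  have hLD : ∀ᶠ t in 𝓝[<] (1 : ℝ), t < 1 ∧ L t ∈ ball k r := by
    filter_upwards [Ico_mem_nhdsLT (zero_lt_one' ℝ)] with t ht
    exact ⟨ht.2, add_smul_mem_ball hy hvc ht.1 ht.2⟩
  -- Compactness gives a cluster point of `φ` along the segment from `y` to `v`. If it is unmarked,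
  -- a flat chart around it extends `φ` past `v`; if it is marked, the cone model applies.
  obtain ⟨x, hx⟩ := exists_clusterPt_of_compactSpace (map (fun t => φ (L t)) (𝓝[<] (1 : ℝ)))
  have hfr : ∀ N ∈ 𝓝 x, ∃ᶠ t in 𝓝[<] (1 : ℝ), φ (L t) ∈ N :=
    mapClusterPt_iff_frequently.1 hx
  by_cases hxZ : x ∈ Z
  · obtain ⟨n, ρ, ψ, hψ, hηρ⟩ := hη.2 x hxZ
    have h1 : Tendsto (fun u : ℂ => ‖u‖ ^ n) (𝓝 0) (𝓝 0) := by
      have : Continuous (fun u : ℂ => ‖u‖ ^ n) := by fun_prop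
      have h := this.tendsto 0
      simpa [hψ.n_pos.ne'] using h
    have hη2 : 0 < η / 2 := half_pos hη.1
    have hN := hψ.image_mem_nhds _ (inter_mem (ball_mem_nhds 0 hψ.ρ_pos)
      (h1.eventually_lt_const hη2))
    obtain ⟨t, ⟨u, ⟨hu1, hu2⟩, hu⟩, ⟨ht1, htD⟩, htv⟩ := ((hfr _ hN).and_eventually (hLD.and
      (hLt.eventually (ball_mem_nhds v hη2)))).exists
    obtain ⟨c, g, hc1, hc2, hc3, hc4, hc5⟩ := hψ.continuation hxZ (convex_ball k r) hφ htD
      (mem_ball_zero_iff.1 hu1) hu.symm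
    have hu2 : ‖u‖ ^ n < η / 2 := hu2
    -- A cone point placed elsewhere than at `v` would leave `v` in the slit disc to which `φ`
    -- continues, so `v` would be regular.
    have hcv : c = v := by
      by_contra hcv
      apply hreg
      have hslit : (v - c) / (L t - c) ∈ Complex.slitPlane := by
        by_contra hns
        obtain ⟨s, hs0, hs1, hs2, hs3⟩ := exists_of_notMem_slitPlane
          (by rintro h; exact hc2 (h ▸ htD)) hns
        apply hc2
        rw [hs2]
        exact add_smul_mem_ball htD hvc hs0.le (hs3 (Ne.symm hcv))
      have hvcn : ‖v - c‖ < ρ ^ n := by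
        have h3 : ‖v - L t‖ < η / 2 := by
          have : L t ∈ ball v (η / 2) := htv
          rwa [mem_ball', dist_eq_norm] at this
        calc ‖v - c‖ = ‖(v - L t) + (L t - c)‖ := by ring_nf
          _ ≤ ‖v - L t‖ + ‖L t - c‖ := norm_add_le _ _
          _ < η := by rw [hc1]; linarith
          _ ≤ ρ ^ n := hηρ
      have hopen : IsOpen {z | (z - c) / (L t - c) ∈ Complex.slitPlane ∧ ‖z - c‖ < ρ ^ n} :=
        isOpen_slit_ball c (L t) _
      obtain ⟨δ, hδ, hsub⟩ := Metric.isOpen_iff.1 hopen v ⟨hslit, hvcn⟩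
      exact ⟨δ, hδ, g, hc3.mono hsub, fun z hz hz' => (hc4 z hz (hsub hz').2).eq_of_nhds⟩
    subst hcv
    refine ⟨x, hxZ, ?_, g, ?_, fun z hz hz' => hc4 z hz (hz'.trans_le hηρ)⟩
    · refine (hc5.mono_left nhdsWithin_le_nhds).congr' ?_
      filter_upwards [self_mem_nhdsWithin,
        mem_nhdsWithin_of_mem_nhds (ball_mem_nhds c (pow_pos hψ.ρ_pos n))] with z hz hz'
      exact (hc4 z hz (mem_ball_iff_norm.1 hz')).eq_of_nhds.symm
    · refine hc3.mono ?_
      rintro z ⟨hz1, hz2⟩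
      refine ⟨?_, hz2.trans_le hηρ⟩
      -- Since `L t` is on the segment from `y` to `c`, both points define the same slit.
      have h2 : (z - c) / (L t - c) = ((1 - t)⁻¹ : ℝ) * ((z - c) / (y - c)) := by
        have : L t - c = (1 - t : ℝ) * (y - c) := by
          simp only [hL]; push_cast; ring
        rw [this, mul_comm, ← div_div, div_eq_mul_inv, ← Complex.ofReal_inv, mul_comm]
      have h3 : 0 < (1 - t)⁻¹ := inv_pos.2 (by linarith)
      rw [h2, Complex.mem_slitPlane_iff, Complex.re_ofReal_mul, Complex.im_ofReal_mul]
      rcases Complex.mem_slitPlane_iff.1 hz1 with h | h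
      · exact Or.inl (mul_pos h3 h)
      · exact Or.inr (mul_ne_zero h3.ne' h)
  · exfalso
    apply hreg
    obtain ⟨f, hf, rfl⟩ := exists_flatAt hq hxZ
    obtain ⟨δ, hδ, hfδ⟩ := hf.exists_ball hZ.isClosed
    have hN := hf.image_mem_nhds (ball_mem_nhds 0 (half_pos hδ))
    obtain ⟨t, ⟨a, ha, hta⟩, ⟨ht1, htD⟩, htv⟩ := ((hfr _ hN).and_eventually (hLD.and
      (hLt.eventually (ball_mem_nhds v (show 0 < δ / 4 by positivity))))).exists
    rw [mem_ball_zero_iff] at ha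
    obtain ⟨ε, hε, hal⟩ := hφ.align hfδ (convex_ball _ _) (convex_ball _ _)
      (mem_ball_zero_iff.2 (by linarith)) htD hta
    have hA : ∀ z ∈ ball v (δ / 4), ε * (z - L t) + a ∈ ball 0 δ := by
      intro z hz
      have htv' : L t ∈ ball v (δ / 4) := htv
      rw [mem_ball_iff_norm] at hz
      rw [mem_ball', dist_eq_norm] at htv'
      rw [mem_ball_zero_iff]
      calc _ ≤ ‖ε * (z - L t)‖ + ‖a‖ := norm_add_le _ _
        _ = ‖(z - v) + (v - L t)‖ + ‖a‖ := by rw [norm_mul, norm_sign hε, one_mul]; ring_nf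
        _ ≤ ‖z - v‖ + ‖v - L t‖ + ‖a‖ := by gcongr; exact norm_add_le _ _
        _ < δ := by linarith
    exact ⟨δ / 4, by positivity, _, fun z hz => (hfδ _ (hA z hz)).comp_sign hε,
      fun z hz hz' => (hal z hz (hA z hz')).eq_of_nhds⟩

/-- Singular boundary points of overlapping discs are separated. -/
theorem FlatOn.eq_of_dist_lt [T2Space S] [CompactSpace S] (hq : q.IsMarkedBy Z) (hZ : Z.Finite)
    {η : ℝ} (hη : IsConeScale q Z η) {φ₁ φ₂ : ℂ → S} {k₁ k₂ : ℂ} {r₁ r₂ : ℝ}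
    (hφ₁ : FlatOn q Z φ₁ (ball k₁ r₁)) (hφ₂ : FlatOn q Z φ₂ (ball k₂ r₂)) {a v₁ v₂ : ℂ}
    (ha₁ : a ∈ ball k₁ r₁) (ha₂ : a ∈ ball k₂ r₂) (hgerm : φ₁ =ᶠ[𝓝 a] φ₂)
    (hv₁ : v₁ ∈ sphere k₁ r₁) (hv₂ : v₂ ∈ sphere k₂ r₂) (hs₁ : ¬ RegularAt q Z φ₁ (ball k₁ r₁) v₁)
    (hs₂ : ¬ RegularAt q Z φ₂ (ball k₂ r₂) v₂) (hd : ‖v₂ - v₁‖ < η)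
    (hinter : ∃ x, x ∈ ball k₁ r₁ ∧ x ∈ ball k₂ r₂ ∧ ‖x - v₁‖ < η) : v₁ = v₂ := by
  by_contra hne
  obtain ⟨p, hp, -, g, hg, hφg⟩ := hφ₁.boundary hq hZ hη ha₁ hv₁ hs₁
  have h12 : ∀ z ∈ ball k₁ r₁ ∩ ball k₂ r₂, φ₁ =ᶠ[𝓝 z] φ₂ := fun z hz =>
    FlatAt.eventuallyEq_of_isPreconnected
      ((convex_ball k₁ r₁).inter (convex_ball k₂ r₂)).isPreconnected
      (fun w hw => hφ₁ w hw.1) (fun w hw => hφ₂ w hw.2) ⟨ha₁, ha₂⟩ hgerm hz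
  -- Otherwise `φ₂` would extend `φ₁` across `v₁`.
  have hv₁2 : v₁ ∉ ball k₂ r₂ := by
    intro h
    obtain ⟨δ, hδ, hsub⟩ := Metric.isOpen_iff.1 isOpen_ball v₁ h
    exact hs₁ ⟨δ, hδ, φ₂, hφ₂.mono hsub, fun z hz hz' => (h12 z ⟨hz, hsub hz'⟩).eq_of_nhds⟩
  have hav : a ≠ v₁ := by rintro rfl; exact hv₁2 ha₂
  obtain ⟨x, hx1, hx2, hx3⟩ := hinter
  -- The continuation of `φ₁` around `v₁` also continues `φ₂`; it is flat at every point of its slit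
  -- disc, so it would make `v₂ ≠ v₁` regular.
  have h2g : ∀ z ∈ ball k₂ r₂ ∩ ball v₁ η, φ₂ =ᶠ[𝓝 z] g := fun z hz =>
    FlatAt.eventuallyEq_of_isPreconnected
      ((convex_ball k₂ r₂).inter (convex_ball v₁ η)).isPreconnected
      (fun w hw => hφ₂ w hw.1)
      (fun w hw => hg w ⟨Convex.mem_slitPlane (convex_ball k₂ r₂) ha₂ hw.1 hv₁2,
        mem_ball_iff_norm.1 hw.2⟩)
      ⟨hx2, mem_ball_iff_norm.2 hx3⟩ ((h12 x ⟨hx1, hx2⟩).symm.trans (hφg x hx1 hx3)) hz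
  have hslit : (v₂ - v₁) / (a - v₁) ∈ Complex.slitPlane := by
    by_contra hns
    obtain ⟨s, hs0, hs1, hs2, hs3⟩ := exists_of_notMem_slitPlane hav hns
    apply hv₁2
    rw [hs2]
    exact add_smul_mem_ball ha₂ (sphere_subset_closedBall hv₂) hs0.le (hs3 (Ne.symm hne))
  have hopen : IsOpen {z | (z - v₁) / (a - v₁) ∈ Complex.slitPlane ∧ ‖z - v₁‖ < η} :=
    isOpen_slit_ball v₁ a _
  obtain ⟨δ, hδ, hsub⟩ := Metric.isOpen_iff.1 hopen v₂ ⟨hslit, hd⟩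
  exact hs₂ ⟨δ, hδ, g, hg.mono hsub, fun z hz hz' =>
    (h2g z ⟨hz, mem_ball_iff_norm.2 (hsub hz').2⟩).eq_of_nhds⟩

end Discs

/-! ### Developing a germ, and discs of maximal power -/

section Developing

variable {S : Type*} [TopologicalSpace S] [ChartedSpace ℂ S] [IsManifold 𝓘(ℂ) ω S]
  {q : QuadDiff S} {Z : Set S} {Φ : ℂ → S} {a k : ℂ} {r : ℝ} {Ω : Set ℂ}

/-- `Φ` is a flat map on `Ω`, which contains every convex open set to which the germ of `Φ`
at `a` extends. -/
structure IsDeveloping (q : QuadDiff S) (Z : Set S) (a : ℂ) (Φ : ℂ → S) (Ω : Set ℂ) : Prop where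
  isOpen : IsOpen Ω
  flatOn : FlatOn q Z Φ Ω
  mem : a ∈ Ω
  maximal : ∀ U, IsOpen U → Convex ℝ U → a ∈ U → ∀ f, FlatOn q Z f U → f =ᶠ[𝓝 a] Φ → U ⊆ Ω

/-- Take the union of all convex open neighbourhoods of `a` to which the germ extends. Two of them
meet in a convex set containing `a`, so the extensions agree there and glue. -/
theorem exists_isDeveloping [T2Space S] (hZ : IsClosed Z) {f₀ : ℂ → S} (h₀ : FlatAt q Z f₀ a) :
    ∃ Φ Ω, IsDeveloping q Z a Φ Ω ∧ Φ =ᶠ[𝓝 a] f₀ := by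
  classical
  set P : Set ℂ → (ℂ → S) → Prop := fun U f =>
    IsOpen U ∧ Convex ℝ U ∧ a ∈ U ∧ FlatOn q Z f U ∧ f =ᶠ[𝓝 a] f₀ with hP
  set Ω : Set ℂ := {z | ∃ U f, P U f ∧ z ∈ U} with hΩ
  have hex : ∀ z : ℂ, ∃ s : S, z ∈ Ω → ∃ U f, P U f ∧ z ∈ U ∧ f z = s := by
    intro z
    by_cases hz : z ∈ Ω
    · obtain ⟨U, f, h, hz⟩ := hz
      exact ⟨f z, fun _ => ⟨U, f, h, hz, rfl⟩⟩
    · exact ⟨f₀ z, fun h => absurd h hz⟩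
  choose Φ hΦ using hex
  have hval : ∀ U f, P U f → ∀ z ∈ U, Φ z = f z := by
    intro U f hU z hz
    obtain ⟨U', f', hU', hz', h⟩ := hΦ z ⟨U, f, hU, hz⟩
    rw [← h]
    refine (FlatAt.eventuallyEq_of_isPreconnected (hU'.2.1.inter hU.2.1).isPreconnected
      (fun w hw => hU'.2.2.2.1 w hw.1) (fun w hw => hU.2.2.2.1 w hw.2) ⟨hU'.2.2.1, hU.2.2.1⟩
      (hU'.2.2.2.2.trans hU.2.2.2.2.symm) ⟨hz', hz⟩).eq_of_nhds
  have hgerm : ∀ U f, P U f → ∀ z ∈ U, Φ =ᶠ[𝓝 z] f := fun U f hU z hz =>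
    eventually_of_mem (hU.1.mem_nhds hz) (hval U f hU)
  obtain ⟨δ, hδ, hball⟩ := h₀.exists_ball hZ
  have hP₀ : P (ball a δ) f₀ :=
    ⟨isOpen_ball, convex_ball _ _, mem_ball_self hδ, hball, EventuallyEq.rfl⟩
  have hΦ₀ : Φ =ᶠ[𝓝 a] f₀ := hgerm _ _ hP₀ a (mem_ball_self hδ)
  refine ⟨Φ, Ω, ⟨?_, ?_, ⟨_, _, hP₀, mem_ball_self hδ⟩, ?_⟩, hΦ₀⟩
  · rw [isOpen_iff_mem_nhds]
    rintro z ⟨U, f, hU, hz⟩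
    exact mem_of_superset (hU.1.mem_nhds hz) fun w hw => ⟨U, f, hU, hw⟩
  · rintro z ⟨U, f, hU, hz⟩
    exact (hU.2.2.2.1 z hz).congr (hgerm U f hU z hz)
  · intro U hU hUc ha f hf hfa z hz
    exact ⟨U, f, ⟨hU, hUc, ha, hf, hfa.trans hΦ₀⟩, hz⟩

/-- An extension of `Φ` past `v` is defined on the disc together with a ball around `v`. This
contains a thickening of the segment from `a` to `v`, which is convex, so maximality of `Ω` applies.
-/
theorem IsDeveloping.regularAt_iff (h : IsDeveloping q Z a Φ Ω) (ha : a ∈ ball k r)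
    (hD : ball k r ⊆ Ω) {v : ℂ} (hv : v ∈ sphere k r) :
    RegularAt q Z Φ (ball k r) v ↔ v ∈ Ω := by
  classical
  constructor
  · rintro ⟨δ, hδ, g, hg, hΦg⟩
    set F : ℂ → S := fun z => if z ∈ ball k r then Φ z else g z with hF
    have hF₁ : ∀ z ∈ ball k r, F =ᶠ[𝓝 z] Φ := fun z hz =>
      eventually_of_mem (isOpen_ball.mem_nhds hz) fun w hw => if_pos hw
    have hF₂ : ∀ z ∈ ball v δ, F =ᶠ[𝓝 z] g := fun z hz =>
      eventually_of_mem (isOpen_ball.mem_nhds hz) fun w hw => by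
        by_cases hw' : w ∈ ball k r
        · simp only [hF, if_pos hw']; exact hΦg w hw' hw
        · simp only [hF, if_neg hw']
    have hsub : segment ℝ a v ⊆ ball k r ∪ ball v δ := by
      rw [segment_eq_image']
      rintro _ ⟨t, ht, rfl⟩
      rcases eq_or_lt_of_le ht.2 with rfl | h1
      · right; simpa using hδ
      · left
        exact add_smul_mem_ball ha (sphere_subset_closedBall hv) ht.1 h1
    have hcomp : IsCompact (segment ℝ a v) := by
      rw [segment_eq_image']
      exact isCompact_Icc.image (by fun_prop)
    obtain ⟨s, hs, hthick⟩ := hcomp.exists_thickening_subset_open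
      (isOpen_ball.union isOpen_ball) hsub
    refine h.maximal _ isOpen_thickening ((convex_segment a v).thickening s)
      (self_subset_thickening hs _ (left_mem_segment ℝ a v)) F ?_ (hF₁ a ha)
      (self_subset_thickening hs _ (right_mem_segment ℝ a v))
    intro z hz
    rcases hthick hz with hz | hz
    · exact (h.flatOn z (hD hz)).congr (hF₁ z hz)
    · exact (hg z hz).congr (hF₂ z hz)
  · intro hv'
    obtain ⟨δ, hδ, hsub⟩ := Metric.isOpen_iff.1 h.isOpen v hv'
    exact ⟨δ, hδ, Φ, h.flatOn.mono hsub, fun _ _ _ => rfl⟩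

/-- Among the discs around which `Φ` develops, one maximizes the power of `a`. -/
theorem IsDeveloping.exists_max (h : IsDeveloping q Z a Φ Ω) {R : ℝ}
    (hR : ∀ k r, ball k r ⊆ Ω → r ≤ R) :
    ∃ k r, a ∈ ball k r ∧ ball k r ⊆ Ω ∧ ∀ k' r', a ∈ ball k' r' → ball k' r' ⊆ Ω →
      r' ^ 2 - ‖a - k'‖ ^ 2 ≤ r ^ 2 - ‖a - k‖ ^ 2 := by
  -- The condition on `a` is relaxed to a closed one for compactness; the maximum is positive, since
  -- a ball centred at `a` competes, and this makes the inequality strict again.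
  set K : Set (ℂ × ℝ) := {x | ball x.1 x.2 ⊆ Ω} ∩ {x | ‖a - x.1‖ ≤ x.2} with hK
  have hK1 : IsClosed {x : ℂ × ℝ | ball x.1 x.2 ⊆ Ω} := by
    have : {x : ℂ × ℝ | ball x.1 x.2 ⊆ Ω} = ⋂ z ∈ Ωᶜ, {x : ℂ × ℝ | x.2 ≤ dist z x.1} := by
      ext x
      simp only [mem_iInter]
      constructor
      · intro hx z hz
        by_contra hlt
        exact hz (hx (show z ∈ ball x.1 x.2 from not_le.1 (show ¬ x.2 ≤ dist z x.1 from hlt)))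
      · intro hx z hz
        by_contra hzΩ
        exact absurd (show x.2 ≤ dist z x.1 from hx z hzΩ) (not_le.2 hz)
    rw [this]
    exact isClosed_biInter fun z _ => isClosed_le continuous_snd (by fun_prop)
  have hK2 : IsClosed {x : ℂ × ℝ | ‖a - x.1‖ ≤ x.2} := isClosed_le (by fun_prop) continuous_snd
  have hKc : IsCompact K := by
    refine ((isCompact_closedBall a R).prod (isCompact_Icc (a := (0 : ℝ)) (b := R))).of_isClosed_subset
      (hK1.inter hK2) ?_
    rintro ⟨k, r⟩ ⟨h1, h2⟩
    have h1' := hR k r h1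
    have h2 : ‖a - k‖ ≤ r := h2
    refine ⟨?_, (norm_nonneg _).trans h2, h1'⟩
    rw [mem_closedBall', dist_eq_norm]
    exact h2.trans h1'
  obtain ⟨δ, hδ, hδΩ⟩ := Metric.isOpen_iff.1 h.isOpen a h.mem
  have hδK : (a, δ) ∈ K := ⟨hδΩ, by simpa using hδ.le⟩
  obtain ⟨⟨k, r⟩, ⟨hk1, hk2⟩, hmax⟩ := hKc.exists_isMaxOn ⟨_, hδK⟩
    (f := fun x : ℂ × ℝ => x.2 ^ 2 - ‖a - x.1‖ ^ 2) (by fun_prop)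
  have hpos : 0 < r ^ 2 - ‖a - k‖ ^ 2 := by
    have := hmax hδK
    simp only [mem_ofPred_eq, sub_self, norm_zero] at this
    have : δ ^ 2 - 0 ^ 2 ≤ r ^ 2 - ‖a - k‖ ^ 2 := this
    nlinarith
  have hk2 : ‖a - k‖ ≤ r := hk2
  refine ⟨k, r, ?_, hk1, fun k' r' h1 h2 => hmax (show (k', r') ∈ K from ⟨h2, ?_⟩)⟩
  · rw [mem_ball_iff_norm]
    exact lt_of_le_of_ne hk2 (by rintro h; rw [h] at hpos; simp at hpos)
  · rw [mem_ball_iff_norm] at h1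
    exact h1.le

theorem norm_sub_add_mul_sq (z k w : ℂ) (t : ℝ) : ‖z - (k - t * w)‖ ^ 2 =
    ‖z - k‖ ^ 2 + 2 * t * (w.re * (z - k).re + w.im * (z - k).im) + t ^ 2 * ‖w‖ ^ 2 := by
  simp only [Complex.sq_norm, Complex.normSq_apply, Complex.sub_re, Complex.sub_im, Complex.mul_re,
    Complex.mul_im, Complex.ofReal_re, Complex.ofReal_im]
  ring

/-- If a disc in the open set `Ω` maximizes the power of `a`, then `a` is in the convex hull of the
boundary points that are not in `Ω`. -/
theorem mem_convexHull_of_max (hΩ : IsOpen Ω) (ha : a ∈ ball k r) (hD : ball k r ⊆ Ω)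
    (hfin : (sphere k r \ Ω).Finite) (hmax : ∀ k' r', a ∈ ball k' r' → ball k' r' ⊆ Ω →
      r' ^ 2 - ‖a - k'‖ ^ 2 ≤ r ^ 2 - ‖a - k‖ ^ 2) : a ∈ convexHull ℝ (sphere k r \ Ω) := by
  by_contra hnot
  obtain ⟨F, u, hFa, hFv⟩ := geometric_hahn_banach_point_closed (convex_convexHull ℝ _)
    (hfin.isClosed_convexHull ℝ) hnot
  set w : ℂ := ⟨F 1, F Complex.I⟩ with hw
  have hFw : ∀ z, F z = w.re * z.re + w.im * z.im := by
    intro z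
    have : z = z.re • (1 : ℂ) + z.im • Complex.I := by simp
    conv_lhs => rw [this]
    rw [map_add, map_smul, map_smul]
    simp only [hw, smul_eq_mul]; ring
  set β := u - F a with hβ
  have hβ0 : 0 < β := sub_pos.2 hFa
  have hV : ∀ v ∈ sphere k r \ Ω, β < F (v - a) := by
    intro v hv
    have := hFv v (subset_convexHull ℝ _ hv)
    rw [map_sub]; linarith
  rw [mem_ball_iff_norm] at ha
  have hr : 0 < r := (norm_nonneg _).trans_lt ha
  -- The functional `F` is larger on the singular points than at `a`. Its gradient `w` gives the
  -- direction in which to retreat, and the squared radius `Rt t` is set so that the power of `a`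
  -- grows by `t * β`.
  set kt : ℝ → ℂ := fun t => k - t * w with hkt
  set Rt : ℝ → ℝ := fun t => ‖a - kt t‖ ^ 2 + (r ^ 2 - ‖a - k‖ ^ 2) + t * β with hRt
  have hpow : ∀ t z, ‖z - kt t‖ ^ 2 - ‖a - kt t‖ ^ 2 =
      ‖z - k‖ ^ 2 - ‖a - k‖ ^ 2 + 2 * t * F (z - a) := by
    intro t z
    rw [hkt]
    simp only [norm_sub_add_mul_sq, hFw, Complex.sub_re, Complex.sub_im]
    ring
  have hmem : ∀ t z, z ∈ ball (kt t) (√(Rt t)) ↔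
      ‖z - k‖ ^ 2 < r ^ 2 + t * (β - 2 * F (z - a)) := by
    intro t z
    rw [mem_ball_iff_norm, Real.lt_sqrt (norm_nonneg _)]
    have := hpow t z
    simp only [hRt]
    constructor <;> intro h <;> nlinarith
  obtain ⟨M, hM⟩ : ∃ M : ℝ, ∀ t ∈ Icc (0 : ℝ) 1, ∀ z ∈ ball (kt t) (√(Rt t)), z ∈ closedBall k M := by
    have hc : ContinuousOn (fun t => ‖kt t - k‖ + √(Rt t)) (Icc 0 1) := by
      simp only [hRt, hkt]
      exact Continuous.continuousOn (by fun_prop)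
    obtain ⟨M, hM⟩ := (isCompact_Icc.image_of_continuousOn hc).bddAbove
    refine ⟨M, fun t ht z hz => ?_⟩
    rw [mem_closedBall_iff_norm]
    rw [mem_ball_iff_norm] at hz
    have h1 := hM (mem_image_of_mem _ ht)
    calc ‖z - k‖ = ‖(z - kt t) + (kt t - k)‖ := by ring_nf
      _ ≤ ‖z - kt t‖ + ‖kt t - k‖ := norm_add_le _ _
      _ ≤ M := by linarith
  -- Only these points outside `Ω` could enter the moved disc. They form a compact set at distance
  -- greater than `r` from `k`, because the singular points have `β < F (v - a)`; so a small `t`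
  -- keeps them out.
  set C : Set ℂ := (closedBall k M \ Ω) ∩ {z | 0 ≤ β - 2 * F (z - a)} with hC
  have hCc : IsCompact C :=
    ((isCompact_closedBall k M).diff hΩ).inter_right (isClosed_le continuous_const (by fun_prop))
  have hge : ∀ z, z ∉ Ω → r ≤ ‖z - k‖ := by
    intro z hz
    by_contra! h
    exact hz (hD (mem_ball_iff_norm.2 h))
  obtain ⟨t, ht0, ht1, htC⟩ : ∃ t : ℝ, 0 < t ∧ t ≤ 1 ∧
      ∀ z ∈ C, r ^ 2 + t * (β - 2 * F (z - a)) ≤ ‖z - k‖ ^ 2 := by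
    rcases C.eq_empty_or_nonempty with h0 | hne
    · exact ⟨1, one_pos, le_rfl, by simp [h0]⟩
    obtain ⟨z₁, hz₁, hmin⟩ := hCc.exists_isMinOn hne (f := fun z => ‖z - k‖ ^ 2) (by fun_prop)
    obtain ⟨z₂, hz₂, hmx⟩ := hCc.exists_isMaxOn hne (f := fun z => β - 2 * F (z - a)) (by fun_prop)
    have hm : 0 < ‖z₁ - k‖ ^ 2 - r ^ 2 := by
      have h1 := hge z₁ hz₁.1.2
      rcases h1.eq_or_lt with h2 | h2
      · have h3 := hV z₁ ⟨mem_sphere_iff_norm.2 h2.symm, hz₁.1.2⟩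
        have h4 : 0 ≤ β - 2 * F (z₁ - a) := hz₁.2
        linarith
      · nlinarith
    have hH : 0 ≤ β - 2 * F (z₂ - a) := hz₂.2
    set m := ‖z₁ - k‖ ^ 2 - r ^ 2 with hm'
    set H := β - 2 * F (z₂ - a)
    refine ⟨min 1 (m / (H + 1)), by positivity, min_le_left _ _, fun z hz => ?_⟩
    have h1 : m + r ^ 2 ≤ ‖z - k‖ ^ 2 := by
      have : ‖z₁ - k‖ ^ 2 ≤ ‖z - k‖ ^ 2 := hmin hz
      linarith
    have h2 : β - 2 * F (z - a) ≤ H := hmx hz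
    have h3 : 0 ≤ β - 2 * F (z - a) := hz.2
    have h4 : min 1 (m / (H + 1)) * (H + 1) ≤ m := by
      calc _ ≤ m / (H + 1) * (H + 1) := by gcongr; exact min_le_right _ _
        _ = m := by field_simp
    have h5 : 0 ≤ min 1 (m / (H + 1)) := by positivity
    nlinarith
  have hsub : ball (kt t) (√(Rt t)) ⊆ Ω := by
    intro z hz
    by_contra hzΩ
    have h1 := hM t ⟨ht0.le, ht1⟩ z hz
    have h2 := (hmem t z).1 hz
    rcases le_or_gt 0 (β - 2 * F (z - a)) with h3 | h3
    · exact absurd (htC z ⟨⟨h1, hzΩ⟩, h3⟩) (not_le.2 h2)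
    · have h4 := hge z hzΩ
      nlinarith
  have hain : a ∈ ball (kt t) (√(Rt t)) := by
    rw [hmem, sub_self, map_zero]
    nlinarith [norm_nonneg (a - k)]
  have := hmax _ _ hain hsub
  rw [Real.sq_sqrt] at this
  · simp only [hRt] at this
    nlinarith
  · simp only [hRt]
    nlinarith [norm_nonneg (a - k), sq_nonneg ‖a - kt t‖]

theorem finite_of_separated {W : Set ℂ} {δ : ℝ} (hδ : 0 < δ) (hW : Bornology.IsBounded W)
    (hsep : ∀ v ∈ W, ∀ v' ∈ W, ‖v' - v‖ < δ → v = v') : W.Finite := by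
  by_contra hinf
  obtain ⟨x, -, hx⟩ := Set.Infinite.exists_accPt_of_subset_isCompact hinf
    hW.isCompact_closure subset_closure
  rw [accPt_iff_nhds] at hx
  obtain ⟨y, ⟨hy1, hy2⟩, hyx⟩ := hx _ (ball_mem_nhds x (half_pos hδ))
  have hpos : 0 < dist y x := dist_pos.2 hyx
  -- A second point strictly closer to the accumulation point, hence different from the first.
  obtain ⟨y', ⟨hy1', hy2'⟩, hyx'⟩ := hx _ (ball_mem_nhds x hpos)
  have hlt : dist y' x < dist y x := hy1'
  have : y = y' := hsep y hy2 y' hy2' (by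
    rw [← dist_eq_norm]
    have h1 : dist y x < δ / 2 := hy1
    calc _ ≤ dist y' x + dist y x := dist_triangle_right _ _ _
      _ < δ := by linarith)
  rw [this] at hlt
  exact lt_irrefl _ hlt

/-- The singular boundary points of a flat disc are separated. -/
theorem FlatOn.singular_separated [T2Space S] [CompactSpace S] (hq : q.IsMarkedBy Z) (hZ : Z.Finite)
    {η : ℝ} (hη : IsConeScale q Z η) {φ : ℂ → S} (hφ : FlatOn q Z φ (ball k r)) (hr : 0 < r)
    {v v' : ℂ} (hv : v ∈ sphere k r ∧ ¬ RegularAt q Z φ (ball k r) v)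
    (hv' : v' ∈ sphere k r ∧ ¬ RegularAt q Z φ (ball k r) v') (hd : ‖v' - v‖ < η) : v = v' := by
  refine FlatOn.eq_of_dist_lt hq hZ hη hφ hφ (mem_ball_self hr) (mem_ball_self hr) EventuallyEq.rfl
    hv.1 hv'.1 hv.2 hv'.2 hd ?_
  have hcl : v ∈ closure (ball k r) := by
    rw [closure_ball k hr.ne']; exact sphere_subset_closedBall hv.1
  obtain ⟨x, hx, hx'⟩ := Metric.mem_closure_iff.1 hcl η hη.1
  exact ⟨x, hx, hx, by rwa [dist_comm, dist_eq_norm] at hx'⟩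

/-- A flat disc has finitely many singular boundary points. -/
theorem FlatOn.finite_singular [T2Space S] [CompactSpace S] (hq : q.IsMarkedBy Z) (hZ : Z.Finite)
    {η : ℝ} (hη : IsConeScale q Z η) {φ : ℂ → S} (hφ : FlatOn q Z φ (ball k r)) :
    {v ∈ sphere k r | ¬ RegularAt q Z φ (ball k r) v}.Finite := by
  rcases le_or_gt r 0 with hr | hr
  · refine Set.Finite.subset (finite_singleton k) ?_
    rintro v ⟨hv, -⟩
    rw [mem_sphere] at hv
    have : dist v k ≤ 0 := by linarith
    exact dist_le_zero.1 this
  exact finite_of_separated hη.1 (isBounded_sphere.subset (sep_subset _ _))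
    fun v hv v' hv' => hφ.singular_separated hq hZ hη hr hv hv'

/-- The singular boundary points of the discs around which `Φ` develops and which contain a given
disc around `a` are finite in number. -/
theorem IsDeveloping.finite_singular [T2Space S] [CompactSpace S] (h : IsDeveloping q Z a Φ Ω)
    (hq : q.IsMarkedBy Z) (hZ : Z.Finite) {η : ℝ} (hη : IsConeScale q Z η) {R : ℝ} (hR0 : 0 < R)
    (hR : ∀ k r, ball k r ⊆ Ω → r ≤ R) {s : ℝ} (hs : 0 < s) :
    {v | ∃ k r, ball a s ⊆ ball k r ∧ ball k r ⊆ Ω ∧ v ∈ sphere k r ∧ v ∉ Ω}.Finite := by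
  -- The witness for the overlap of two discs is `a + (1 - θ) * (v₁ - a)`: it is within `η` of `v₁`,
  -- as `‖v₁ - a‖ ≤ 2 * R`.
  set θ : ℝ := min (1 / 2) (η / (4 * R)) with hθ
  have hη0 := hη.1
  have hθ0 : 0 < θ := by positivity
  have hθ1 : θ < 1 := (min_le_left _ _).trans_lt (by norm_num)
  have hθη : θ * (2 * R) < η := by
    calc _ ≤ η / (4 * R) * (2 * R) := by gcongr; exact min_le_right _ _
      _ = η / 2 := by field_simp; norm_num
      _ < η := by linarith
  have hbd : ∀ v k r, ball a s ⊆ ball k r → ball k r ⊆ Ω → v ∈ sphere k r → ‖v - a‖ ≤ 2 * R := by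
    intro v k r h1 h2 h3
    have ha := h1 (mem_ball_self hs)
    have hr := hR k r h2
    rw [mem_ball', dist_eq_norm] at ha
    rw [mem_sphere_iff_norm] at h3
    calc ‖v - a‖ = ‖(v - k) + (k - a)‖ := by ring_nf
      _ ≤ ‖v - k‖ + ‖k - a‖ := norm_add_le _ _
      _ ≤ 2 * R := by linarith
  refine finite_of_separated (δ := min η (s * θ)) (by positivity) ?_ ?_
  · refine (isBounded_closedBall (x := a) (r := 2 * R)).subset ?_
    rintro v ⟨k, r, h1, h2, h3, -⟩
    exact mem_closedBall_iff_norm.2 (hbd v k r h1 h2 h3)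
  · rintro v₁ ⟨k₁, r₁, hs₁, hΩ₁, hv₁, hv₁Ω⟩ v₂ ⟨k₂, r₂, hs₂, hΩ₂, hv₂, hv₂Ω⟩ hd
    have ha₁ := hs₁ (mem_ball_self hs)
    have ha₂ := hs₂ (mem_ball_self hs)
    refine FlatOn.eq_of_dist_lt hq hZ hη (h.flatOn.mono hΩ₁) (h.flatOn.mono hΩ₂) ha₁ ha₂
      EventuallyEq.rfl hv₁ hv₂ (by rwa [h.regularAt_iff ha₁ hΩ₁ hv₁])
      (by rwa [h.regularAt_iff ha₂ hΩ₂ hv₂]) (hd.trans_le (min_le_left _ _)) ?_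
    have hθc : (θ : ℂ) ≠ 0 := by exact_mod_cast hθ0.ne'
    refine ⟨a + ((1 - θ : ℝ) : ℂ) * (v₁ - a),
      add_smul_mem_ball ha₁ (sphere_subset_closedBall hv₁) (by linarith) (by linarith), ?_, ?_⟩
    · have hb : a + (((1 - θ) / θ : ℝ) : ℂ) * (v₁ - v₂) ∈ ball k₂ r₂ := by
        apply hs₂
        rw [mem_ball_iff_norm, add_sub_cancel_left, norm_mul, Complex.norm_of_nonneg (by
          apply div_nonneg <;> linarith), norm_sub_rev]
        have hd' : ‖v₂ - v₁‖ < s * θ := hd.trans_le (min_le_right _ _)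
        rw [div_mul_eq_mul_div, div_lt_iff₀ hθ0]
        nlinarith [norm_nonneg (v₂ - v₁)]
      have := add_smul_mem_ball (s := 1 - θ) hb (sphere_subset_closedBall hv₂) (by linarith)
        (by linarith)
      convert this using 1
      push_cast
      field_simp
      ring
    · have h1 : a + ((1 - θ : ℝ) : ℂ) * (v₁ - a) - v₁ = (θ : ℂ) * (a - v₁) := by push_cast; ring
      rw [h1, norm_mul, Complex.norm_of_nonneg hθ0.le, norm_sub_rev]
      exact lt_of_le_of_lt (by gcongr; exact hbd v₁ k₁ r₁ hs₁ hΩ₁ hv₁) hθη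

end Developing

/-! ### Open simplices, affine functions and points on a circle -/

section Simplices

/-- The relative interior of the simplex with vertex set `T`. -/
def openSimplex (T : Finset ℂ) : Set ℂ :=
  {y | ∃ w : ℂ → ℝ, (∀ v ∈ T, 0 < w v) ∧ ∑ v ∈ T, w v = 1 ∧ ∑ v ∈ T, (w v : ℂ) * v = y}

def IsAffine (L : ℂ → ℝ) : Prop := ∃ A B C : ℝ, ∀ z, L z = A * z.re + B * z.im + C

variable {T : Finset ℂ} {L : ℂ → ℝ} {y a b c : ℂ}

theorem IsAffine.sum (hL : IsAffine L) {w : ℂ → ℝ} (hw : ∑ v ∈ T, w v = 1) :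
    L (∑ v ∈ T, (w v : ℂ) * v) = ∑ v ∈ T, w v * L v := by
  obtain ⟨A, B, C, h⟩ := hL
  simp only [h, Complex.re_sum, Complex.im_sum, Complex.re_ofReal_mul, Complex.im_ofReal_mul,
    mul_add, Finset.sum_add_distrib, Finset.mul_sum]
  rw [← Finset.sum_mul, hw, one_mul]
  congr 2 <;> exact Finset.sum_congr rfl fun _ _ => by ring

theorem IsAffine.le_zero_of_mem (hL : IsAffine L) (hT : ∀ v ∈ T, L v ≤ 0) (hy : y ∈ openSimplex T) :
    L y ≤ 0 := by
  obtain ⟨w, hw, hw1, rfl⟩ := hy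
  rw [hL.sum hw1]
  exact Finset.sum_nonpos fun v hv => mul_nonpos_of_nonneg_of_nonpos (hw v hv).le (hT v hv)

/-- All weights are strictly positive, so a vanishing sum of nonpositive terms vanishes term by
term. -/
theorem IsAffine.eq_zero_of_mem (hL : IsAffine L) (hT : ∀ v ∈ T, L v ≤ 0) (hy : y ∈ openSimplex T)
    (hLy : L y = 0) : ∀ v ∈ T, L v = 0 := by
  obtain ⟨w, hw, hw1, rfl⟩ := hy
  rw [hL.sum hw1] at hLy
  intro v hv
  have := (Finset.sum_eq_zero_iff_of_nonpos fun v hv =>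
    mul_nonpos_of_nonneg_of_nonpos (hw v hv).le (hT v hv)).1 hLy v hv
  exact (mul_eq_zero.1 this).resolve_left (hw v hv).ne'

theorem IsAffine.exists_sign_of_mem (hL : IsAffine L) (hy : y ∈ openSimplex T) (ha : a ∈ T)
    (hT : ∀ v ∈ T, v ≠ a → L v = 0) : ∃ s > 0, L y = s * L a := by
  obtain ⟨w, hw, hw1, rfl⟩ := hy
  refine ⟨w a, hw a ha, ?_⟩
  rw [hL.sum hw1]
  exact Finset.sum_eq_single_of_mem a ha fun v hv hva => by rw [hT v hv hva, mul_zero]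

theorem IsAffine.neg (hL : IsAffine L) : IsAffine (fun z => -L z) := by
  obtain ⟨A, B, C, h⟩ := hL
  exact ⟨-A, -B, -C, fun z => by simp only [h]; ring⟩

theorem mem_openSimplex_pair (hab : a ≠ b) {s t : ℝ} (hs : 0 < s) (ht : 0 < t) (hst : s + t = 1) :
    (s : ℂ) * a + t * b ∈ openSimplex {a, b} := by
  refine ⟨fun v => if v = a then s else t, ?_, ?_, ?_⟩
  · intro v _; dsimp only; split_ifs <;> assumption
  · rw [Finset.sum_pair hab]; simp [hab.symm, hst]
  · rw [Finset.sum_pair hab]; simp [hab.symm]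

theorem mem_openSimplex_triple (hab : a ≠ b) (hac : a ≠ c) (hbc : b ≠ c) {s t u : ℝ} (hs : 0 < s)
    (ht : 0 < t) (hu : 0 < u) (hst : s + t + u = 1) :
    (s : ℂ) * a + t * b + u * c ∈ openSimplex {a, b, c} := by
  refine ⟨fun v => if v = a then s else if v = b then t else u, ?_, ?_, ?_⟩
  · intro v _; dsimp only; split_ifs <;> assumption
  · rw [Finset.sum_insert (by simp [hab, hac]), Finset.sum_pair hbc]
    simp [hab.symm, hac.symm, hbc.symm, ← hst, add_assoc]
  · rw [Finset.sum_insert (by simp [hab, hac]), Finset.sum_pair hbc]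
    simp [hab.symm, hac.symm, hbc.symm, add_assoc]

theorem openSimplex_subset_convexHull (T : Finset ℂ) : openSimplex T ⊆ convexHull ℝ T := by
  rintro _ ⟨w, hw, hw1, rfl⟩
  rw [Finset.mem_convexHull']
  exact ⟨w, fun v hv => (hw v hv).le, hw1, by simp⟩

theorem IsAffine.convex_le (hL : IsAffine L) : Convex ℝ {z | L z ≤ 0} := by
  obtain ⟨A, B, C, h⟩ := hL
  intro x hx y hy s t hs ht hst
  have hx : L x ≤ 0 := hx
  have hy : L y ≤ 0 := hy
  show L (s • x + t • y) ≤ 0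
  have : L (s • x + t • y) = s * L x + t * L y := by
    simp only [h, Complex.add_re, Complex.add_im, Complex.smul_re, Complex.smul_im, smul_eq_mul]
    linear_combination -C * hst
  rw [this]
  nlinarith

/-- The oriented area form: positive when `z` is on the left of the line from `a` to `b`. -/
def cross (a b z : ℂ) : ℝ := (b.re - a.re) * (z.im - a.im) - (b.im - a.im) * (z.re - a.re)

theorem isAffine_cross (a b : ℂ) : IsAffine (cross a b) :=
  ⟨-(b.im - a.im), b.re - a.re, (b.im - a.im) * a.re - (b.re - a.re) * a.im,
    fun z => by rw [cross]; ring⟩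

theorem sq_dist_eq (z k : ℂ) : ‖z - k‖ ^ 2 = (z.re - k.re) ^ 2 + (z.im - k.im) ^ 2 := by
  rw [Complex.sq_norm, Complex.normSq_apply, Complex.sub_re, Complex.sub_im]; ring

/-- A line meets a closed disc in the chord between the points where it meets the circle. -/
theorem exists_of_cross_eq_zero {k m : ℂ} {r : ℝ} (hab : a ≠ b) (ha : ‖a - k‖ = r)
    (hb : ‖b - k‖ = r) (hm : ‖m - k‖ ≤ r) (h : cross a b m = 0) :
    ∃ τ : ℝ, 0 ≤ τ ∧ τ ≤ 1 ∧ m = (1 - τ : ℝ) * a + τ * b := by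
  have ha2 := sq_dist_eq a k
  have hb2 := sq_dist_eq b k
  have hm2 := sq_dist_eq m k
  rw [ha] at ha2
  rw [hb] at hb2
  have hmr : ‖m - k‖ ^ 2 ≤ r ^ 2 := by gcongr
  have hd : 0 < (b.re - a.re) ^ 2 + (b.im - a.im) ^ 2 := by
    rw [← sq_dist_eq]
    have : 0 < ‖b - a‖ := norm_pos_iff.2 (sub_ne_zero.2 hab.symm)
    positivity
  set d := (b.re - a.re) ^ 2 + (b.im - a.im) ^ 2 with hd'
  set τ := ((b.re - a.re) * (m.re - a.re) + (b.im - a.im) * (m.im - a.im)) / d with hτ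
  have hτd : τ * d = (b.re - a.re) * (m.re - a.re) + (b.im - a.im) * (m.im - a.im) := by
    rw [hτ]; field_simp
  rw [cross] at h
  have hre : m.re = (1 - τ) * a.re + τ * b.re := by
    apply mul_right_cancel₀ hd.ne'
    linear_combination (a.re - b.re) * hτd + (b.im - a.im) * -h + (m.re - a.re) * hd'
  have him : m.im = (1 - τ) * a.im + τ * b.im := by
    apply mul_right_cancel₀ hd.ne'
    linear_combination (a.im - b.im) * hτd + (b.re - a.re) * h + (m.im - a.im) * hd'
  -- This product is `r ^ 2 - ‖m - k‖ ^ 2`, by the intersecting chords theorem.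
  have hpow : 0 ≤ τ * (1 - τ) * d := by
    have : r ^ 2 - ‖m - k‖ ^ 2 = τ * (1 - τ) * d := by
      rw [hm2, hre, him]
      linear_combination (1 - τ) * ha2 + τ * hb2 - τ * (1 - τ) * hd'
    linarith
  have h01 : 0 ≤ τ * (1 - τ) := nonneg_of_mul_nonneg_left hpow hd
  refine ⟨τ, by nlinarith, by nlinarith, ?_⟩
  apply Complex.ext
  · simp only [Complex.add_re, Complex.re_ofReal_mul]; exact hre
  · simp only [Complex.add_im, Complex.im_ofReal_mul]; exact him

/-- The hypotheses say that the points `(X, t * X)` lie on a circle through the origin with centre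
on the first axis. Their orientation is a Vandermonde determinant in the slopes, so it is read off
from the order of the slopes. -/
theorem det_of_slopes {X₁ X₂ X₃ t₁ t₂ t₃ d : ℝ} (h₁ : X₁ * (1 + t₁ ^ 2) = d)
    (h₂ : X₂ * (1 + t₂ ^ 2) = d) (h₃ : X₃ * (1 + t₃ ^ 2) = d) :
    d * ((X₂ - X₁) * (t₃ * X₃ - t₁ * X₁) - (t₂ * X₂ - t₁ * X₁) * (X₃ - X₁)) =
      X₁ * X₂ * X₃ * ((t₂ - t₁) * (t₃ - t₁) * (t₃ - t₂)) := by
  linear_combination (-(X₂ * X₃ * (t₃ - t₂))) * h₁ + (X₁ * X₃ * (t₃ - t₁)) * h₂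
    - (X₁ * X₂ * (t₂ - t₁)) * h₃

/-- Among at least three points on a circle one finds an ear: a point cut off from the others by
the chord between two of them. -/
theorem exists_ear {V : Finset ℂ} {k : ℂ} {r : ℝ} (hV : ∀ v ∈ V, ‖v - k‖ = r) {w : ℂ} (hw : w ∈ V)
    (hcard : 3 ≤ V.card) : ∃ a ∈ V, ∃ b ∈ V, a ≠ b ∧ a ≠ w ∧ b ≠ w ∧ 0 < cross a b w ∧
      ∀ v ∈ V, v ≠ a → v ≠ b → v ≠ w → cross a b v < 0 := by
  set V' := V.erase w with hV'
  have hcard' : 2 ≤ V'.card := by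
    rw [hV', Finset.card_erase_of_mem hw]; omega
  -- Coordinates, scaled by `r`, with origin `w` and first axis towards the centre. All other points
  -- have `X > 0`, and their slope `Y / X` seen from `w` determines them.
  set X : ℂ → ℝ := fun v => (v.re - w.re) * (k.re - w.re) + (v.im - w.im) * (k.im - w.im) with hX
  set Y : ℂ → ℝ := fun v => (v.im - w.im) * (k.re - w.re) - (v.re - w.re) * (k.im - w.im) with hY
  set d := (w.re - k.re) ^ 2 + (w.im - k.im) ^ 2 with hd
  have hwk := sq_dist_eq w k
  rw [hV w hw, ← hd] at hwk
  have hcirc : ∀ v ∈ V', (v.re - w.re) ^ 2 + (v.im - w.im) ^ 2 = 2 * X v := by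
    intro v hv
    have h1 := sq_dist_eq v k
    rw [hV v (Finset.mem_of_mem_erase hv), hwk] at h1
    simp only [hX]; linear_combination -h1 - hd
  have hXpos : ∀ v ∈ V', 0 < X v := by
    intro v hv
    have h1 := hcirc v hv
    rw [← sq_dist_eq] at h1
    have : 0 < ‖v - w‖ := norm_pos_iff.2 (sub_ne_zero.2 (Finset.ne_of_mem_erase hv))
    nlinarith
  have hXY : ∀ v ∈ V', X v ^ 2 + Y v ^ 2 = 2 * d * X v := by
    intro v hv
    simp only [hX, hY, hd]
    linear_combination ((k.re - w.re) ^ 2 + (k.im - w.im) ^ 2) * hcirc v hv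
  have hd0 : 0 < d := by
    obtain ⟨v, hv⟩ : V'.Nonempty := Finset.card_pos.1 (by omega)
    nlinarith [hXY v hv, hXpos v hv, sq_nonneg (Y v)]
  set t : ℂ → ℝ := fun v => Y v / X v with ht
  have hYt : ∀ v ∈ V', Y v = t v * X v := fun v hv => by
    simp only [ht]; rw [div_mul_cancel₀ _ (hXpos v hv).ne']
  have hXt : ∀ v ∈ V', X v * (1 + t v ^ 2) = 2 * d := by
    intro v hv
    apply mul_right_cancel₀ (hXpos v hv).ne'
    rw [← hXY v hv, hYt v hv]; ring
  have hinj : ∀ u ∈ V', ∀ v ∈ V', t u = t v → u = v := by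
    intro u hu v hv huv
    have hXe : X u = X v := by
      have h1 := hXt u hu
      have h2 := hXt v hv
      rw [huv, ← h2] at h1
      exact mul_right_cancel₀ (by positivity) h1
    have hYe : Y u = Y v := by rw [hYt u hu, hYt v hv, hXe, huv]
    simp only [hX, hY] at hXe hYe
    apply Complex.ext
    · apply mul_right_cancel₀ hd0.ne'
      linear_combination (k.re - w.re) * hXe - (k.im - w.im) * hYe
        + (u.re - v.re) * hd
    · apply mul_right_cancel₀ hd0.ne'
      linear_combination (k.im - w.im) * hXe + (k.re - w.re) * hYe
        + (u.im - v.im) * hd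
  have hne : V'.Nonempty := Finset.card_pos.1 (by omega)
  -- The chord between the points of extreme slope cuts off `w`.
  obtain ⟨a, ha, hamin⟩ := Finset.exists_min_image V' t hne
  obtain ⟨b, hb, hbmax⟩ := Finset.exists_max_image V' t hne
  have hab : a ≠ b := by
    rintro rfl
    obtain ⟨x, hx, y, hy, hxy⟩ := Finset.one_lt_card.1 (show 1 < V'.card by omega)
    have h1 := hinj x hx a ha (le_antisymm (hbmax x hx) (hamin x hx))
    have h2 := hinj y hy a ha (le_antisymm (hbmax y hy) (hamin y hy))
    exact hxy (h1.trans h2.symm)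
  have htab : t a < t b := lt_of_le_of_ne (hamin b hb) fun h => hab (hinj a ha b hb h)
  have hcr : ∀ z, d * cross a b z = (X b - X a) * (Y z - Y a) - (Y b - Y a) * (X z - X a) := by
    intro z
    simp only [cross, hX, hY, hd]; ring
  refine ⟨a, Finset.mem_of_mem_erase ha, b, Finset.mem_of_mem_erase hb, hab,
    Finset.ne_of_mem_erase ha, Finset.ne_of_mem_erase hb, ?_, ?_⟩
  · have h1 : d * cross a b w = X a * X b * (t b - t a) := by
      rw [hcr, hYt a ha, hYt b hb]
      simp only [hX, hY, sub_self, zero_mul, add_zero]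
      ring
    have h2 : 0 < X a * X b * (t b - t a) :=
      mul_pos (mul_pos (hXpos a ha) (hXpos b hb)) (sub_pos.2 htab)
    rw [← h1] at h2
    exact (mul_pos_iff_of_pos_left hd0).1 h2
  · intro v hv hva hvb hvw
    have hv' : v ∈ V' := Finset.mem_erase.2 ⟨hvw, hv⟩
    have htav : t a < t v := lt_of_le_of_ne (hamin v hv') fun h => hva (hinj a ha v hv' h).symm
    have htvb : t v < t b := lt_of_le_of_ne (hbmax v hv') fun h => hvb (hinj v hv' b hb h)
    have h1 : 2 * d * (d * cross a b v) =
        X a * X b * X v * ((t b - t a) * (t v - t a) * (t v - t b)) := by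
      rw [hcr, hYt a ha, hYt b hb, hYt v hv']
      exact det_of_slopes (hXt a ha) (hXt b hb) (hXt v hv')
    have h2 : X a * X b * X v * ((t b - t a) * (t v - t a) * (t v - t b)) < 0 := by
      refine mul_neg_of_pos_of_neg (mul_pos (mul_pos (hXpos a ha) (hXpos b hb)) (hXpos v hv')) ?_
      exact mul_neg_of_pos_of_neg (mul_pos (sub_pos.2 htab) (sub_pos.2 htav)) (sub_neg.2 htvb)
    rw [← h1] at h2
    by_contra! h3
    have : 0 ≤ 2 * d * (d * cross a b v) := by positivity
    linarith

end Simplices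

/-! ### Triangulating a polygon inscribed in a circle -/

section Fan

/-- A triangulation of the convex hull of the finite set `V`, with vertex set `V`, given by the vertex
sets of its edges and triangles. -/
structure IsPlanarTriangulation (V : Finset ℂ) (𝒯 : Set (Finset ℂ)) : Prop where
  subset : ∀ T ∈ 𝒯, T ⊆ V
  card : ∀ T ∈ 𝒯, T.card = 2 ∨ T.card = 3
  edge_mem : ∀ T ∈ 𝒯, T.card = 3 → ∀ T' ⊆ T, T'.card = 2 → T' ∈ 𝒯
  existsUnique : ∀ y ∈ convexHull ℝ (V : Set ℂ), y ∉ V → ∃! T, T ∈ 𝒯 ∧ y ∈ openSimplex T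

theorem cross_self_left (a b : ℂ) : cross a b a = 0 := by simp [cross]

theorem cross_self_right (a b : ℂ) : cross a b b = 0 := by simp [cross]; ring

theorem cross_rotate (a b c : ℂ) : cross a b c = cross b c a := by simp only [cross]; ring

theorem IsAffine.combo {L : ℂ → ℝ} (hL : IsAffine L) {s t : ℝ} (hst : s + t = 1) (x y : ℂ) :
    L (s * x + t * y) = s * L x + t * L y := by
  obtain ⟨A, B, C, h⟩ := hL
  simp only [h, Complex.add_re, Complex.add_im, Complex.re_ofReal_mul, Complex.im_ofReal_mul]
  linear_combination -C * hst

theorem norm_midpoint_lt {a b k : ℂ} {r : ℝ} (hab : a ≠ b) (ha : ‖a - k‖ = r) (hb : ‖b - k‖ = r) :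
    ‖((1 / 2 : ℝ) : ℂ) * a + ((1 / 2 : ℝ) : ℂ) * b - k‖ < r := by
  have h1 := sq_dist_eq a k
  have h2 := sq_dist_eq b k
  have h3 := sq_dist_eq (((1 / 2 : ℝ) : ℂ) * a + ((1 / 2 : ℝ) : ℂ) * b) k
  have h4 := sq_dist_eq a b
  rw [ha] at h1
  rw [hb] at h2
  simp only [Complex.add_re, Complex.add_im, Complex.re_ofReal_mul, Complex.im_ofReal_mul] at h3
  have h5 : 0 < ‖a - b‖ := norm_pos_iff.2 (sub_ne_zero.2 hab)
  refine lt_of_pow_lt_pow_left₀ 2 (ha ▸ norm_nonneg _) ?_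
  nlinarith

theorem segment_exists {x y z : ℂ} (h : z ∈ segment ℝ x y) :
    ∃ s t : ℝ, 0 ≤ s ∧ 0 ≤ t ∧ s + t = 1 ∧ z = s * x + t * y := by
  obtain ⟨s, t, hs, ht, hst, rfl⟩ := h
  exact ⟨s, t, hs, ht, hst, by simp⟩

theorem mem_segment_combo {x y : ℂ} {s t : ℝ} (hs : 0 ≤ s) (ht : 0 ≤ t) (hst : s + t = 1) :
    (s : ℂ) * x + t * y ∈ segment ℝ x y := ⟨s, t, hs, ht, hst, by simp⟩

theorem convexHull_subset_closedBall {V : Set ℂ} {k : ℂ} {r : ℝ} (hV : ∀ v ∈ V, ‖v - k‖ = r) :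
    convexHull ℝ V ⊆ closedBall k r :=
  convexHull_min (fun v hv => mem_closedBall_iff_norm.2 (hV v hv).le) (convex_closedBall k r)

theorem isPlanarTriangulation_pair {a b : ℂ} (hab : a ≠ b) :
    IsPlanarTriangulation {a, b} {({a, b} : Finset ℂ)} where
  subset := by rintro T rfl; exact Finset.Subset.refl _
  card := by rintro T rfl; exact Or.inl (Finset.card_pair hab)
  edge_mem := by
    rintro T rfl h
    rw [Finset.card_pair hab] at h
    omega
  existsUnique := by
    intro y hy hyV
    refine ⟨{a, b}, ⟨rfl, ?_⟩, fun T hT => hT.1⟩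
    rw [Finset.coe_pair, convexHull_pair] at hy
    obtain ⟨s, t, hs, ht, hst, rfl⟩ := segment_exists hy
    refine mem_openSimplex_pair hab (lt_of_le_of_ne hs ?_) (lt_of_le_of_ne ht ?_) hst
    · rintro rfl
      apply hyV
      obtain rfl : t = 1 := by linarith
      simp
    · rintro rfl
      apply hyV
      obtain rfl : s = 1 := by linarith
      simp

/-- Adding an ear to a triangulation. -/
theorem IsPlanarTriangulation.insert_ear {V : Finset ℂ} {k : ℂ} {r : ℝ} (hV : ∀ v ∈ V, ‖v - k‖ = r)
    {a b w : ℂ} (hw : w ∈ V) (ha : a ∈ V) (hb : b ∈ V) (hab : a ≠ b) (haw : a ≠ w) (hbw : b ≠ w)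
    (hLw : 0 < cross a b w) (hLv : ∀ v ∈ V, v ≠ a → v ≠ b → v ≠ w → cross a b v < 0)
    {𝒯 : Set (Finset ℂ)} (h𝒯 : IsPlanarTriangulation (V.erase w) 𝒯) :
    IsPlanarTriangulation V (𝒯 ∪ {{a, w}, {b, w}, {a, b, w}}) := by
  set V' := V.erase w with hV'
  have ha' : a ∈ V' := Finset.mem_erase.2 ⟨haw, ha⟩
  have hb' : b ∈ V' := Finset.mem_erase.2 ⟨hbw, hb⟩
  have hVV' : V' ⊆ V := Finset.erase_subset _ _
  have hins : insert w V' = V := Finset.insert_erase hw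
  set L := cross a b with hL
  have hLaff : IsAffine L := isAffine_cross a b
  have hLa : L a = 0 := cross_self_left a b
  have hLb : L b = 0 := cross_self_right a b
  have hLV' : ∀ v ∈ V', L v ≤ 0 := by
    intro v hv
    by_cases h1 : v = a
    · rw [h1, hLa]
    by_cases h2 : v = b
    · rw [h2, hLb]
    exact (hLv v (hVV' hv) h1 h2 (Finset.ne_of_mem_erase hv)).le
  have hLhull : ∀ q ∈ convexHull ℝ (V' : Set ℂ), L q ≤ 0 := fun q hq =>
    convexHull_min (t := {z | L z ≤ 0}) hLV' hLaff.convex_le hq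
  have hnew : ∀ T ∈ ({{a, w}, {b, w}, {a, b, w}} : Set (Finset ℂ)), ∀ y ∈ openSimplex T,
      0 < L y := by
    intro T hT y hy
    have hwT : w ∈ T ∧ ∀ v ∈ T, v ≠ w → L v = 0 := by
      rcases hT with rfl | rfl | rfl
      · simp [hLa]
      · simp [hLb]
      · simp only [Finset.mem_insert, Finset.mem_singleton]
        refine ⟨by simp, ?_⟩
        rintro v (rfl | rfl | rfl) hv
        · exact hLa
        · exact hLb
        · exact absurd rfl hv
    obtain ⟨s, hs, hsL⟩ := hLaff.exists_sign_of_mem hy hwT.1 hwT.2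
    rw [hsL]; exact mul_pos hs hLw
  -- Write `y` on a segment from `w` to a point `p` of the old hull. This segment crosses the line
  -- through `a` and `b` at a point `m`, which lies on the chord because it is in the disc. Then `y`
  -- is either beyond `m`, in the old hull, or before it, in the ear.
  have hdec : ∀ y ∈ convexHull ℝ (V : Set ℂ), y ∉ V →
      (L y ≤ 0 → y ∈ convexHull ℝ (V' : Set ℂ)) ∧ (0 < L y →
        y ∈ openSimplex {a, w} ∨ y ∈ openSimplex {b, w} ∨ y ∈ openSimplex {a, b, w}) := by
    intro y hy hyV
    rw [← hins, Finset.coe_insert, convexHull_insert ⟨a, ha'⟩, mem_convexJoin] at hy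
    obtain ⟨w', rfl, p, hp, hy⟩ := hy
    obtain ⟨s, t, hs, ht, hst, rfl⟩ := segment_exists hy
    have hLp := hLhull p hp
    set μ : ℝ := L w' / (L w' - L p) with hμ
    have hden : 0 < L w' - L p := by linarith
    have hμ0 : 0 < μ := div_pos hLw hden
    have hμ1 : μ ≤ 1 := by rw [hμ, div_le_one hden]; linarith
    have hμeq : (1 - μ) * L w' + μ * L p = 0 := by rw [hμ]; field_simp; ring
    set m : ℂ := (1 - μ : ℝ) * w' + μ * p with hm
    have hLm : L m = 0 := by rw [hm, hLaff.combo (by ring), hμeq]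
    have hmball : ‖m - k‖ ≤ r := by
      rw [← mem_closedBall_iff_norm]
      refine (convex_closedBall k r).segment_subset (x := w') (y := p) ?_ ?_
        (mem_segment_combo (by linarith) hμ0.le (by ring))
      · exact mem_closedBall_iff_norm.2 (hV w' hw).le
      · exact convexHull_subset_closedBall (fun v hv => hV v (hVV' hv)) hp
    obtain ⟨τ, hτ0, hτ1, hmτ⟩ := exists_of_cross_eq_zero hab (hV a ha) (hV b hb) hmball hLm
    have hLy : L (s * w' + t * p) = s * L w' + t * L p := hLaff.combo hst _ _
    have hs' : s = 1 - t := by linarith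
    have hLyμ : μ * L (s * w' + t * p) = (μ - t) * L w' := by
      rw [hLy, hs']; linear_combination t * hμeq
    constructor
    · intro hle
      have hmV' : m ∈ convexHull ℝ (V' : Set ℂ) := by
        rw [hmτ]
        exact (convex_convexHull ℝ _).segment_subset (subset_convexHull ℝ _ ha')
          (subset_convexHull ℝ _ hb') (mem_segment_combo (by linarith) hτ0 (by ring))
      have htμ : μ ≤ t := by
        by_contra! hlt
        have : 0 < (μ - t) * L w' := mul_pos (by linarith) hLw
        nlinarith
      rcases hμ1.eq_or_lt with h1 | h1
      · have : t = 1 := by linarith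
        subst this
        have : s = 0 := by linarith
        subst this
        simpa using hp
      refine (convex_convexHull ℝ _).segment_subset hmV' hp ?_
      have h1μ : 0 < 1 - μ := by linarith
      have := mem_segment_combo (x := m) (y := p) (s := (1 - t) / (1 - μ)) (t := (t - μ) / (1 - μ))
        (div_nonneg (by linarith) h1μ.le) (div_nonneg (by linarith) h1μ.le) (by field_simp; ring)
      convert this using 1
      have h1μc : (1 : ℂ) - μ ≠ 0 := by exact_mod_cast h1μ.ne'
      rw [hm, hs']
      push_cast
      field_simp
      ring
    · intro hlt
      have htμ : t < μ := by
        by_contra! hle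
        have : (μ - t) * L w' ≤ 0 := mul_nonpos_of_nonpos_of_nonneg (by linarith) hLw.le
        nlinarith
      have ht0 : 0 < t := by
        refine lt_of_le_of_ne ht ?_
        rintro rfl
        apply hyV
        have : s = 1 := by linarith
        subst this
        simpa using hw
      set ν : ℝ := t / μ with hν
      have hν0 : 0 < ν := div_pos ht0 hμ0
      have hν1 : ν < 1 := by rw [hν, div_lt_one hμ0]; exact htμ
      have hyν : (s : ℂ) * w' + t * p = (1 - ν : ℝ) * w' + ν * m := by
        have hμc : (μ : ℂ) ≠ 0 := by exact_mod_cast hμ0.ne'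
        rw [hm, hs', hν]
        push_cast
        field_simp
        ring
      rw [hyν, hmτ]
      rcases hτ0.eq_or_lt with h0 | h0
      · left
        subst h0
        convert mem_openSimplex_pair haw (s := ν) (t := 1 - ν) hν0 (by linarith) (by ring) using 1
        push_cast; ring
      rcases hτ1.eq_or_lt with h1 | h1
      · right; left
        subst h1
        convert mem_openSimplex_pair hbw (s := ν) (t := 1 - ν) hν0 (by linarith) (by ring) using 1
        push_cast; ring
      · right; right
        convert mem_openSimplex_triple hab haw hbw (s := ν * (1 - τ)) (t := ν * τ) (u := 1 - ν)
          (mul_pos hν0 (by linarith)) (mul_pos hν0 h0) (by linarith) (by ring) using 1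
        push_cast; ring
  refine ⟨?_, ?_, ?_, ?_⟩
  · rintro T (hT | rfl | rfl | rfl)
    · exact (h𝒯.subset T hT).trans hVV'
    · simp [Finset.insert_subset_iff, ha, hw]
    · simp [Finset.insert_subset_iff, hb, hw]
    · simp [Finset.insert_subset_iff, ha, hb, hw]
  · rintro T (hT | rfl | rfl | rfl)
    · exact h𝒯.card T hT
    · exact Or.inl (Finset.card_pair haw)
    · exact Or.inl (Finset.card_pair hbw)
    · exact Or.inr (Finset.card_eq_three.2 ⟨a, b, w, hab, haw, hbw, rfl⟩)
  -- The base of the ear is already an edge: the cell containing its midpoint has all vertices on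
  -- the line through `a` and `b`, since that line supports the old hull.
  · have habmem : ({a, b} : Finset ℂ) ∈ 𝒯 := by
      set m : ℂ := ((1 / 2 : ℝ) : ℂ) * a + ((1 / 2 : ℝ) : ℂ) * b with hm
      have hmV : m ∉ V' := fun h => by
        have h1 := norm_midpoint_lt hab (hV a ha) (hV b hb)
        rw [← hm, hV m (hVV' h)] at h1
        exact lt_irrefl _ h1
      have hmh : m ∈ convexHull ℝ (V' : Set ℂ) :=
        (convex_convexHull ℝ _).segment_subset (subset_convexHull ℝ _ ha')
          (subset_convexHull ℝ _ hb') (mem_segment_combo (by norm_num) (by norm_num) (by norm_num))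
      obtain ⟨T, ⟨hT, hmT⟩, -⟩ := h𝒯.existsUnique m hmh hmV
      have hTV := h𝒯.subset T hT
      have hLm : L m = 0 := by rw [hm, hLaff.combo (by norm_num), hLa, hLb]; ring
      have hT0 := hLaff.eq_zero_of_mem (fun v hv => hLV' v (hTV hv)) hmT hLm
      have hsub : T ⊆ {a, b} := by
        intro v hv
        by_contra hv'
        simp only [Finset.mem_insert, Finset.mem_singleton, not_or] at hv'
        have := hLv v (hVV' (hTV hv)) hv'.1 hv'.2 (Finset.ne_of_mem_erase (hTV hv))
        have h0 := hT0 v hv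
        exact absurd h0 this.ne
      have : T = {a, b} := Finset.eq_of_subset_of_card_le hsub (by
        rw [Finset.card_pair hab]
        rcases h𝒯.card T hT with h | h <;> omega)
      exact this ▸ hT
    rintro T (hT | rfl | rfl | rfl) h3 T' hT' hc
    · exact Or.inl (h𝒯.edge_mem T hT h3 T' hT' hc)
    · rw [Finset.card_pair haw] at h3; omega
    · rw [Finset.card_pair hbw] at h3; omega
    · obtain ⟨x, y, hxy, rfl⟩ := Finset.card_eq_two.1 hc
      simp only [Finset.insert_subset_iff, Finset.singleton_subset_iff, Finset.mem_insert,
        Finset.mem_singleton] at hT'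
      obtain ⟨rfl | rfl | rfl, rfl | rfl | rfl⟩ := hT'
      all_goals first
        | exact absurd rfl hxy
        | exact Or.inl habmem
        | exact Or.inl (by rw [Finset.pair_comm]; exact habmem)
        | exact Or.inr (Or.inl rfl)
        | exact Or.inr (Or.inr (Or.inl rfl))
        | exact Or.inr (Or.inl (Finset.pair_comm _ _))
        | exact Or.inr (Or.inr (Or.inl (Finset.pair_comm _ _)))
  · intro y hy hyV
    obtain ⟨h1, h2⟩ := hdec y hy hyV
    rcases le_or_gt (L y) 0 with hle | hlt
    · obtain ⟨T, ⟨hT, hyT⟩, huniq⟩ := h𝒯.existsUnique y (h1 hle) fun h => hyV (hVV' h)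
      refine ⟨T, ⟨Or.inl hT, hyT⟩, ?_⟩
      rintro T' ⟨hT' | hT', hyT'⟩
      · exact huniq T' ⟨hT', hyT'⟩
      · exact absurd (hnew T' hT' y hyT') (not_lt.2 hle)
    · have hold : ∀ T ∈ 𝒯, y ∉ openSimplex T := fun T hT hyT =>
        absurd (hLaff.le_zero_of_mem (fun v hv => hLV' v (h𝒯.subset T hT hv)) hyT) (not_le.2 hlt)
      -- The three new cells are told apart by which of `cross b w` and `cross w a` vanish.
      have hA : cross b w a ≠ 0 := by rw [← cross_rotate]; exact hLw.ne'
      have hB : cross w a b ≠ 0 := by rw [← cross_rotate, ← cross_rotate]; exact hLw.ne'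
      have haff1 := isAffine_cross b w
      have haff2 := isAffine_cross w a
      have e1 : y ∈ openSimplex {a, w} → cross b w y ≠ 0 ∧ cross w a y = 0 := by
        intro h
        obtain ⟨s, hs, h'⟩ := haff1.exists_sign_of_mem (a := a) h (by simp)
          (by simp [cross_self_right, haw.symm])
        obtain ⟨s', hs', h''⟩ := haff2.exists_sign_of_mem (a := w) h (by simp)
          (by simp [cross_self_right])
        rw [h', h'', cross_self_left]
        exact ⟨mul_ne_zero hs.ne' hA, mul_zero _⟩
      have e2 : y ∈ openSimplex {b, w} → cross b w y = 0 ∧ cross w a y ≠ 0 := by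
        intro h
        obtain ⟨s, hs, h'⟩ := haff1.exists_sign_of_mem (a := w) h (by simp)
          (by simp [cross_self_left])
        obtain ⟨s', hs', h''⟩ := haff2.exists_sign_of_mem (a := b) h (by simp)
          (by simp [cross_self_left])
        rw [h', h'', cross_self_right]
        exact ⟨mul_zero _, mul_ne_zero hs'.ne' hB⟩
      have e3 : y ∈ openSimplex {a, b, w} → cross b w y ≠ 0 ∧ cross w a y ≠ 0 := by
        intro h
        obtain ⟨s, hs, h'⟩ := haff1.exists_sign_of_mem (a := a) h (by simp)
          (by simp [cross_self_left, cross_self_right])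
        obtain ⟨s', hs', h''⟩ := haff2.exists_sign_of_mem (a := b) h (by simp)
          (by simp [cross_self_left, cross_self_right])
        rw [h', h'']
        exact ⟨mul_ne_zero hs.ne' hA, mul_ne_zero hs'.ne' hB⟩
      rcases h2 hlt with h | h | h
      · refine ⟨{a, w}, ⟨by simp, h⟩, ?_⟩
        rintro T' ⟨hT' | rfl | rfl | rfl, hyT'⟩
        · exact absurd hyT' (hold T' hT')
        · rfl
        · exact absurd (e2 hyT').1 (e1 h).1
        · exact absurd (e1 h).2 (e3 hyT').2
      · refine ⟨{b, w}, ⟨by simp, h⟩, ?_⟩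
        rintro T' ⟨hT' | rfl | rfl | rfl, hyT'⟩
        · exact absurd hyT' (hold T' hT')
        · exact absurd (e2 h).1 (e1 hyT').1
        · rfl
        · exact absurd (e2 h).1 (e3 hyT').1
      · refine ⟨{a, b, w}, ⟨by simp, h⟩, ?_⟩
        rintro T' ⟨hT' | rfl | rfl | rfl, hyT'⟩
        · exact absurd hyT' (hold T' hT')
        · exact absurd (e1 hyT').2 (e3 h).2
        · exact absurd (e2 hyT').1 (e3 h).1
        · rfl

/-- The convex hull of finitely many points on a circle has a triangulation without further
vertices. -/
theorem exists_isPlanarTriangulation (V : Finset ℂ) {k : ℂ} {r : ℝ} (hV : ∀ v ∈ V, ‖v - k‖ = r) :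
    ∃ 𝒯, IsPlanarTriangulation V 𝒯 := by
  induction hn : V.card generalizing V with
  | zero =>
    rw [Finset.card_eq_zero] at hn
    subst hn
    exact ⟨∅, by simp, by simp, by simp, by simp⟩
  | succ n ih =>
    by_cases h1 : n = 0
    · subst h1
      obtain ⟨v, rfl⟩ := Finset.card_eq_one.1 hn
      refine ⟨∅, by simp, by simp, by simp, fun y hy hyV => ?_⟩
      simp at hy hyV
      exact absurd hy hyV
    by_cases h2 : n = 1
    · subst h2
      obtain ⟨a, b, hab, rfl⟩ := Finset.card_eq_two.1 hn
      exact ⟨_, isPlanarTriangulation_pair hab⟩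
    obtain ⟨w, hw⟩ : V.Nonempty := Finset.card_pos.1 (by omega)
    obtain ⟨a, ha, b, hb, hab, haw, hbw, h3, h4⟩ := exists_ear hV hw (by omega)
    obtain ⟨𝒯, h𝒯⟩ := ih (V.erase w) (fun v hv => hV v (Finset.mem_of_mem_erase hv))
      (by rw [Finset.card_erase_of_mem hw]; omega)
    exact ⟨_, h𝒯.insert_ear hV hw ha hb hab haw hbw h3 h4⟩

end Fan

/-! ### Maps `z ↦ ± z + c`, barycentres and circles -/

section Isometry

variable {ε a b k z : ℂ} {r : ℝ} {T : Finset ℂ}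

/-- The map `z ↦ ± z + c` that takes `b` to `a`. -/
def flip (ε b a z : ℂ) : ℂ := ε * (z - b) + a

theorem flip_flip (hε : ε = 1 ∨ ε = -1) (b a z : ℂ) : flip ε a b (flip ε b a z) = z := by
  simp only [flip]; linear_combination (z - b) * sign_sq hε

theorem flip_self (ε b a : ℂ) : flip ε b a b = a := by simp [flip]

theorem norm_flip_sub (hε : ε = 1 ∨ ε = -1) (b a z w : ℂ) :
    ‖flip ε b a z - flip ε b a w‖ = ‖z - w‖ := by
  have : flip ε b a z - flip ε b a w = ε * (z - w) := by simp only [flip]; ring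
  rw [this, norm_mul, norm_sign hε, one_mul]

theorem flip_injective (hε : ε = 1 ∨ ε = -1) (b a : ℂ) : Function.Injective (flip ε b a) :=
  Function.LeftInverse.injective (flip_flip hε b a)

theorem continuous_flip : Continuous (flip ε b a) := by unfold flip; fun_prop

theorem flip_sum {w : ℂ → ℝ} (hw : ∑ v ∈ T, w v = 1) (b a : ℂ) :
    flip ε b a (∑ v ∈ T, (w v : ℂ) * v) = ∑ v ∈ T, (w v : ℂ) * flip ε b a v := by
  have hw' : ∑ v ∈ T, (w v : ℂ) = 1 := by exact_mod_cast hw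
  have h : ∀ v ∈ T, (w v : ℂ) * flip ε b a v = ε * ((w v : ℂ) * v) + (w v : ℂ) * (a - ε * b) := by
    intro v _; simp only [flip]; ring
  rw [Finset.sum_congr rfl h, Finset.sum_add_distrib, ← Finset.sum_mul, ← Finset.mul_sum, hw', flip]
  ring

theorem flip_mem_openSimplex (hε : ε = 1 ∨ ε = -1) (hz : z ∈ openSimplex T) :
    flip ε b a z ∈ openSimplex (T.image (flip ε b a)) := by
  obtain ⟨w, hw, hw1, rfl⟩ := hz
  have hinj : ∀ x ∈ T, ∀ y ∈ T, flip ε b a x = flip ε b a y → x = y := fun x _ y _ h =>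
    flip_injective hε b a h
  refine ⟨fun v => w (flip ε a b v), ?_, ?_, ?_⟩
  · intro v hv
    obtain ⟨u, hu, rfl⟩ := Finset.mem_image.1 hv
    show 0 < w (flip ε a b (flip ε b a u))
    rw [flip_flip hε]; exact hw u hu
  · rw [Finset.sum_image hinj]
    simp only [flip_flip hε]; exact hw1
  · rw [Finset.sum_image hinj, flip_sum hw1]
    simp only [flip_flip hε]

theorem image_flip_flip (hε : ε = 1 ∨ ε = -1) (b a : ℂ) (T : Finset ℂ) :
    (T.image (flip ε b a)).image (flip ε a b) = T := by
  ext z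
  simp [flip_flip hε]

theorem image_flip_one (T : Finset ℂ) : T.image (flip 1 a a) = T := by
  ext z
  simp [flip]

theorem convex_preimage_flip {C : Set ℂ} (hC : Convex ℝ C) : Convex ℝ {z | flip ε b a z ∈ C} := by
  intro x hx y hy s t hs ht hst
  have := hC hx hy hs ht hst
  show flip ε b a (s • x + t • y) ∈ C
  convert this using 1
  have hst' : (s : ℂ) + t = 1 := by exact_mod_cast hst
  simp only [Complex.real_smul, flip]
  linear_combination (ε * b - a) * hst'

/-- The barycentre of `T`. -/
noncomputable def mean (T : Finset ℂ) : ℂ := ∑ v ∈ T, (((T.card : ℝ)⁻¹ : ℝ) : ℂ) * v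

theorem sum_card_inv (hT : T.Nonempty) : ∑ _v ∈ T, (T.card : ℝ)⁻¹ = 1 := by
  rw [Finset.sum_const, nsmul_eq_mul, mul_inv_cancel₀]
  exact_mod_cast hT.card_pos.ne'

theorem mean_mem_openSimplex (hT : T.Nonempty) : mean T ∈ openSimplex T :=
  ⟨fun _ => (T.card : ℝ)⁻¹, fun _ _ => by
    have := hT.card_pos
    positivity, sum_card_inv hT, rfl⟩

theorem flip_mean (hε : ε = 1 ∨ ε = -1) (hT : T.Nonempty) :
    flip ε b a (mean T) = mean (T.image (flip ε b a)) := by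
  have hinj : ∀ x ∈ T, ∀ y ∈ T, flip ε b a x = flip ε b a y → x = y := fun x _ y _ h =>
    flip_injective hε b a h
  rw [mean, flip_sum (w := fun _ => (T.card : ℝ)⁻¹) (sum_card_inv hT), mean, Finset.sum_image hinj,
    Finset.card_image_of_injOn hinj]

/-- Strict convexity of the disc: at a point `y` on the circle the tangent line supports the
simplex, so all vertices lie on it and equal `y`. -/
theorem openSimplex_subset_ball (hT : ∀ v ∈ T, ‖v - k‖ = r) (hcard : 2 ≤ T.card) :
    openSimplex T ⊆ ball k r := by
  intro y hy
  have hcb := convexHull_subset_closedBall hT (openSimplex_subset_convexHull T hy)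
  rw [mem_closedBall_iff_norm] at hcb
  rw [mem_ball_iff_norm]
  refine lt_of_le_of_ne hcb fun heq => ?_
  set L : ℂ → ℝ := fun z => (y.re - k.re) * z.re + (y.im - k.im) * z.im +
    (-(y.re - k.re) * k.re - (y.im - k.im) * k.im - r ^ 2) with hL
  have hLaff : IsAffine L := ⟨_, _, _, fun z => rfl⟩
  have hyk := sq_dist_eq y k
  rw [heq] at hyk
  have hdist : ∀ v ∈ T, ‖v - y‖ ^ 2 = -2 * L v := by
    intro v hv
    have h1 := sq_dist_eq v k
    rw [hT v hv] at h1
    rw [sq_dist_eq]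
    simp only [hL]; linear_combination -h1 - hyk
  have hLT : ∀ v ∈ T, L v ≤ 0 := fun v hv => by nlinarith [hdist v hv, sq_nonneg ‖v - y‖]
  have hLy : L y = 0 := by simp only [hL]; linear_combination -hyk
  have h0 := hLaff.eq_zero_of_mem hLT hy hLy
  have hall : ∀ v ∈ T, v = y := by
    intro v hv
    have h1 := hdist v hv
    rw [h0 v hv, mul_zero] at h1
    exact sub_eq_zero.1 (norm_eq_zero.1 (pow_eq_zero_iff (two_ne_zero) |>.1 h1))
  obtain ⟨x, hx, x', hx', hne⟩ := Finset.one_lt_card.1 (show 1 < T.card by omega)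
  exact hne ((hall x hx).trans (hall x' hx').symm)

/-- The parallel axis identity. It converts separation of the vertices into depth of the barycentre
inside the disc. -/
theorem sum_sq_dist_mean (hT : T.Nonempty) (hr : ∀ v ∈ T, ‖v - k‖ = r) :
    ∑ v ∈ T, ‖v - mean T‖ ^ 2 = T.card * (r ^ 2 - ‖mean T - k‖ ^ 2) := by
  have hn : (T.card : ℝ) ≠ 0 := by exact_mod_cast hT.card_pos.ne'
  have hre : ∑ v ∈ T, v.re = T.card * (mean T).re := by
    rw [mean, ← Finset.mul_sum, Complex.re_ofReal_mul, Complex.re_sum, mul_inv_cancel_left₀ hn]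
  have him : ∑ v ∈ T, v.im = T.card * (mean T).im := by
    rw [mean, ← Finset.mul_sum, Complex.im_ofReal_mul, Complex.im_sum, mul_inv_cancel_left₀ hn]
  have h : ∀ v ∈ T, ‖v - mean T‖ ^ 2 = (r ^ 2 + ((mean T).re - k.re) ^ 2 + ((mean T).im - k.im) ^ 2
      + 2 * ((mean T).re - k.re) * k.re + 2 * ((mean T).im - k.im) * k.im)
      - 2 * ((mean T).re - k.re) * v.re - 2 * ((mean T).im - k.im) * v.im := by
    intro v hv
    have h1 := sq_dist_eq v k
    rw [hr v hv] at h1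
    rw [sq_dist_eq]
    linear_combination -h1
  rw [Finset.sum_congr rfl h, Finset.sum_sub_distrib, Finset.sum_sub_distrib, ← Finset.mul_sum,
    ← Finset.mul_sum, hre, him, Finset.sum_const, nsmul_eq_mul, sq_dist_eq]
  ring

/-- Two vertices at distance at least `η` contribute at least `η ^ 2 / 2` to the sum of squares.
With at most three vertices, `r ^ 2 - ‖mean T - k‖ ^ 2` is at least `η ^ 2 / 6`; dividing by `r +
‖mean T - k‖ ≤ 2 * R` gives the radius. -/
theorem ball_mean_subset {η R : ℝ} (hη : 0 < η) (hR : r ≤ R) (hr : ∀ v ∈ T, ‖v - k‖ = r)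
    (hcard : 2 ≤ T.card) (hcard' : T.card ≤ 3)
    (hsep : ∀ v ∈ T, ∀ v' ∈ T, ‖v' - v‖ < η → v = v') :
    ball (mean T) (η ^ 2 / (12 * R)) ⊆ ball k r := by
  have hne : T.Nonempty := Finset.card_pos.1 (by omega)
  obtain ⟨x, hx, y, hy, hxy⟩ := Finset.one_lt_card.1 (show 1 < T.card by omega)
  have hηxy : η ≤ ‖y - x‖ := by
    by_contra! h
    exact hxy (hsep x hx y hy h)
  have hsum := sum_sq_dist_mean hne hr
  have hge : ‖x - mean T‖ ^ 2 + ‖y - mean T‖ ^ 2 ≤ ∑ v ∈ T, ‖v - mean T‖ ^ 2 := by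
    rw [← Finset.sum_pair hxy (f := fun v => ‖v - mean T‖ ^ 2)]
    exact Finset.sum_le_sum_of_subset_of_nonneg (by simp [Finset.insert_subset_iff, hx, hy])
      fun _ _ _ => by positivity
  have htri : ‖y - x‖ ≤ ‖x - mean T‖ + ‖y - mean T‖ := by
    calc ‖y - x‖ = ‖(y - mean T) - (x - mean T)‖ := by ring_nf
      _ ≤ ‖y - mean T‖ + ‖x - mean T‖ := norm_sub_le _ _
      _ = _ := add_comm _ _
  have hmball := openSimplex_subset_ball hr hcard (mean_mem_openSimplex hne)
  rw [mem_ball_iff_norm] at hmball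
  have hpos : 0 ≤ r ^ 2 - ‖mean T - k‖ ^ 2 := by nlinarith [norm_nonneg (mean T - k)]
  have hc3 : (T.card : ℝ) ≤ 3 := by exact_mod_cast hcard'
  have hpow : η ^ 2 / 6 ≤ r ^ 2 - ‖mean T - k‖ ^ 2 := by
    have h1 : η ^ 2 ≤ (‖x - mean T‖ + ‖y - mean T‖) ^ 2 := by
      gcongr; exact hηxy.trans htri
    have h2 : (T.card : ℝ) * (r ^ 2 - ‖mean T - k‖ ^ 2) ≤ 3 * (r ^ 2 - ‖mean T - k‖ ^ 2) := by
      gcongr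
    nlinarith [sq_nonneg (‖x - mean T‖ - ‖y - mean T‖)]
  have hr0 : 0 < r := (norm_nonneg _).trans_lt hmball
  have hR0 : 0 < R := hr0.trans_le hR
  refine ball_subset_ball' ?_
  rw [dist_eq_norm]
  have : η ^ 2 / (12 * R) ≤ r - ‖mean T - k‖ := by
    rw [div_le_iff₀ (by positivity)]
    have h3 : 0 < r - ‖mean T - k‖ := by linarith
    nlinarith
  linarith

/-- Two different circles meet in at most two points. -/
theorem card_le_two_of_circles {k k' : ℂ} {r r' : ℝ} (hne : k ≠ k') (h : ∀ v ∈ T, ‖v - k‖ = r)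
    (h' : ∀ v ∈ T, ‖v - k'‖ = r') : T.card ≤ 2 := by
  by_contra! hc
  obtain ⟨x, y, z, hx, hy, hz, hxy, hxz, hyz⟩ := Finset.two_lt_card_iff.1 hc
  simp only [← dist_eq_norm] at h h'
  rcases EuclideanGeometry.eq_of_dist_eq_of_dist_eq_of_finrank_eq_two (V := ℂ) (P := ℂ)
    Complex.finrank_real_complex hne hxy (h x hx) (h y hy) (h z hz) (h' x hx) (h' y hy) (h' z hz)
    with h | h
  · exact hxz h.symm
  · exact hyz h.symm

end Isometry

/-! ### Maximal discs and the disjointness of their cells -/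

section Cells

variable {S : Type*} [TopologicalSpace S] [ChartedSpace ℂ S] [IsManifold 𝓘(ℂ) ω S]
  {q : QuadDiff S} {Z : Set S} {f φ : ℂ → S} {ε a b k k' v : ℂ} {r : ℝ}

theorem mem_ball_flip (hε : ε = 1 ∨ ε = -1) (hk : flip ε b a k = k') (z : ℂ) :
    flip ε b a z ∈ ball k' r ↔ z ∈ ball k r := by
  rw [mem_ball_iff_norm, mem_ball_iff_norm, ← hk, norm_flip_sub hε]

theorem FlatAt.comp_flip (hε : ε = 1 ∨ ε = -1) {z : ℂ} (h : FlatAt q Z f (flip ε b a z)) :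
    FlatAt q Z (fun w => f (flip ε b a w)) z := FlatAt.comp_sign hε h

theorem RegularAt.comp_flip (hε : ε = 1 ∨ ε = -1) (hk : flip ε b a k = k')
    (hφ : ∀ z ∈ ball k r, φ z = f (flip ε b a z))
    (h : RegularAt q Z f (ball k' r) (flip ε b a v)) : RegularAt q Z φ (ball k r) v := by
  obtain ⟨δ, hδ, g, hg, hfg⟩ := h
  have hb : ∀ z, flip ε b a z ∈ ball (flip ε b a v) δ ↔ z ∈ ball v δ := fun z =>
    mem_ball_flip hε rfl z
  refine ⟨δ, hδ, fun z => g (flip ε b a z), fun z hz => (hg _ ((hb z).2 hz)).comp_flip hε, ?_⟩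
  intro z hz hz'
  rw [hφ z hz]
  exact hfg _ ((mem_ball_flip hε hk z).2 hz) ((hb z).2 hz')

theorem regularAt_flip_iff (hε : ε = 1 ∨ ε = -1) (hk : flip ε b a k = k')
    (hφ : ∀ z ∈ ball k r, φ z = f (flip ε b a z)) :
    RegularAt q Z f (ball k' r) (flip ε b a v) ↔ RegularAt q Z φ (ball k r) v := by
  refine ⟨RegularAt.comp_flip hε hk hφ, fun h => ?_⟩
  have hk' : flip ε a b k' = k := by rw [← hk, flip_flip hε]
  refine RegularAt.comp_flip (f := φ) (ε := ε) (b := a) (a := b) hε hk' (fun z hz => ?_)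
    (by rwa [flip_flip hε])
  rw [hφ _ ((mem_ball_flip hε hk' z).2 hz), flip_flip hε]

/-- A maximal flat disc, with centre `0`, and a triangulation of the convex hull of its singular
boundary points. -/
structure MaxDisc (q : QuadDiff S) (Z : Set S) where
  φ : ℂ → S
  r : ℝ
  V : Finset ℂ
  tri : Set (Finset ℂ)
  r_pos : 0 < r
  flatOn : FlatOn q Z φ (ball 0 r)
  mem_V : ∀ v, v ∈ V ↔ v ∈ sphere 0 r ∧ ¬ RegularAt q Z φ (ball 0 r) v
  nonempty : V.Nonempty
  isTri : IsPlanarTriangulation V tri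

namespace MaxDisc

variable {d₁ d₂ d : MaxDisc q Z} {T T₁ T₂ : Finset ℂ} {y y₁ y₂ : ℂ}

theorem norm_V (d : MaxDisc q Z) : ∀ v ∈ d.V, ‖v - 0‖ = d.r := fun v hv =>
  mem_sphere_iff_norm.1 ((d.mem_V v).1 hv).1

theorem two_le_card (hT : T ∈ d.tri) : 2 ≤ T.card := by
  rcases d.isTri.card T hT with h | h <;> omega

theorem tri_nonempty (hT : T ∈ d.tri) : T.Nonempty :=
  Finset.card_pos.1 (by have := two_le_card hT; omega)

theorem openSimplex_subset (hT : T ∈ d.tri) : openSimplex T ⊆ ball 0 d.r :=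
  openSimplex_subset_ball (fun v hv => d.norm_V v (d.isTri.subset T hT hv)) (two_le_card hT)

/-- The empty circle property: the second disc would extend the first one flatly past any singular
point it contained. -/
theorem notMem_ball_of_mem_V [T2Space S] (hε : ε = 1 ∨ ε = -1)
    (hal : ∀ z ∈ ball 0 d₁.r, flip ε y₁ y₂ z ∈ ball 0 d₂.r →
      d₁.φ =ᶠ[𝓝 z] fun z => d₂.φ (flip ε y₁ y₂ z)) (hv : v ∈ d₁.V) :
    flip ε y₁ y₂ v ∉ ball 0 d₂.r := by
  intro h
  apply ((d₁.mem_V v).1 hv).2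
  have hopen : IsOpen {z | flip ε y₁ y₂ z ∈ ball (0 : ℂ) d₂.r} :=
    isOpen_ball.preimage continuous_flip
  obtain ⟨δ, hδ, hsub⟩ := Metric.isOpen_iff.1 hopen v h
  exact ⟨δ, hδ, fun z => d₂.φ (flip ε y₁ y₂ z), fun z hz => (d₂.flatOn _ (hsub hz)).comp_flip hε,
    fun z hz hz' => (hal z hz (hsub hz')).eq_of_nhds⟩

/-- A flat map is locally injective, so it is not invariant under a half-turn. -/
theorem not_eventuallyEq_neg (hf : FlatAt q Z f a) : ¬ f =ᶠ[𝓝 a] fun z => f (flip (-1) a a z) := by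
  intro h
  obtain ⟨U, hU, hinj⟩ := hf.exists_injOn
  have h2 : ∀ᶠ z in 𝓝 a, flip (-1) a a z ∈ U := by
    have hc : ContinuousAt (flip (-1) a a) a := continuous_flip.continuousAt
    exact hc.eventually_mem (by rwa [flip_self])
  have key : ∀ᶠ z in 𝓝 a, z = a := by
    filter_upwards [h, h2, hU] with z h1 h2 h3
    have := hinj h3 h2 h1
    simp only [flip] at this
    linear_combination this / 2
  obtain ⟨y, hy, hya⟩ := ((key.filter_mono (nhdsWithin_le_nhds (s := {a}ᶜ))).and
    self_mem_nhdsWithin).exists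
  exact hya hy

/-- If two cells have a common point in the surface then they are aligned. -/
theorem align_cells [T2Space S] (hc : d₁.φ 0 = d₂.φ 0 → d₁ = d₂) (hT₁ : T₁ ∈ d₁.tri)
    (hT₂ : T₂ ∈ d₂.tri) (hy₁ : y₁ ∈ openSimplex T₁) (hy₂ : y₂ ∈ openSimplex T₂)
    (hy : d₁.φ y₁ = d₂.φ y₂) :
    ∃ ε : ℂ, (ε = 1 ∨ ε = -1) ∧ (∀ z ∈ ball 0 d₁.r, flip ε y₁ y₂ z ∈ ball 0 d₂.r →
      d₁.φ =ᶠ[𝓝 z] fun z => d₂.φ (flip ε y₁ y₂ z)) ∧ T₂ = T₁.image (flip ε y₁ y₂) := by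
  have hyb₁ := openSimplex_subset hT₁ hy₁
  have hyb₂ := openSimplex_subset hT₂ hy₂
  obtain ⟨ε, hε, hal⟩ := d₁.flatOn.align d₂.flatOn (convex_ball _ _) (convex_ball _ _) hyb₂ hyb₁
    hy.symm
  change ∀ z ∈ ball 0 d₁.r, flip ε y₁ y₂ z ∈ ball 0 d₂.r →
      d₁.φ =ᶠ[𝓝 z] fun z => d₂.φ (flip ε y₁ y₂ z) at hal
  refine ⟨ε, hε, hal, ?_⟩
  have hal' : ∀ z ∈ ball 0 d₂.r, flip ε y₂ y₁ z ∈ ball 0 d₁.r →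
      d₂.φ =ᶠ[𝓝 z] fun z => d₁.φ (flip ε y₂ y₁ z) := by
    intro z hz hz'
    have h1 := hal _ hz' (by rwa [flip_flip hε])
    have h2 : Tendsto (flip ε y₂ y₁) (𝓝 z) (𝓝 (flip ε y₂ y₁ z)) := continuous_flip.continuousAt
    filter_upwards [h2.eventually h1] with w hw
    rw [hw, flip_flip hε]
  -- The centre of the second disc, drawn in the plane of the first; `T'` is the second cell drawn
  -- there.
  set c := flip ε y₂ y₁ 0 with hc'
  have hck : flip ε y₁ y₂ c = 0 := flip_flip hε _ _ _
  have hnorm : ∀ z, ‖flip ε y₁ y₂ z‖ = ‖z - c‖ := by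
    intro z
    rw [← norm_flip_sub hε y₁ y₂ z c, hck, sub_zero]
  set T' := T₂.image (flip ε y₂ y₁) with hT'
  have hT'T₂ : T'.image (flip ε y₁ y₂) = T₂ := image_flip_flip hε _ _ _
  suffices h : T' = T₁ by rw [← h, hT'T₂]
  have hy₁T' : y₁ ∈ openSimplex T' := by
    have := flip_mem_openSimplex (b := y₂) (a := y₁) hε hy₂
    rwa [flip_self] at this
  -- The difference of the powers with respect to the two circles: the quadratic terms cancel, and
  -- its zero set is the radical axis if the centres differ.
  set L : ℂ → ℝ := fun z => d₂.r ^ 2 - d₁.r ^ 2 + ‖z - 0‖ ^ 2 - ‖z - c‖ ^ 2 with hL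
  have hLaff : IsAffine L := by
    refine ⟨2 * c.re, 2 * c.im, d₂.r ^ 2 - d₁.r ^ 2 - c.re ^ 2 - c.im ^ 2, fun z => ?_⟩
    simp only [hL, sq_dist_eq, Complex.zero_re, Complex.zero_im]; ring
  have hn₁ : ∀ v ∈ T₁, ‖v - 0‖ = d₁.r := fun v hv => d₁.norm_V v (d₁.isTri.subset _ hT₁ hv)
  have hn' : ∀ v ∈ T', ‖v - c‖ = d₂.r := by
    intro v hv
    obtain ⟨u, hu, rfl⟩ := Finset.mem_image.1 hv
    rw [hc', norm_flip_sub hε]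
    exact d₂.norm_V u (d₂.isTri.subset _ hT₂ hu)
  have hL₁ : ∀ v ∈ T₁, L v ≤ 0 := by
    intro v hv
    have h1 := notMem_ball_of_mem_V hε hal (d₁.isTri.subset _ hT₁ hv)
    rw [mem_ball_zero_iff, hnorm, not_lt] at h1
    simp only [hL, hn₁ v hv]
    have := pow_le_pow_left₀ d₂.r_pos.le h1 2
    linarith
  have hL' : ∀ v ∈ T', -L v ≤ 0 := by
    intro v hv
    have h2 := hn' v hv
    obtain ⟨u, hu, rfl⟩ := Finset.mem_image.1 hv
    have h1 := notMem_ball_of_mem_V hε hal' (d₂.isTri.subset _ hT₂ hu)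
    rw [mem_ball_iff_norm, not_lt] at h1
    simp only [hL, h2]
    have := pow_le_pow_left₀ d₁.r_pos.le h1 2
    linarith
  have hLy : L y₁ = 0 := by
    have h1 := hLaff.le_zero_of_mem hL₁ hy₁
    have h2 := hLaff.neg.le_zero_of_mem hL' hy₁T'
    linarith
  have hz₁ := hLaff.eq_zero_of_mem hL₁ hy₁ hLy
  have hz' := hLaff.neg.eq_zero_of_mem hL' hy₁T' (by rw [hLy, neg_zero])
  -- Concentric discs are equal by `hc` and aligned by the identity, so uniqueness of the cell
  -- inside one polygon applies. Otherwise the circles share at most two points, and both cells are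
  -- the same chord.
  by_cases hc0 : c = 0
  · have hr : d₁.r = d₂.r := by
      obtain ⟨v, hv⟩ := tri_nonempty hT₁
      have h1 := hz₁ v hv
      simp only [hL, hc0] at h1
      have h2 : d₁.r ^ 2 = d₂.r ^ 2 := by linarith
      exact (pow_left_inj₀ d₁.r_pos.le d₂.r_pos.le two_ne_zero).1 h2
    have h0 : flip ε y₁ y₂ 0 = 0 := by rw [← hc0, hck, hc0]
    have hgerm := hal 0 (mem_ball_self d₁.r_pos) (by rw [h0]; exact mem_ball_self d₂.r_pos)
    obtain rfl : d₁ = d₂ := hc (by rw [hgerm.eq_of_nhds, h0])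
    have hε1 : ε = 1 := by
      refine hε.resolve_right ?_
      rintro rfl
      refine not_eventuallyEq_neg (d₁.flatOn 0 (mem_ball_self d₁.r_pos)) (hgerm.trans ?_)
      refine Eventually.of_forall fun z => ?_
      show d₁.φ _ = d₁.φ _
      congr 1
      simp only [flip] at h0 ⊢
      linear_combination h0
    subst hε1
    have hyy : y₁ = y₂ := by
      simp only [flip] at h0; linear_combination -h0
    subst hyy
    have hT'2 : T' = T₂ := image_flip_one _
    have hyV : y₁ ∉ d₁.V := fun h => by
      have h1 := d₁.norm_V _ h
      rw [mem_ball_iff_norm, h1] at hyb₁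
      exact lt_irrefl _ hyb₁
    have hhull : y₁ ∈ convexHull ℝ (d₁.V : Set ℂ) :=
      convexHull_mono (Finset.coe_subset.2 (d₁.isTri.subset _ hT₁))
        (openSimplex_subset_convexHull _ hy₁)
    rw [hT'2]
    exact (d₁.isTri.existsUnique y₁ hhull hyV).unique ⟨hT₂, hy₂⟩ ⟨hT₁, hy₁⟩
  · have hcard : (T₁ ∪ T').card ≤ 2 := by
      refine card_le_two_of_circles (k := 0) (k' := c) (r := d₁.r) (r' := d₂.r) (Ne.symm hc0) ?_ ?_
      · intro v hv
        rcases Finset.mem_union.1 hv with h | h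
        · exact hn₁ v h
        · have h1 := neg_eq_zero.1 (hz' v h)
          simp only [hL, hn' v h] at h1
          have h2 : ‖v - 0‖ ^ 2 = d₁.r ^ 2 := by linarith
          exact (pow_left_inj₀ (norm_nonneg _) d₁.r_pos.le two_ne_zero).1 h2
      · intro v hv
        rcases Finset.mem_union.1 hv with h | h
        · have h1 := hz₁ v h
          simp only [hL, hn₁ v h] at h1
          have h2 : ‖v - c‖ ^ 2 = d₂.r ^ 2 := by linarith
          exact (pow_left_inj₀ (norm_nonneg _) d₂.r_pos.le two_ne_zero).1 h2
        · exact hn' v h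
    have hcT' : 2 ≤ T'.card := by
      rw [hT', Finset.card_image_of_injective _ (flip_injective hε _ _)]
      exact two_le_card hT₂
    have e1 : T₁ = T₁ ∪ T' := Finset.eq_of_subset_of_card_le Finset.subset_union_left
      (hcard.trans (two_le_card hT₁))
    have e2 : T' = T₁ ∪ T' := Finset.eq_of_subset_of_card_le Finset.subset_union_right
      (hcard.trans hcT')
    exact e2.trans e1.symm

/-- The open cells are embedded. -/
theorem injOn_openSimplex [T2Space S] (hT : T ∈ d.tri) : InjOn d.φ (openSimplex T) := by
  intro y₁ hy₁ y₂ hy₂ hy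
  obtain ⟨ε, hε, hal, himg⟩ := align_cells (d₁ := d) (d₂ := d) (fun _ => rfl) hT hT hy₁ hy₂ hy
  -- The alignment permutes the vertices, so it fixes the barycentre: it is the identity or a
  -- half-turn, and the latter is impossible.
  have hmean : flip ε y₁ y₂ (mean T) = mean T := by
    rw [flip_mean hε (tri_nonempty hT), ← himg]
  have hmb := openSimplex_subset hT (mean_mem_openSimplex (tri_nonempty hT))
  rcases hε with rfl | rfl
  · simp only [flip] at hmean; linear_combination -hmean
  · exfalso
    have hgerm := hal _ hmb (by rwa [hmean])
    refine not_eventuallyEq_neg (d.flatOn _ hmb) (hgerm.trans ?_)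
    refine Eventually.of_forall fun z => ?_
    show d.φ _ = d.φ _
    congr 1
    simp only [flip] at hmean ⊢
    linear_combination hmean

/-- The image of a cell in the surface. -/
def cell (d : MaxDisc q Z) (T : Finset ℂ) : Set S := d.φ '' openSimplex T

/-- The alignment at one common point carries the first simplex onto the second and intertwines the
two flat maps. -/
theorem cell_eq_of_mem [T2Space S] (hc : d₁.φ 0 = d₂.φ 0 → d₁ = d₂) (hT₁ : T₁ ∈ d₁.tri)
    (hT₂ : T₂ ∈ d₂.tri) {p : S} (hp₁ : p ∈ d₁.cell T₁) (hp₂ : p ∈ d₂.cell T₂) :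
    d₁.cell T₁ = d₂.cell T₂ ∧ T₁.card = T₂.card := by
  obtain ⟨y₁, hy₁, rfl⟩ := hp₁
  obtain ⟨y₂, hy₂, hy⟩ := hp₂
  obtain ⟨ε, hε, hal, himg⟩ := align_cells hc hT₁ hT₂ hy₁ hy₂ hy.symm
  have hT₁2 : T₁ = T₂.image (flip ε y₂ y₁) := by
    rw [himg, image_flip_flip hε]
  have hval : ∀ z ∈ openSimplex T₁, d₁.φ z = d₂.φ (flip ε y₁ y₂ z) ∧
      flip ε y₁ y₂ z ∈ openSimplex T₂ := by
    intro z hz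
    have h := flip_mem_openSimplex (b := y₁) (a := y₂) hε hz
    rw [← himg] at h
    exact ⟨(hal z (openSimplex_subset hT₁ hz) (openSimplex_subset hT₂ h)).eq_of_nhds, h⟩
  constructor
  · apply Subset.antisymm
    · rintro _ ⟨z, hz, rfl⟩
      obtain ⟨h1, h2⟩ := hval z hz
      exact ⟨_, h2, h1.symm⟩
    · rintro _ ⟨z, hz, rfl⟩
      have h := flip_mem_openSimplex (b := y₂) (a := y₁) hε hz
      rw [← hT₁2] at h
      refine ⟨_, h, ?_⟩
      rw [(hval _ h).1, flip_flip hε]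
  · rw [himg, Finset.card_image_of_injective _ (flip_injective hε _ _)]

end MaxDisc

end Cells

/-! ### Choosing discs; covering and finiteness of the cells -/

section Systems

variable {S : Type*} [TopologicalSpace S] [ChartedSpace ℂ S] [IsManifold 𝓘(ℂ) ω S]
  {q : QuadDiff S} {Z : Set S} {φ Φ : ℂ → S} {Ω : Set ℂ} {a k k' v : ℂ} {r r' : ℝ}

/-- A flat disc that is aligned with a concentric one is not smaller, unless it has no singular
boundary point. -/
theorem radius_le_of_not_regularAt {f g : ℂ → S} {ε b : ℂ} (hε : ε = 1 ∨ ε = -1)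
    (hk : flip ε b a k = k') (hg : FlatOn q Z g (ball k' r'))
    (hal : ∀ z ∈ ball k r, flip ε b a z ∈ ball k' r' → f z = g (flip ε b a z))
    (hv : v ∈ sphere k r) (hreg : ¬ RegularAt q Z f (ball k r) v) : r' ≤ r := by
  by_contra! hlt
  apply hreg
  have hmem : flip ε b a v ∈ ball k' r' := by
    rw [mem_ball_flip hε hk, mem_ball]
    rw [mem_sphere] at hv
    rwa [hv]
  have hopen : IsOpen {z | flip ε b a z ∈ ball k' r'} := isOpen_ball.preimage continuous_flip
  obtain ⟨δ, hδ, hsub⟩ := Metric.isOpen_iff.1 hopen v hmem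
  exact ⟨δ, hδ, fun z => g (flip ε b a z), fun z hz => (hg _ (hsub hz)).comp_flip hε,
    fun z hz hz' => hal z hz (hsub hz')⟩

/-- A maximal developed disc is the same as the given maximal disc with the same centre. -/
theorem IsDeveloping.maxDisc_eq [T2Space S] (h : IsDeveloping q Z a Φ Ω) (ha : a ∈ ball k r)
    (hD : ball k r ⊆ Ω) (hv : (sphere k r \ Ω).Nonempty) {d : MaxDisc q Z} (hd : d.φ 0 = Φ k) :
    d.r = r ∧ ∃ ε : ℂ, (ε = 1 ∨ ε = -1) ∧ (∀ z ∈ ball k r, Φ z = d.φ (flip ε k 0 z)) ∧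
      ∀ v ∈ sphere k r, v ∉ Ω → flip ε k 0 v ∈ d.V := by
  have hr : 0 < r := dist_nonneg.trans_lt ha
  have hflat := h.flatOn.mono hD
  obtain ⟨ε, hε, hal⟩ := hflat.align d.flatOn (convex_ball _ _) (convex_ball _ _)
    (mem_ball_self d.r_pos) (mem_ball_self hr) hd
  have hal1 : ∀ z ∈ ball k r, flip ε k 0 z ∈ ball 0 d.r → Φ z = d.φ (flip ε k 0 z) :=
    fun z hz hz' => (hal z hz hz').eq_of_nhds
  have hal2 : ∀ z ∈ ball 0 d.r, flip ε 0 k z ∈ ball k r → d.φ z = Φ (flip ε 0 k z) := by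
    intro z hz hz'
    rw [hal1 _ hz' (by rwa [flip_flip hε]), flip_flip hε]
  obtain ⟨v, hv, hvΩ⟩ := hv
  obtain ⟨u, hu⟩ := d.nonempty
  -- Each disc has a singular boundary point, which prevents the other from being larger.
  have h1 : d.r ≤ r := radius_le_of_not_regularAt hε (flip_self _ _ _) d.flatOn hal1 hv
    (by rwa [h.regularAt_iff ha hD hv])
  have h2 : r ≤ d.r := radius_le_of_not_regularAt hε (flip_self _ _ _) hflat hal2
    ((d.mem_V u).1 hu).1 ((d.mem_V u).1 hu).2
  obtain rfl := le_antisymm h1 h2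
  have hal3 : ∀ z ∈ ball k d.r, Φ z = d.φ (flip ε k 0 z) := fun z hz =>
    hal1 z hz ((mem_ball_flip hε (flip_self _ _ _) z).2 hz)
  refine ⟨rfl, ε, hε, hal3, fun w hw hwΩ => (d.mem_V _).2 ⟨?_, ?_⟩⟩
  · rw [mem_sphere_iff_norm] at hw ⊢
    rw [← hw, ← norm_flip_sub hε k 0 w k, flip_self]
  · rwa [regularAt_flip_iff hε (flip_self _ _ _) hal3, h.regularAt_iff ha hD hw]

/-- The radius is the distance from the origin to the complement of the developed domain, which is
nonempty by the radius bound; a nearest point of the complement is singular. -/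
theorem MaxDisc.exists_of_notMem [T2Space S] [CompactSpace S] [ConnectedSpace S]
    (hq : q.IsMarkedBy Z) (hZ : Z.Finite) (hne : Z.Nonempty) {x : S} (hx : x ∉ Z) :
    ∃ d : MaxDisc q Z, d.φ 0 = x := by
  obtain ⟨η, hη⟩ := exists_isConeScale hq hZ
  obtain ⟨R, hR0, hR⟩ := exists_radius_bound hq hZ hne
  obtain ⟨f, hf, rfl⟩ := exists_flatAt hq hx
  obtain ⟨Φ, Ω, h, hgerm⟩ := exists_isDeveloping hZ.isClosed hf
  have hΩne : Ωᶜ.Nonempty := by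
    rw [nonempty_compl]
    rintro rfl
    have := hR Φ 0 (R + 1) (h.flatOn.mono (subset_univ _))
    linarith
  have hcl : IsClosed Ωᶜ := h.isOpen.isClosed_compl
  have hr : 0 < infDist 0 Ωᶜ := (hcl.notMem_iff_infDist_pos hΩne).1 (not_not.2 h.mem)
  have hD : ball 0 (infDist 0 Ωᶜ) ⊆ Ω := ball_infDist_compl_subset
  obtain ⟨v, hv, hdist⟩ := hcl.exists_infDist_eq_dist hΩne 0
  have hflat := h.flatOn.mono hD
  have hfin := hflat.finite_singular hq hZ hη
  have hmem : ∀ w, w ∈ hfin.toFinset ↔ w ∈ sphere 0 (infDist 0 Ωᶜ) ∧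
      ¬ RegularAt q Z Φ (ball 0 (infDist 0 Ωᶜ)) w := fun w => hfin.mem_toFinset
  obtain ⟨𝒯, h𝒯⟩ := exists_isPlanarTriangulation (k := 0) (r := infDist 0 Ωᶜ) hfin.toFinset
    fun w hw => mem_sphere_iff_norm.1 ((hmem w).1 hw).1
  have hvs : v ∈ sphere 0 (infDist 0 Ωᶜ) := by rw [mem_sphere', hdist]
  exact ⟨{ φ := Φ, r := _, V := hfin.toFinset, tri := 𝒯, r_pos := hr, flatOn := hflat
           mem_V := hmem
           nonempty := ⟨v, (hmem v).2 ⟨hvs, by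
              rwa [h.regularAt_iff (mem_ball_self hr) hD hvs]⟩⟩
           isTri := h𝒯 }, hgerm.eq_of_nhds⟩

/-- A choice of a triangulated maximal disc around every unmarked point. -/
structure IsDiscSystem (Z : Set S) (𝒟 : Set (MaxDisc q Z)) : Prop where
  eq_of_centre : ∀ d₁ ∈ 𝒟, ∀ d₂ ∈ 𝒟, d₁.φ 0 = d₂.φ 0 → d₁ = d₂
  exists_centre : ∀ x ∉ Z, ∃ d ∈ 𝒟, d.φ 0 = x

/-- One disc per centre is what makes the choices consistent: a polygon with more than three
vertices has several triangulations. -/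
theorem exists_isDiscSystem [T2Space S] [CompactSpace S] [ConnectedSpace S]
    (hq : q.IsMarkedBy Z) (hZ : Z.Finite) (hne : Z.Nonempty) :
    ∃ 𝒟 : Set (MaxDisc q Z), IsDiscSystem Z 𝒟 := by
  choose d hd using fun x : (Zᶜ : Set S) => MaxDisc.exists_of_notMem hq hZ hne x.2
  refine ⟨range d, ?_, fun x hx => ⟨_, mem_range_self ⟨x, hx⟩, hd _⟩⟩
  rintro _ ⟨x, rfl⟩ _ ⟨y, rfl⟩ hxy
  rw [hd, hd] at hxy
  rw [Subtype.ext hxy]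

variable {𝒟 : Set (MaxDisc q Z)}

/-- The cells cover the complement of the marked points. -/
theorem IsDiscSystem.exists_mem_cell [T2Space S] [CompactSpace S] [ConnectedSpace S]
    (h𝒟 : IsDiscSystem Z 𝒟) (hq : q.IsMarkedBy Z) (hZ : Z.Finite) (hne : Z.Nonempty) {y : S}
    (hy : y ∉ Z) : ∃ d ∈ 𝒟, ∃ T ∈ d.tri, y ∈ d.cell T := by
  obtain ⟨η, hη⟩ := exists_isConeScale hq hZ
  obtain ⟨R, hR0, hR⟩ := exists_radius_bound hq hZ hne
  obtain ⟨f, hf, rfl⟩ := exists_flatAt hq hy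
  obtain ⟨Φ, Ω, h, hgerm⟩ := exists_isDeveloping hZ.isClosed hf
  -- The disc of maximal power has `y` in the hull of its singular points. It agrees, up to a sign
  -- and a translation, with the chosen disc having the same centre in `S`, which transfers the
  -- conclusion.
  obtain ⟨k, r, h0, hD, hmax⟩ := h.exists_max fun k r hkr => hR Φ k r (h.flatOn.mono hkr)
  have hr : 0 < r := dist_nonneg.trans_lt h0
  have hflat := h.flatOn.mono hD
  have hfin : (sphere k r \ Ω).Finite := (hflat.finite_singular hq hZ hη).subset
    fun v hv => ⟨hv.1, by rw [h.regularAt_iff h0 hD hv.1]; exact hv.2⟩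
  have hhull := mem_convexHull_of_max h.isOpen h0 hD hfin hmax
  obtain ⟨d, hd, hdk⟩ := h𝒟.exists_centre (Φ k) (hflat k (mem_ball_self hr)).notMem
  obtain ⟨rfl, ε, hε, hΦ, hV⟩ := h.maxDisc_eq h0 hD (convexHull_nonempty_iff.1 ⟨_, hhull⟩) hdk
  have hhull' : flip ε k 0 0 ∈ convexHull ℝ (d.V : Set ℂ) := by
    refine convexHull_min (t := {z | flip ε k 0 z ∈ convexHull ℝ (d.V : Set ℂ)}) ?_
      (convex_preimage_flip (convex_convexHull ℝ _)) hhull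
    exact fun v hv => subset_convexHull ℝ _ (hV v hv.1 hv.2)
  have hb : flip ε k 0 0 ∈ ball 0 d.r := (mem_ball_flip hε (flip_self _ _ _) 0).2 h0
  have hnV : flip ε k 0 0 ∉ d.V := fun hmem => by
    rw [mem_ball_iff_norm, d.norm_V _ hmem] at hb
    exact lt_irrefl _ hb
  obtain ⟨T, ⟨hT, hTy⟩, -⟩ := d.isTri.existsUnique _ hhull' hnV
  exact ⟨d, hd, T, hT, _, hTy, by rw [← hΦ 0 h0, hgerm.eq_of_nhds]⟩

/-- The singular boundary points of a disc are separated. -/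
theorem MaxDisc.eq_of_dist_lt [T2Space S] [CompactSpace S] (d : MaxDisc q Z) (hq : q.IsMarkedBy Z)
    (hZ : Z.Finite) {η : ℝ} (hη : IsConeScale q Z η) :
    ∀ v ∈ d.V, ∀ v' ∈ d.V, ‖v' - v‖ < η → v = v' := fun v hv v' hv' h =>
  d.flatOn.singular_separated hq hZ hη d.r_pos ((d.mem_V v).1 hv) ((d.mem_V v').1 hv') h

/-- A cell whose barycentre maps close to `Φ 0` can be redrawn in the developed picture around `0`.
Its whole disc is redrawn there and contains a fixed ball around `0`, so its vertices fall under
`IsDeveloping.finite_singular`. -/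
theorem IsDeveloping.exists_cell_eq [T2Space S] (h : IsDeveloping q Z 0 Φ Ω) {s δ : ℝ}
    (hδs : δ ≤ s / 2) (hδ : ball 0 δ ⊆ Ω) {d : MaxDisc q Z} {T : Finset ℂ} (hT : T ∈ d.tri)
    (hmean : ball (mean T) s ⊆ ball 0 d.r) (ha : a ∈ ball 0 δ) (hda : d.φ (mean T) = Φ a) :
    ∃ T' : Finset ℂ, (∀ v ∈ T', ∃ k r, ball 0 (s / 2) ⊆ ball k r ∧ ball k r ⊆ Ω ∧
      v ∈ sphere k r ∧ v ∉ Ω) ∧ d.cell T = Φ '' openSimplex T' := by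
  have hδ0 : 0 < δ := dist_nonneg.trans_lt ha
  have hmb := MaxDisc.openSimplex_subset hT (mean_mem_openSimplex (MaxDisc.tri_nonempty hT))
  obtain ⟨ε, hε, hal⟩ := (h.flatOn.mono hδ).align d.flatOn (convex_ball _ _) (convex_ball _ _)
    hmb ha hda
  change ∀ z ∈ ball 0 δ, flip ε a (mean T) z ∈ ball 0 d.r →
    Φ =ᶠ[𝓝 z] fun z => d.φ (flip ε a (mean T) z) at hal
  set k := flip ε (mean T) a 0 with hk
  have hk' : flip ε a (mean T) k = 0 := flip_flip hε _ _ _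
  rw [mem_ball_zero_iff] at ha
  have hsub : ball 0 (s / 2) ⊆ ball k d.r := by
    intro z hz
    rw [← mem_ball_flip hε hk']
    apply hmean
    rw [mem_ball_zero_iff] at hz
    have hza := norm_flip_sub hε a (mean T) z a
    rw [flip_self] at hza
    rw [mem_ball_iff_norm, hza]
    calc ‖z - a‖ ≤ ‖z‖ + ‖a‖ := norm_sub_le _ _
      _ < s := by linarith
  have h0 : 0 ∈ ball k d.r := hsub (mem_ball_self (by linarith))
  have hflat : FlatOn q Z (fun z => d.φ (flip ε a (mean T) z)) (ball k d.r) := fun z hz =>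
    (d.flatOn _ ((mem_ball_flip hε hk' z).2 hz)).comp_flip hε
  have hgerm := hal 0 (mem_ball_self hδ0) ((mem_ball_flip hε hk' 0).2 h0)
  have hD : ball k d.r ⊆ Ω := h.maximal _ isOpen_ball (convex_ball _ _) h0 _ hflat hgerm.symm
  have hΦ : ∀ z ∈ ball k d.r, Φ z = d.φ (flip ε a (mean T) z) := fun z hz =>
    (FlatAt.eventuallyEq_of_isPreconnected (convex_ball k d.r).isPreconnected
      (h.flatOn.mono hD) hflat h0 hgerm hz).eq_of_nhds
  refine ⟨T.image (flip ε (mean T) a), ?_, ?_⟩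
  · intro v hv
    obtain ⟨u, hu, rfl⟩ := Finset.mem_image.1 hv
    have huV := d.isTri.subset T hT hu
    have hvs : flip ε (mean T) a u ∈ sphere k d.r := by
      rw [mem_sphere_iff_norm, hk, norm_flip_sub hε, d.norm_V u huV]
    refine ⟨k, d.r, hsub, hD, hvs, ?_⟩
    rw [← h.regularAt_iff h0 hD hvs, ← regularAt_flip_iff hε hk' hΦ, flip_flip hε]
    exact ((d.mem_V u).1 huV).2
  · apply Subset.antisymm
    · rintro _ ⟨z, hz, rfl⟩
      refine ⟨_, flip_mem_openSimplex hε hz, ?_⟩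
      rw [hΦ, flip_flip hε]
      rw [← mem_ball_flip hε hk', flip_flip hε]
      exact MaxDisc.openSimplex_subset hT hz
    · rintro _ ⟨z, hz, rfl⟩
      have h1 := flip_mem_openSimplex (b := a) (a := mean T) hε hz
      rw [image_flip_flip hε] at h1
      refine ⟨_, h1, (hΦ z ?_).symm⟩
      rw [← mem_ball_flip hε hk']
      exact MaxDisc.openSimplex_subset hT h1

/-- There are finitely many cells. -/
theorem finite_cells [T2Space S] [CompactSpace S] [ConnectedSpace S]
    (hq : q.IsMarkedBy Z) (hZ : Z.Finite) (hne : Z.Nonempty) :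
    {C | ∃ d : MaxDisc q Z, ∃ T ∈ d.tri, C = d.cell T}.Finite := by
  obtain ⟨η, hη⟩ := exists_isConeScale hq hZ
  obtain ⟨R, hR0, hR⟩ := exists_radius_bound hq hZ hne
  set s := η ^ 2 / (12 * R) with hs
  have hη0 := hη.1
  have hs0 : 0 < s := by positivity
  have hmean : ∀ d : MaxDisc q Z, ∀ T ∈ d.tri, ball (mean T) s ⊆ ball 0 d.r := fun d T hT =>
    have hsub := d.isTri.subset T hT
    ball_mean_subset hη0 (hR d.φ 0 d.r d.flatOn) (fun v hv => d.norm_V v (hsub hv))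
      (MaxDisc.two_le_card hT) (by rcases d.isTri.card T hT with h | h <;> omega)
      fun v hv v' hv' => d.eq_of_dist_lt hq hZ hη v (hsub hv) v' (hsub hv')
  set P : Set S → Prop := fun N =>
    {C | ∃ d : MaxDisc q Z, ∃ T ∈ d.tri, d.φ (mean T) ∈ N ∧ C = d.cell T}.Finite with hP
  have huniv : P univ := by
    refine isCompact_univ.induction_on (p := P) ?_ ?_ ?_ ?_
    · simp [hP]
    · intro N N' hNN' h
      refine h.subset ?_
      rintro C ⟨d, T, hT, hN, rfl⟩
      exact ⟨d, T, hT, hNN' hN, rfl⟩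
    · intro N N' h h'
      refine (h.union h').subset ?_
      rintro C ⟨d, T, hT, hN | hN, rfl⟩
      · exact Or.inl ⟨d, T, hT, hN, rfl⟩
      · exact Or.inr ⟨d, T, hT, hN, rfl⟩
    · intro y _
      by_cases hy : y ∈ Z
      -- Near a marked point flat discs have radius below `s`, so no barycentre lands there.
      · obtain ⟨n, ρ, ψ, hψ⟩ := exists_isConeModel hq hZ hy
        obtain ⟨N, hN, h⟩ := hψ.exists_nhds_radius_lt hy hs0
        refine ⟨N, mem_nhdsWithin_of_mem_nhds hN, Set.finite_empty.subset ?_⟩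
        rintro C ⟨d, T, hT, hTN, rfl⟩
        exact absurd (h d.φ (mean T) s (d.flatOn.mono (hmean d T hT)) hTN) (lt_irrefl _)
      · obtain ⟨f, hf, rfl⟩ := exists_flatAt hq hy
        obtain ⟨Φ, Ω, h, hgerm⟩ := exists_isDeveloping hZ.isClosed hf
        obtain ⟨δ, hδ, hδΩ⟩ := Metric.isOpen_iff.1 h.isOpen 0 h.mem
        have hN := (h.flatOn 0 h.mem).image_mem_nhds
          (ball_mem_nhds 0 (show 0 < min δ (s / 2) by positivity))
        rw [hgerm.eq_of_nhds] at hN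
        refine ⟨_, mem_nhdsWithin_of_mem_nhds hN, ?_⟩
        have hfin := h.finite_singular hq hZ hη hR0 (fun k r hkr => hR Φ k r (h.flatOn.mono hkr))
          (half_pos hs0)
        refine (hfin.toFinset.powerset.finite_toSet.image fun T' => Φ '' openSimplex T').subset ?_
        rintro C ⟨d, T, hT, ⟨a, ha, hda⟩, rfl⟩
        obtain ⟨T', hT', heq⟩ := h.exists_cell_eq (min_le_right δ (s / 2))
          ((ball_subset_ball (min_le_left _ _)).trans hδΩ) hT (hmean d T hT) ha hda.symm
        exact ⟨T', Finset.mem_coe.2 (Finset.mem_powerset.2 fun v hv =>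
          hfin.mem_toFinset.2 (hT' v hv)), heq.symm⟩
  refine huniv.subset ?_
  rintro C ⟨d, T, hT, rfl⟩
  exact ⟨d, T, hT, mem_univ _, rfl⟩

end Systems

/-! ### Extension to the vertices and assembly of the triangulation -/

section Extension

variable {S : Type*} [TopologicalSpace S] [ChartedSpace ℂ S] [IsManifold 𝓘(ℂ) ω S]
  {q : QuadDiff S} {Z : Set S} {𝒟 : Set (MaxDisc q Z)}

namespace MaxDisc

variable {d d₁ d₂ : MaxDisc q Z} {T : Finset ℂ} {a b a₁ b₁ a₂ b₂ z v : ℂ}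

/-- The extension of a maximal disc to its singular boundary points. -/
noncomputable def ext (d : MaxDisc q Z) : ℂ → S := extendFrom (ball 0 d.r) d.φ

theorem mem_closure_of_mem_V (hv : v ∈ d.V) : v ∈ closure (ball 0 d.r) := by
  rw [closure_ball _ d.r_pos.ne']
  exact sphere_subset_closedBall ((d.mem_V v).1 hv).1

theorem ext_eq [T2Space S] (d : MaxDisc q Z) (hz : z ∈ ball 0 d.r) : d.ext z = d.φ z :=
  extendFrom_eq (subset_closure hz) (d.flatOn z hz).continuousAt.continuousWithinAt

theorem exists_tendsto [T2Space S] [CompactSpace S] (hq : q.IsMarkedBy Z) (hZ : Z.Finite)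
    (hv : v ∈ d.V) : ∃ p ∈ Z, Tendsto d.φ (𝓝[ball 0 d.r] v) (𝓝 p) := by
  obtain ⟨η, hη⟩ := exists_isConeScale hq hZ
  obtain ⟨hv1, hv2⟩ := (d.mem_V v).1 hv
  obtain ⟨p, hp, h, -⟩ := d.flatOn.boundary hq hZ hη (mem_ball_self d.r_pos) hv1 hv2
  exact ⟨p, hp, h⟩

theorem ext_mem [T2Space S] [CompactSpace S] (hq : q.IsMarkedBy Z) (hZ : Z.Finite)
    (hv : v ∈ d.V) : d.ext v ∈ Z := by
  obtain ⟨p, hp, h⟩ := exists_tendsto hq hZ hv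
  rwa [ext, extendFrom_eq (mem_closure_of_mem_V hv) h]

theorem continuousOn_ext [T2Space S] [CompactSpace S] (d : MaxDisc q Z) (hq : q.IsMarkedBy Z)
    (hZ : Z.Finite) : ContinuousOn d.ext (ball 0 d.r ∪ d.V) := by
  refine continuousOn_extendFrom ?_ ?_
  · rintro z (hz | hz)
    · exact subset_closure hz
    · exact mem_closure_of_mem_V hz
  · rintro z (hz | hz)
    · exact ⟨_, (d.flatOn z hz).continuousAt.continuousWithinAt⟩
    · obtain ⟨p, -, h⟩ := exists_tendsto hq hZ hz
      exact ⟨p, h⟩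

/-- The closed polygon meets the circle only at its vertices, so `ext` is continuous on it. -/
theorem convexHull_subset (d : MaxDisc q Z) :
    convexHull ℝ (d.V : Set ℂ) ⊆ ball 0 d.r ∪ d.V := by
  intro z hz
  by_cases h : z ∈ d.V
  · exact Or.inr h
  · obtain ⟨T, ⟨hT, hTz⟩, -⟩ := d.isTri.existsUnique z hz h
    exact Or.inl (openSimplex_subset hT hTz)

theorem ext_notMem [T2Space S] (hT : T ∈ d.tri) (hz : z ∈ openSimplex T) : d.ext z ∉ Z := by
  rw [d.ext_eq (openSimplex_subset hT hz)]
  exact (d.flatOn z (openSimplex_subset hT hz)).notMem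

theorem ext_mem_cell [T2Space S] (hT : T ∈ d.tri) (hz : z ∈ openSimplex T) :
    d.ext z ∈ d.cell T := by
  rw [d.ext_eq (openSimplex_subset hT hz)]
  exact ⟨z, hz, rfl⟩

theorem injOn_ext [T2Space S] (hT : T ∈ d.tri) : InjOn d.ext (openSimplex T) :=
  (injOn_openSimplex hT).congr fun _ hz => (d.ext_eq (openSimplex_subset hT hz)).symm

end MaxDisc

/-- The affine combination of the points `v i` with weights `w i`. -/
noncomputable def combo {n : ℕ} (v : Fin n → ℂ) (w : Fin n → ℝ) : ℂ := ∑ i, (w i : ℂ) * v i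

theorem continuous_combo {n : ℕ} (v : Fin n → ℂ) : Continuous (combo v) := by
  unfold combo; fun_prop

theorem combo_mem_openSimplex {n : ℕ} {v : Fin n → ℂ} (hv : Function.Injective v) {w : Fin n → ℝ}
    (hw : ∀ i, 0 < w i) (hw1 : ∑ i, w i = 1) : combo v w ∈ openSimplex (Finset.univ.image v) := by
  have h := hv.extend_apply w (0 : ℂ → ℝ)
  refine ⟨Function.extend v w 0, ?_, ?_, ?_⟩
  · intro u hu
    obtain ⟨i, -, rfl⟩ := Finset.mem_image.1 hu
    rw [h]; exact hw i
  · rw [Finset.sum_image fun x _ y _ hxy => hv hxy]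
    simp only [h, hw1]
  · rw [Finset.sum_image fun x _ y _ hxy => hv hxy]
    simp only [h, combo]

theorem exists_combo_eq {n : ℕ} {v : Fin n → ℂ} (hv : Function.Injective v) {z : ℂ}
    (hz : z ∈ openSimplex (Finset.univ.image v)) :
    ∃ w : Fin n → ℝ, (∀ i, 0 < w i) ∧ ∑ i, w i = 1 ∧ combo v w = z := by
  obtain ⟨w, hw, hw1, rfl⟩ := hz
  rw [Finset.sum_image fun x _ y _ hxy => hv hxy] at hw1 ⊢
  exact ⟨fun i => w (v i), fun i => hw _ (Finset.mem_image_of_mem v (Finset.mem_univ i)), hw1, rfl⟩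

theorem combo_mem_convexHull {n : ℕ} {v : Fin n → ℂ} {V : Set ℂ} (hv : ∀ i, v i ∈ V)
    {w : Fin n → ℝ} (hw : ∀ i, 0 ≤ w i) (hw1 : ∑ i, w i = 1) : combo v w ∈ convexHull ℝ V := by
  have h := (convex_convexHull ℝ V).sum_mem (t := Finset.univ) (fun i _ => hw i) hw1
    fun i _ => subset_convexHull ℝ V (hv i)
  simpa [combo] using h

/-- Three distinct points on a circle are affinely independent. -/
theorem combo_injective {v : Fin 3 → ℂ} (hv : Function.Injective v) {r : ℝ}
    (hr : ∀ i, ‖v i - 0‖ = r) {w w' : Fin 3 → ℝ} (hw : ∑ i, w i = 1) (hw' : ∑ i, w' i = 1)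
    (h : combo v w = combo v w') : w = w' := by
  have hcos : EuclideanGeometry.Cospherical (sphere (0 : ℂ) r) := ⟨0, r, fun p hp => hp⟩
  have hind : AffineIndependent ℝ v := hcos.affineIndependent
    (by rintro _ ⟨i, rfl⟩; exact mem_sphere_iff_norm.2 (hr i)) hv
  rw [affineIndependent_iff] at hind
  have key := hind Finset.univ (fun i => w i - w' i)
    (by simp [Finset.sum_sub_distrib, hw, hw']) (by
      simp only [sub_smul, Finset.sum_sub_distrib, Complex.real_smul]
      exact sub_eq_zero.2 h)
  funext i
  exact sub_eq_zero.1 (key i (Finset.mem_univ i))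

/-- The point of the segment from `a` to `b` with parameter `t`. -/
noncomputable def chord (a b : ℂ) (t : ℝ) : ℂ := ((1 - t : ℝ) : ℂ) * a + t * b

theorem continuous_chord (a b : ℂ) : Continuous (chord a b) := by unfold chord; fun_prop

theorem chord_mem_openSimplex {a b : ℂ} (hab : a ≠ b) {t : ℝ} (h0 : 0 < t) (h1 : t < 1) :
    chord a b t ∈ openSimplex {a, b} :=
  mem_openSimplex_pair hab (by linarith) h0 (by ring)

theorem exists_chord_eq {a b z : ℂ} (hab : a ≠ b) (hz : z ∈ openSimplex {a, b}) :
    ∃ t : ℝ, 0 < t ∧ t < 1 ∧ chord a b t = z := by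
  obtain ⟨w, hw, hw1, rfl⟩ := hz
  rw [Finset.sum_pair hab] at hw1 ⊢
  have ha := hw a (by simp)
  have hb := hw b (by simp)
  refine ⟨w b, hb, by linarith, ?_⟩
  rw [chord, ← hw1, add_sub_cancel_right]

theorem chord_injective {a b : ℂ} (hab : a ≠ b) : Function.Injective (chord a b) := by
  intro s t h
  have h1 : ((s - t : ℝ) : ℂ) * (b - a) = 0 := by
    simp only [chord] at h
    push_cast at h ⊢
    linear_combination h
  rcases mul_eq_zero.1 h1 with h2 | h2
  · exact sub_eq_zero.1 (by exact_mod_cast h2)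
  · exact absurd (sub_eq_zero.1 h2).symm hab

theorem flip_chord (ε b a x y : ℂ) (t : ℝ) :
    flip ε b a (chord x y t) = chord (flip ε b a x) (flip ε b a y) t := by
  simp only [flip, chord]; push_cast; ring

theorem chord_symm (a b : ℂ) (t : ℝ) : chord a b t = chord b a (1 - t) := by
  simp only [chord]; push_cast; ring

theorem chord_mem_convexHull {a b : ℂ} {V : Set ℂ} (ha : a ∈ V) (hb : b ∈ V) {t : ℝ}
    (h0 : 0 ≤ t) (h1 : t ≤ 1) : chord a b t ∈ convexHull ℝ V := by
  have h := convex_convexHull ℝ V (subset_convexHull ℝ V ha) (subset_convexHull ℝ V hb)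
    (sub_nonneg.2 h1) h0 (by ring)
  simpa [chord] using h

namespace MaxDisc

variable {d d₁ d₂ : MaxDisc q Z} {T : Finset ℂ} {a b a₁ b₁ a₂ b₂ z v : ℂ}

theorem mem_V_of_pair (h : {a, b} ∈ d.tri) : a ∈ d.V ∧ b ∈ d.V :=
  ⟨d.isTri.subset _ h (by simp), d.isTri.subset _ h (by simp)⟩

theorem continuous_ext_chord [T2Space S] [CompactSpace S] (hq : q.IsMarkedBy Z) (hZ : Z.Finite)
    (h : {a, b} ∈ d.tri) : Continuous fun t : unitInterval => d.ext (chord a b t) :=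
  (d.continuousOn_ext hq hZ).comp_continuous ((continuous_chord a b).comp continuous_subtype_val)
    fun t => d.convexHull_subset
      (chord_mem_convexHull (mem_V_of_pair h).1 (mem_V_of_pair h).2 t.2.1 t.2.2)

/-- The saddle connection given by a chord of a maximal disc. -/
noncomputable def edge [T2Space S] [CompactSpace S] (hq : q.IsMarkedBy Z) (hZ : Z.Finite)
    (h : {a, b} ∈ d.tri) : C(unitInterval, S) :=
  ⟨fun t => d.ext (chord a b t), continuous_ext_chord hq hZ h⟩

theorem isSaddleConnection_edge [T2Space S] [CompactSpace S] (hq : q.IsMarkedBy Z) (hZ : Z.Finite)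
    (hab : a ≠ b) (h : {a, b} ∈ d.tri) : q.IsSaddleConnection Z (edge hq hZ h) := by
  have hmem : ∀ t ∈ Ioo (0 : unitInterval) 1, chord a b t ∈ openSimplex {a, b} := fun t ht =>
    chord_mem_openSimplex hab ht.1 ht.2
  refine ⟨?_, ?_, fun t ht => ext_notMem h (hmem t ht), ?_, ?_⟩
  · have : chord a b (0 : unitInterval) = a := by simp [chord]
    show d.ext _ ∈ Z
    rw [this]
    exact ext_mem hq hZ (mem_V_of_pair h).1
  · have : chord a b (1 : unitInterval) = b := by simp [chord]
    show d.ext _ ∈ Z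
    rw [this]
    exact ext_mem hq hZ (mem_V_of_pair h).2
  · intro s hs t ht hst
    exact Subtype.ext (chord_injective hab (injOn_ext h (hmem s hs) (hmem t ht) hst))
  · intro t ht
    have hb := openSimplex_subset h (hmem t ht)
    obtain ⟨e, he, hze, hφ, -⟩ := d.flatOn _ hb
    have hval : ∀ᶠ s : unitInterval in 𝓝 t, chord a b s ∈ e.target ∧
        edge hq hZ h s = e.symm (chord a b s) := by
      have hc : Tendsto (fun s : unitInterval => chord a b s) (𝓝 t) (𝓝 (chord a b t)) :=
        ((continuous_chord a b).comp continuous_subtype_val).continuousAt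
      filter_upwards [hc.eventually hφ, hc.eventually (isOpen_ball.mem_nhds hb),
        hc.eventually (e.open_target.mem_nhds hze)] with s h1 h2 h3
      exact ⟨h3, (d.ext_eq h2).trans h1⟩
    refine ⟨e, he, ?_, a, b - a, sub_ne_zero.2 hab.symm, ?_⟩
    · rw [hval.self_of_nhds.2]
      exact e.map_target hze
    · filter_upwards [hval] with s hs
      rw [hs.2, e.right_inv hs.1, chord]
      push_cast; ring

/-- Two chords that give the same cell are attached in the same way, up to orientation. -/
theorem edge_eq_of_cell_eq [T2Space S] [CompactSpace S] (hq : q.IsMarkedBy Z) (hZ : Z.Finite)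
    (hc : d₁.φ 0 = d₂.φ 0 → d₁ = d₂) (hab₁ : a₁ ≠ b₁) (h₁ : {a₁, b₁} ∈ d₁.tri)
    (h₂ : {a₂, b₂} ∈ d₂.tri) (h : d₁.cell {a₁, b₁} = d₂.cell {a₂, b₂}) :
    ∃ σ : unitInterval ≃ₜ unitInterval, ∀ t, edge hq hZ h₁ t = edge hq hZ h₂ (σ t) := by
  -- The alignment compares the two edges only on open chords; density and continuity extend this to
  -- the endpoints.
  have hdense : Dense (Ioo (0 : unitInterval) 1) := by
    rw [dense_iff_closure_eq, closure_Ioo zero_ne_one]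
    exact eq_univ_of_forall fun t => ⟨t.2.1, t.2.2⟩
  have hmean := mean_mem_openSimplex (tri_nonempty h₁)
  obtain ⟨y, hy, hyz⟩ : d₁.φ (mean {a₁, b₁}) ∈ d₂.cell {a₂, b₂} := h ▸ ⟨_, hmean, rfl⟩
  obtain ⟨ε, hε, hal, himg⟩ := align_cells hc h₁ h₂ hmean hy hyz.symm
  have hval : ∀ t ∈ Ioo (0 : unitInterval) 1, d₁.ext (chord a₁ b₁ t) =
      d₂.ext (chord (flip ε (mean {a₁, b₁}) y a₁) (flip ε (mean {a₁, b₁}) y b₁) t) := by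
    intro t ht
    have h3 := chord_mem_openSimplex hab₁ ht.1 ht.2
    have h4 := flip_mem_openSimplex (b := mean {a₁, b₁}) (a := y) hε h3
    rw [← himg] at h4
    have h5 := openSimplex_subset h₁ h3
    have h6 := openSimplex_subset h₂ h4
    rw [d₁.ext_eq h5, (hal _ h5 h6).eq_of_nhds, ← flip_chord, d₂.ext_eq h6]
  rw [Finset.image_insert, Finset.image_singleton] at himg
  have hor : (flip ε (mean {a₁, b₁}) y a₁ = a₂ ∧ flip ε (mean {a₁, b₁}) y b₁ = b₂) ∨
      (flip ε (mean {a₁, b₁}) y a₁ = b₂ ∧ flip ε (mean {a₁, b₁}) y b₁ = a₂) := by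
    have := congrArg (fun T : Finset ℂ => (T : Set ℂ)) himg
    simp only [Finset.coe_insert, Finset.coe_singleton] at this
    exact Set.pair_eq_pair_iff.1 this.symm
  rcases hor with ⟨e1, e2⟩ | ⟨e1, e2⟩ <;> rw [e1, e2] at hval
  · refine ⟨Homeomorph.refl _, fun t => congrFun (Continuous.ext_on hdense
      (edge hq hZ h₁).continuous (edge hq hZ h₂).continuous hval) t⟩
  · refine ⟨unitInterval.symmHomeomorph, fun t => congrFun (Continuous.ext_on hdense
      (edge hq hZ h₁).continuous ((edge hq hZ h₂).continuous.comp
        unitInterval.symmHomeomorph.continuous) fun t ht => (hval t ht).trans ?_) t⟩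
    rw [chord_symm]
    rfl

/-- The triangle given by three singular boundary points of a maximal disc. -/
noncomputable def face [T2Space S] [CompactSpace S] (hq : q.IsMarkedBy Z) (hZ : Z.Finite)
    {v : Fin 3 → ℂ} (hv : ∀ i, v i ∈ d.V) : C(Triangle, S) :=
  ⟨fun x => d.ext (combo v x.1), (d.continuousOn_ext hq hZ).comp_continuous
    ((continuous_combo v).comp continuous_subtype_val)
    fun x => d.convexHull_subset (combo_mem_convexHull hv x.2.1 x.2.2)⟩

theorem combo_side (v : Fin 3 → ℂ) (i : Fin 3) (t : unitInterval) :
    combo v (side i t).1 = chord (v (i + 1)) (v (i + 2)) t := by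
  fin_cases i <;> simp [combo, side, chord, Fin.sum_univ_three]; ring

end MaxDisc

/-- The cells with a given number of vertices, each listed once. -/
theorem exists_cell_enumeration [T2Space S] [CompactSpace S] [ConnectedSpace S]
    (hq : q.IsMarkedBy Z) (hZ : Z.Finite) (hne : Z.Nonempty) (𝒟 : Set (MaxDisc q Z)) (c : ℕ) :
    ∃ (n : ℕ) (d : Fin n → MaxDisc q Z) (v : Fin n → Fin c → ℂ),
      (∀ i, d i ∈ 𝒟) ∧ (∀ i, Function.Injective (v i)) ∧
      (∀ i, Finset.univ.image (v i) ∈ (d i).tri) ∧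
      Function.Injective (fun i => (d i).cell (Finset.univ.image (v i))) ∧
      ∀ d' ∈ 𝒟, ∀ T ∈ d'.tri, T.card = c →
        ∃ i, d'.cell T = (d i).cell (Finset.univ.image (v i)) := by
  set 𝒞 : Set (Set S) := {C | ∃ d ∈ 𝒟, ∃ T ∈ d.tri, T.card = c ∧ C = d.cell T} with h𝒞
  have hfin : 𝒞.Finite := (finite_cells hq hZ hne).subset
    fun C ⟨d, _, T, hT, _, h⟩ => ⟨d, T, hT, h⟩
  have := hfin.to_subtype
  obtain ⟨n, ⟨e⟩⟩ := Finite.exists_equiv_fin 𝒞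
  have hex : ∀ i : Fin n, ∃ (d : MaxDisc q Z) (v : Fin c → ℂ), d ∈ 𝒟 ∧ Function.Injective v ∧
      Finset.univ.image v ∈ d.tri ∧ (e.symm i : Set S) = d.cell (Finset.univ.image v) := by
    intro i
    obtain ⟨d, hd, T, hT, hcard, h⟩ := (e.symm i).2
    set f := (T.equivFinOfCardEq hcard).symm
    have himg : Finset.univ.image (fun j => (f j : ℂ)) = T := by
      ext z
      simp only [Finset.mem_image, Finset.mem_univ, true_and]
      constructor
      · rintro ⟨j, rfl⟩; exact (f j).2
      · intro hz; exact ⟨f.symm ⟨z, hz⟩, by simp⟩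
    exact ⟨d, fun j => f j, hd, Subtype.val_injective.comp f.injective, by rwa [himg],
      by rwa [himg]⟩
  choose d v hd hv hT hcell using hex
  refine ⟨n, d, v, hd, hv, hT, ?_, ?_⟩
  · intro i j hij
    simp only [← hcell] at hij
    exact e.symm.injective (Subtype.ext hij)
  · intro d' hd' T hT' hcard
    refine ⟨e ⟨d'.cell T, d', hd', T, hT', hcard, rfl⟩, ?_⟩
    rw [← hcell, Equiv.symm_apply_apply]

theorem exists_triangulation [T2Space S] [CompactSpace S] [ConnectedSpace S]
    (hq : q.IsMarkedBy Z) (hZ : Z.Finite) (hne : Z.Nonempty) :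
    ∃ τ : Triangulation S Z, ∀ e, q.IsSaddleConnection Z (τ.edge e) := by
  obtain ⟨𝒟, h𝒟⟩ := exists_isDiscSystem hq hZ hne
  obtain ⟨m, d₂, v₂, hd₂, hv₂, hT₂, hinj₂, hsurj₂⟩ := exists_cell_enumeration hq hZ hne 𝒟 2
  obtain ⟨n, d₃, v₃, hd₃, hv₃, hT₃, hinj₃, hsurj₃⟩ := exists_cell_enumeration hq hZ hne 𝒟 3
  have himg₂ : ∀ i, Finset.univ.image (v₂ i) = {v₂ i 0, v₂ i 1} := fun i => by
    ext z; simp [Fin.exists_fin_two, eq_comm]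
  simp only [himg₂] at hT₂ hinj₂ hsurj₂
  have hne₂ : ∀ i, v₂ i 0 ≠ v₂ i 1 := fun i h => zero_ne_one (hv₂ i h)
  have hV₃ : ∀ i j, v₃ i j ∈ (d₃ i).V := fun i j =>
    (d₃ i).isTri.subset _ (hT₃ i) (Finset.mem_image_of_mem _ (Finset.mem_univ j))
  have hcard₃ : ∀ i, (Finset.univ.image (v₃ i)).card = 3 := fun i => by
    rw [Finset.card_image_of_injective _ (hv₃ i)]; rfl
  have hcard₂ : ∀ i, ({v₂ i 0, v₂ i 1} : Finset ℂ).card = 2 := fun i => Finset.card_pair (hne₂ i)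
  have hopen₂ : ∀ i, ∀ t ∈ Ioo (0 : unitInterval) 1, chord (v₂ i 0) (v₂ i 1) t ∈
      openSimplex {v₂ i 0, v₂ i 1} := fun i t ht => chord_mem_openSimplex (hne₂ i) ht.1 ht.2
  have hopen₃ : ∀ i, ∀ x ∈ openTriangle, combo (v₃ i) x.1 ∈
      openSimplex (Finset.univ.image (v₃ i)) := fun i x hx =>
    combo_mem_openSimplex (hv₃ i) hx x.2.2
  refine ⟨{ E := Fin m, F := Fin n, finite_E := inferInstance, finite_F := inferInstance
            edge := fun i => MaxDisc.edge hq hZ (hT₂ i)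
            face := fun i => MaxDisc.face hq hZ (hV₃ i)
            edge_source := fun i =>
              (MaxDisc.isSaddleConnection_edge hq hZ (hne₂ i) (hT₂ i)).source_mem
            edge_target := fun i =>
              (MaxDisc.isSaddleConnection_edge hq hZ (hne₂ i) (hT₂ i)).target_mem
            face_side := ?_
            bijective_cells := ⟨?_, ?_⟩ },
    fun i => MaxDisc.isSaddleConnection_edge hq hZ (hne₂ i) (hT₂ i)⟩
  · intro f i
    have hvne : v₃ f (i + 1) ≠ v₃ f (i + 2) := fun h => by
      have := hv₃ f h
      fin_cases i <;> simp at this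
    -- The side is an edge of the same polygon, but the listed edge with this cell may come from
    -- another disc; the two parametrizations then agree up to reversal.
    have hpair : {v₃ f (i + 1), v₃ f (i + 2)} ∈ (d₃ f).tri := by
      refine (d₃ f).isTri.edge_mem _ (hT₃ f) (hcard₃ f) _ ?_ (Finset.card_pair hvne)
      simp [Finset.insert_subset_iff]
    obtain ⟨e, he⟩ := hsurj₂ _ (hd₃ f) _ hpair (Finset.card_pair hvne)
    obtain ⟨σ, hσ⟩ := MaxDisc.edge_eq_of_cell_eq hq hZ
      (h𝒟.eq_of_centre _ (hd₃ f) _ (hd₂ e)) hvne hpair (hT₂ e) he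
    refine ⟨e, σ, fun t => Eq.trans ?_ (hσ t)⟩
    show (d₃ f).ext _ = (d₃ f).ext _
    rw [MaxDisc.combo_side]
  · refine Subtype.val_injective.sumElim (Function.Injective.sumElim ?_ ?_ ?_) ?_
    · rintro ⟨e, t, ht⟩ ⟨e', t', ht'⟩ h
      have h1 := MaxDisc.ext_mem_cell (hT₂ e) (hopen₂ e t ht)
      have h2 := MaxDisc.ext_mem_cell (hT₂ e') (hopen₂ e' t' ht')
      have h : (d₂ e).ext (chord (v₂ e 0) (v₂ e 1) t) =
        (d₂ e').ext (chord (v₂ e' 0) (v₂ e' 1) t') := h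
      rw [← h] at h2
      obtain rfl : e = e' := hinj₂ (MaxDisc.cell_eq_of_mem
        (h𝒟.eq_of_centre _ (hd₂ e) _ (hd₂ e')) (hT₂ e) (hT₂ e') h1 h2).1
      have h3 := chord_injective (hne₂ e)
        (MaxDisc.injOn_ext (hT₂ e) (hopen₂ e t ht) (hopen₂ e t' ht') h)
      obtain rfl : t = t' := Subtype.ext h3
      rfl
    · rintro ⟨f, x, hx⟩ ⟨f', x', hx'⟩ h
      have h1 := MaxDisc.ext_mem_cell (hT₃ f) (hopen₃ f x hx)
      have h2 := MaxDisc.ext_mem_cell (hT₃ f') (hopen₃ f' x' hx')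
      have h : (d₃ f).ext (combo (v₃ f) x.1) = (d₃ f').ext (combo (v₃ f') x'.1) := h
      rw [← h] at h2
      obtain rfl : f = f' := hinj₃ (MaxDisc.cell_eq_of_mem
        (h𝒟.eq_of_centre _ (hd₃ f) _ (hd₃ f')) (hT₃ f) (hT₃ f') h1 h2).1
      have h3 := combo_injective (hv₃ f) (fun i => (d₃ f).norm_V _ (hV₃ f i)) x.2.2 x'.2.2
        (MaxDisc.injOn_ext (hT₃ f) (hopen₃ f x hx) (hopen₃ f x' hx') h)
      obtain rfl : x = x' := Subtype.ext h3
      rfl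
    · rintro ⟨e, t, ht⟩ ⟨f, x, hx⟩ h
      have h1 := MaxDisc.ext_mem_cell (hT₂ e) (hopen₂ e t ht)
      have h2 := MaxDisc.ext_mem_cell (hT₃ f) (hopen₃ f x hx)
      have h : (d₂ e).ext (chord (v₂ e 0) (v₂ e 1) t) = (d₃ f).ext (combo (v₃ f) x.1) := h
      rw [← h] at h2
      have h3 := (MaxDisc.cell_eq_of_mem
        (h𝒟.eq_of_centre _ (hd₂ e) _ (hd₃ f)) (hT₂ e) (hT₃ f) h1 h2).2
      -- Cells that meet have equally many vertices, so an open edge never meets an open triangle.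
      rw [hcard₂, hcard₃] at h3
      omega
    · rintro ⟨p, hp⟩ (⟨e, t, ht⟩ | ⟨f, x, hx⟩) h
      · exact MaxDisc.ext_notMem (hT₂ e) (hopen₂ e t ht) (Eq.subst (motive := (· ∈ Z)) h hp)
      · exact MaxDisc.ext_notMem (hT₃ f) (hopen₃ f x hx) (Eq.subst (motive := (· ∈ Z)) h hp)
  · intro y
    by_cases hy : y ∈ Z
    · exact ⟨Sum.inl ⟨y, hy⟩, rfl⟩
    obtain ⟨d, hd, T, hT, hyT⟩ := h𝒟.exists_mem_cell hq hZ hne hy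
    rcases d.isTri.card T hT with hcard | hcard
    · obtain ⟨e, he⟩ := hsurj₂ d hd T hT hcard
      rw [he] at hyT
      obtain ⟨z, hz, rfl⟩ := hyT
      obtain ⟨t, ht0, ht1, rfl⟩ := exists_chord_eq (hne₂ e) hz
      exact ⟨Sum.inr (Sum.inl ⟨e, ⟨t, ht0.le, ht1.le⟩, ht0, ht1⟩),
        (d₂ e).ext_eq (MaxDisc.openSimplex_subset (hT₂ e) hz)⟩
    · obtain ⟨f, hf⟩ := hsurj₃ d hd T hT hcard
      rw [hf] at hyT
      obtain ⟨z, hz, rfl⟩ := hyT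
      obtain ⟨w, hw, hw1, rfl⟩ := exists_combo_eq (hv₃ f) hz
      exact ⟨Sum.inr (Sum.inr ⟨f, ⟨w, fun i => (hw i).le, hw1⟩, hw⟩),
        (d₃ f).ext_eq (MaxDisc.openSimplex_subset (hT₃ f) hz)⟩

end Extension
end HalfTranslation

theorem lemma2p4 {S : Type*} [TopologicalSpace S] [T2Space S] [CompactSpace S] [ConnectedSpace S]
    [ChartedSpace ℂ S] [IsManifold 𝓘(ℂ) ω S]
    (Z : Set S) (hZ : Z.Finite) (hne : Z.Nonempty)
    (q : HalfTranslation.QuadDiff S) (hq : q.IsMarkedBy Z) :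
    ∃ τ : HalfTranslation.Triangulation S Z, τ.IsStraight q := by
  obtain ⟨τ, hτ⟩ := HalfTranslation.exists_triangulation hq hZ hne
  exact ⟨τ, fun e => ⟨τ.edge e, hτ e, rfl⟩⟩
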